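/- Let $G$ be a (finite-dimensional, Hausdorff, real) Lie group with Lie algebra $\mathfrak g=T_1G$ and an $\mathrm{Ad}(G)$-invariant inner product $\cdot$ on $\mathfrak g$ (for instance $G$ compact and connected). Let $\alpha,\bar\alpha\in\Omega^1(G)\otimes\mathfrak g$ be the left- and right-invariant Maurer--Cartan forms, let $\lambda=\tfrac16\,\alpha\cdot[\alpha,\alpha]\in\Omega^3(G)$, and let $\Omega=\alpha_1\cdot\bar\alpha_2\in\Omega^2(G\times G)$, where $\alpha_1=\pi_1^*\alpha$, $\bar\alpha_2=\pi_2^*\bar\alpha$ and $\pi_1,\pi_2:G\times G\to G$ are the projections. (Wedge products of 1-forms are alternating sums of tensor products, without factorial normalization.) Let $g\ge 0$, let $\mathbb F$ be the free group on $x_1,\dots,x_{2g}$, let $R=\prod_{i=1}^g[x_{2i-1},x_{2i}]$ with $[a,b]=aba^{-1}b^{-1}$, and let $c=\sum_{i=1}^{2g}(\partial R/\partial x_i,\,x_i)$ be the associated group 2-chain, extended $\mathbb Z$-linearly in the first entry, where $\partial/\partial x_i:\mathbb F\to\mathbb Z[\mathbb F]$ is the Fox derivative. Identify $\mathrm{Hom}(\mathbb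 F,G)$ with $G^{2g}$, and for $h\in\mathrm{Hom}(\mathbb F,G)$ put $\varepsilon_R(h)=h(R)$. Writing $c=\sum_j n_j(a_j,b_j)$, let $$\omega=\langle c,E^*\Omega\rangle=\sum_j n_j\,\bigl(h\mapsto (h(a_j),h(b_j))\bigr)^*\Omega\in\Omega^2(G^{2g}).$$ Let $\exp:\mathfrak g\to G$ be the exponential map and let $\sigma=I(\exp^*\lambda)\in\Omega^2(\mathfrak g)$, where $I$ is the Poincaré homotopy operator $$(I\gamma)_v=\int_0^1F_t^*(\iota_{\bar v}\gamma)\,dt,$$ $\bar v$ being the constant vector field on $\mathfrak g$ with value $v$ and $F_t$ multiplication by $t$. Let $\tilde\omega=\mathrm{pr}_1^*\omega+\mathrm{pr}_2^*\sigma$ on $G^{2g}\times\mathfrak g$. For a central element $\beta\in Z(G)$ let $$X_\beta=\{(h,\Lambda)\in G^{2g}\times\mathfrak g:\ \varepsilon_R(h)=\beta\exp\Lambda\}.$$ Then $\tilde\omega$ is a smooth 2-form on $G^{2g}\times\mathfrak g$ which restricts on $X_\beta$ to a closed form, in both of the following senses: (a) for every $p=(h,\Lambda)\in X_\beta$, the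 3-form $d\tilde\omega$ vanishes at $p$ on all triples of vectors of the Zariski tangent space $\{(H,\zeta)\in T_hG^{2g}\times\mathfrak g:\ (d\varepsilon_R)_hH=(d(\beta\exp))_\Lambda\zeta\}$; (b) for every finite-dimensional smooth manifold $N$ (without boundary) and every smooth map $f:N\to G^{2g}\times\mathfrak g$ with $f(N)\subset X_\beta$ (in particular for the inclusion of the smooth locus of $X_\beta$), the form $f^*\tilde\omega$ is smooth and closed. Moreover, let $k\in G$ act on $G^{2g}\times\mathfrak g$ by conjugation on every factor $G$ and by $\mathrm{Ad}_k$ on $\mathfrak g$. Then this action maps $X_\beta$ into itself and leaves $\tilde\omega$ invariant. -/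

import Mathlib

open Set
open scoped Manifold ContDiff

noncomputable section

namespace ExtendedModuli

/-! ### Differential forms on manifolds -/

section Forms

variable {E : Type*} [NormedAddCommGroup E] [NormedSpace ℝ E]
  {H : Type*} [TopologicalSpace H] (I : ModelWithCorners ℝ E H)
  (M : Type*) [TopologicalSpace M] [ChartedSpace H M]
  {E' : Type*} [NormedAddCommGroup E'] [NormedSpace ℝ E']
  {H' : Type*} [TopologicalSpace H'] (I' : ModelWithCorners ℝ E' H')
  {M' : Type*} [TopologicalSpace M'] [ChartedSpace H' M']

/-- Real differential `k`-forms on a manifold, with no regularity imposed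
(see `DForm.IsSmooth`). -/
abbrev DForm (k : ℕ) : Type _ := ∀ x : M, TangentSpace I x [⋀^Fin k]→L[ℝ] ℝ

variable {M}

/-- The representation of a form in the preferred chart around `x₀`: its pullback under the
inverse of the chart, a form on the model vector space. -/
def DForm.inChart {k : ℕ} (η : DForm I M k) (x₀ : M) : E → E [⋀^Fin k]→L[ℝ] ℝ := fun y =>
  (η ((extChartAt I x₀).symm y)).compContinuousLinearMap
    (mfderivWithin 𝓘(ℝ, E) I (extChartAt I x₀).symm (range I) y)

/-- A form is smooth if it is smooth in every chart. -/
def DForm.IsSmooth {k : ℕ} (η : DForm I M k) : Prop :=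
  ∀ x₀ : M, ContDiffOn ℝ ∞ (η.inChart I x₀) (extChartAt I x₀).target

/-- The exterior derivative, computed at `x` in the preferred chart around `x`. -/
def DForm.d {k : ℕ} (η : DForm I M k) : DForm I M (k + 1) := fun x =>
  (extDerivWithin (η.inChart I x) (range I) (extChartAt I x x)).compContinuousLinearMap
    (mfderiv I 𝓘(ℝ, E) (extChartAt I x) x)

/-- A closed form: a smooth form with vanishing exterior derivative. -/
def DForm.IsClosed {k : ℕ} (η : DForm I M k) : Prop :=
  η.IsSmooth I ∧ η.d I = 0

/-- The pullback `f^* η`. -/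
def DForm.pullback {k : ℕ} (f : M → M') (η : DForm I' M' k) : DForm I M k := fun x =>
  (η (f x)).compContinuousLinearMap (mfderiv I I' f x)

end Forms

/-! ### The homotopy operator of the Poincaré lemma -/

/-- The homotopy operator on a vector space `V`:
`(I γ)_v = ∫₀¹ F_t^* (ι_v̄ γ) dt`, where `v̄` is the constant vector field with value `v` and `F_t`
is multiplication by `t`. -/
def homotopyOp {V : Type*} [NormedAddCommGroup V] [NormedSpace ℝ V] {k : ℕ}
    (γ : DForm 𝓘(ℝ, V) V (k + 1)) : DForm 𝓘(ℝ, V) V k := fun v =>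
  let β : V → V [⋀^Fin (k + 1)]→L[ℝ] ℝ := γ
  (∫ t in (0 : ℝ)..1,
    ((β (t • v)).curryLeft v).compContinuousLinearMap (t • ContinuousLinearMap.id ℝ V) :
      V [⋀^Fin k]→L[ℝ] ℝ)

/-! ### Fox calculus and the distinguished group chain -/

section Fox

/-- The affine permutation `z ↦ x_j z + δ_{ij}` of the integral group ring of the free group. -/
def foxAffine {ι : Type*} [DecidableEq ι] (i j : ι) :
    Equiv.Perm (MonoidAlgebra ℤ (FreeGroup ι)) :=
  (Units.mulLeft (Units.map (MonoidAlgebra.of ℤ (FreeGroup ι)) (toUnits (FreeGroup.of j)))).trans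
    (Equiv.addRight (if j = i then 1 else 0))

/-- The Fox derivative `∂w/∂x_i ∈ ℤ[F]`: the translation part of the affine map `z ↦ w z + ∂w/∂x_i`
by which `w` acts. It is characterized by `foxDeriv_of` and `foxDeriv_mul` below. -/
def foxDeriv {ι : Type*} [DecidableEq ι] (i : ι) (w : FreeGroup ι) :
    MonoidAlgebra ℤ (FreeGroup ι) :=
  FreeGroup.lift (foxAffine i) w 0

variable {ι : Type*} [DecidableEq ι]

theorem lift_foxAffine (i : ι) (w : FreeGroup ι) (z : MonoidAlgebra ℤ (FreeGroup ι)) :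
    FreeGroup.lift (foxAffine i) w z = MonoidAlgebra.of ℤ _ w * z + foxDeriv i w := by
  have key : ∀ w : FreeGroup ι, ∃ c, ∀ z,
      FreeGroup.lift (foxAffine i) w z = MonoidAlgebra.of ℤ _ w * z + c := by
    intro w
    induction w using FreeGroup.induction_on with
    | C1 => exact ⟨0, fun z => by simp [MonoidAlgebra.one_def.symm]⟩
    | of j => exact ⟨if j = i then 1 else 0, fun z => by simp [foxAffine]⟩
    | inv_of j hj =>
      obtain ⟨c, hc⟩ := hj
      refine ⟨-(MonoidAlgebra.of ℤ _ (FreeGroup.of j)⁻¹ * c), fun z => ?_⟩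
      rw [map_inv, Equiv.Perm.inv_eq_iff_eq, hc, mul_add, mul_neg, ← mul_assoc, ← mul_assoc,
        ← map_mul, mul_inv_cancel, map_one, one_mul, one_mul, neg_add_cancel_right]
    | mul u v hu hv =>
      obtain ⟨c, hc⟩ := hu
      obtain ⟨e, he⟩ := hv
      exact ⟨MonoidAlgebra.of ℤ _ u * e + c, fun z => by
        rw [map_mul, Equiv.Perm.mul_apply, he, hc, map_mul, mul_add, mul_assoc, add_assoc]⟩
  obtain ⟨c, hc⟩ := key w
  rw [foxDeriv, hc z, hc 0, mul_zero, zero_add]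

/-- `∂x_j/∂x_i = δ_{ij}`. -/
theorem foxDeriv_of (i j : ι) : foxDeriv i (FreeGroup.of j) = if j = i then 1 else 0 := by
  simp [foxDeriv, foxAffine]

/-- `∂(uv)/∂x_i = ∂u/∂x_i + u ∂v/∂x_i`. -/
theorem foxDeriv_mul (i : ι) (u v : FreeGroup ι) :
    foxDeriv i (u * v) = foxDeriv i u + MonoidAlgebra.of ℤ _ u * foxDeriv i v := by
  conv_lhs => rw [foxDeriv, map_mul, Equiv.Perm.mul_apply, lift_foxAffine i u]
  rw [add_comm]; rfl

/-- The surface relation `R = ∏ᵢ [x_{2i-1}, x_{2i}]` in the free group on `2g` generators (indexed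
from `0`), with `[a, b] = a b a⁻¹ b⁻¹`. -/
def surfaceRelation (g : ℕ) : FreeGroup (Fin (2 * g)) :=
  (List.ofFn fun i : Fin g =>
    let a := FreeGroup.of (⟨2 * i, by omega⟩ : Fin (2 * g))
    let b := FreeGroup.of (⟨2 * i + 1, by omega⟩ : Fin (2 * g))
    a * b * a⁻¹ * b⁻¹).prod

/-- The group `2`-chain `c = ∑ᵢ (∂R/∂x_i, x_i)`; here `2`-chains on a group `Γ` are
`ℤ`-linear combinations of elements of `Γ × Γ`. -/
def surfaceChain (g : ℕ) : (FreeGroup (Fin (2 * g)) × FreeGroup (Fin (2 * g))) →₀ ℤ :=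
  ∑ i : Fin (2 * g),
    (foxDeriv i (surfaceRelation g)).coeff.mapDomain fun a => (a, FreeGroup.of i)

end Fox

/-! ### Lie groups

The Lie algebra `𝔤 = T₁G` (Mathlib's `GroupLieAlgebra I G`) is, as a vector space, the model space
`E`, and is written `E` below; this gives it its structure of a normed space. -/

section LieGroups

variable {E : Type*} [NormedAddCommGroup E] [NormedSpace ℝ E]
  {H : Type*} [TopologicalSpace H] (I : ModelWithCorners ℝ E H)
  {G : Type*} [TopologicalSpace G] [ChartedSpace H G] [Group G]

/-- The left-invariant Maurer-Cartan form: `α_a (u) = (L_{a⁻¹})_* u ∈ T₁G = 𝔤`. -/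
def maurerCartan (a : G) : TangentSpace I a →L[ℝ] E :=
  mfderiv I I (fun x : G => a⁻¹ * x) a

/-- The right-invariant Maurer-Cartan form: `ᾱ_a (u) = (R_{a⁻¹})_* u ∈ T₁G = 𝔤`. -/
def maurerCartanRight (a : G) : TangentSpace I a →L[ℝ] E :=
  mfderiv I I (fun x : G => x * a⁻¹) a

/-- The adjoint action of `a` on `𝔤`: the derivative at `1` of conjugation by `a`. -/
def lieAdjoint (a : G) : E →L[ℝ] E :=
  mfderiv I I (fun x : G => a * x * a⁻¹) 1

variable (G) in
/-- The exponential map of `G`: `exp v = γ 1`, for `γ` the integral curve through `1` of the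
left-invariant vector field with value `v` at `1`. -/
def lieExp (v : E) : G :=
  open Classical in
  if h : ∃ γ : ℝ → G, γ 0 = 1 ∧
      IsMIntegralCurve γ (mulInvariantVectorField (I := I) (v : GroupLieAlgebra I G)) then
    h.choose 1
  else 1

variable (G) in
/-- An invariant inner product on `𝔤`. -/
structure IsInvariantInnerProduct (B : E →L[ℝ] E →L[ℝ] ℝ) : Prop where
  symm : ∀ x y, B x y = B y x
  pos : ∀ x, x ≠ 0 → 0 < B x x
  invariant : ∀ (a : G) (x y : E), B (lieAdjoint I a x) (lieAdjoint I a y) = B x y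

section Bracket

variable [FiniteDimensional ℝ E] [LieGroup I ∞ G]

variable (G) in
/-- The Lie bracket of `𝔤` as a continuous bilinear map. -/
def lieBracketL : E →L[ℝ] E →L[ℝ] E :=
  haveI : CompleteSpace E := FiniteDimensional.complete ℝ E
  haveI : LieGroup I (minSmoothness ℝ 3) G :=
    LieGroup.of_le (n := ∞) (by rw [minSmoothness_of_isRCLikeNormedField]; exact ENat.LEInfty.out)
  let br : GroupLieAlgebra I G →ₗ[ℝ] GroupLieAlgebra I G →ₗ[ℝ] GroupLieAlgebra I G :=
    LinearMap.mk₂ ℝ (fun x y => ⁅x, y⁆) add_lie smul_lie lie_add (fun c x y => lie_smul c x y)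
  let br' : E →ₗ[ℝ] E →ₗ[ℝ] E := br
  LinearMap.toContinuousLinearMap (LinearMap.toContinuousLinearMap.toLinearMap ∘ₗ br')

variable (G) in
theorem lieBracketL_apply (x y : GroupLieAlgebra I G) : lieBracketL I G x y = ⁅x, y⁆ := rfl

end Bracket

/-- The wedge product `B(φ ∧ ψ)` of two `E`-valued `1`-forms on `V`, contracted with `B`:
`(u, v) ↦ B (φ u) (ψ v) - B (φ v) (ψ u)`. -/
def wedgeTwo {V : Type*} [AddCommGroup V] [Module ℝ V] [TopologicalSpace V]
    [IsTopologicalAddGroup V] [ContinuousSMul ℝ V]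
    (B : E →L[ℝ] E →L[ℝ] ℝ) (φ ψ : V →L[ℝ] E) : V [⋀^Fin 2]→L[ℝ] ℝ :=
  ContinuousMultilinearMap.alternatization
    { toFun := fun u => B (φ (u 0)) (ψ (u 1))
      map_update_add' := by
        intro _ m i x y
        fin_cases i <;> simp [Function.update]
      map_update_smul' := by
        intro _ m i c x
        fin_cases i <;> simp [Function.update]
      cont := by fun_prop }

theorem wedgeTwo_apply {V : Type*} [AddCommGroup V] [Module ℝ V] [TopologicalSpace V]
    [IsTopologicalAddGroup V] [ContinuousSMul ℝ V]
    (B : E →L[ℝ] E →L[ℝ] ℝ) (φ ψ : V →L[ℝ] E) (u v : V) :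
    wedgeTwo B φ ψ ![u, v] = B (φ u) (ψ v) - B (φ v) (ψ u) := by
  have h : (Finset.univ : Finset (Equiv.Perm (Fin 2))) = {1, Equiv.swap 0 1} := by decide
  rw [wedgeTwo, ContinuousMultilinearMap.alternatization_apply_apply, h,
    Finset.sum_pair (by decide)]
  simp [sub_eq_add_neg]
  rfl

/-- The wedge product `B(φ ∧ [φ ∧ φ])` of an `E`-valued `1`-form on `V` with itself, for a bilinear
bracket `br` on `E`. As for all `1`-forms it is the alternating sum, over all permutations of the
arguments, of the tensor product `(u, v, w) ↦ B (φ u) (br (φ v) (φ w))`. -/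
def wedgeThree {V : Type*} [AddCommGroup V] [Module ℝ V] [TopologicalSpace V]
    [IsTopologicalAddGroup V] [ContinuousSMul ℝ V]
    (B : E →L[ℝ] E →L[ℝ] ℝ) (br : E →L[ℝ] E →L[ℝ] E) (φ : V →L[ℝ] E) : V [⋀^Fin 3]→L[ℝ] ℝ :=
  ContinuousMultilinearMap.alternatization
    { toFun := fun u => B (φ (u 0)) (br (φ (u 1)) (φ (u 2)))
      map_update_add' := by
        intro inst m i x y
        obtain rfl : inst = instDecidableEqFin 3 := Subsingleton.elim _ _
        obtain rfl | rfl | rfl : i = 0 ∨ i = 1 ∨ i = 2 := by omega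
        all_goals simp [Function.update_of_ne]
      map_update_smul' := by
        intro inst m i c x
        obtain rfl : inst = instDecidableEqFin 3 := Subsingleton.elim _ _
        obtain rfl | rfl | rfl : i = 0 ∨ i = 1 ∨ i = 2 := by omega
        all_goals simp [Function.update_of_ne]
      cont := by fun_prop }

variable (G) in
/-- The Cartan `3`-form `(1/6) α · [α, α]` on `G`. -/
def cartanForm [FiniteDimensional ℝ E] [LieGroup I ∞ G] (B : E →L[ℝ] E →L[ℝ] ℝ) : DForm I G 3 :=
  fun a => (1 / 6 : ℝ) • wedgeThree B (lieBracketL I G) (maurerCartan I a)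

variable (G) in
/-- The `2`-form `Ω = α₁ · ᾱ₂` on `G × G`, where `α₁ = π₁^* α` and `ᾱ₂ = π₂^* ᾱ`. -/
def omegaBar (B : E →L[ℝ] E →L[ℝ] ℝ) : DForm (I.prod I) (G × G) 2 := fun p =>
  wedgeTwo B ((maurerCartan I p.1).comp (mfderiv (I.prod I) I Prod.fst p))
    ((maurerCartanRight I p.2).comp (mfderiv (I.prod I) I Prod.snd p))

end LieGroups

/-! ### The forms on `G^{2g}` and on the extended moduli space -/

section Moduli

variable {E : Type*} [NormedAddCommGroup E] [NormedSpace ℝ E]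
  {H : Type*} [TopologicalSpace H] (I : ModelWithCorners ℝ E H)
  {G : Type*} [TopologicalSpace G] [ChartedSpace H G] [Group G]

/-- The model with corners of `G^{2g}`. -/
abbrev modelY (g : ℕ) : ModelWithCorners ℝ (Fin (2 * g) → E) (ModelPi fun _ : Fin (2 * g) => H) :=
  ModelWithCorners.pi fun _ : Fin (2 * g) => I

/-- The model with corners of `G^{2g} × 𝔤`. -/
abbrev modelYg (g : ℕ) : ModelWithCorners ℝ ((Fin (2 * g) → E) × E)
    (ModelProd (ModelPi fun _ : Fin (2 * g) => H) E) :=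
  (modelY I g).prod 𝓘(ℝ, E)

/-- The evaluation map `E_2` at a pair `(a, b)` of words:
`Hom(F, G) = G^{2g} → G × G`, `h ↦ (h(a), h(b))`. -/
def evalTwo {g : ℕ} (ab : FreeGroup (Fin (2 * g)) × FreeGroup (Fin (2 * g)))
    (h : Fin (2 * g) → G) : G × G :=
  (FreeGroup.lift h ab.1, FreeGroup.lift h ab.2)

variable (G) in
/-- The `2`-form `ω = ⟨c, E^* Ω⟩` on `G^{2g}`. -/
def omegaForm (B : E →L[ℝ] E →L[ℝ] ℝ) (g : ℕ) : DForm (modelY I g) (Fin (2 * g) → G) 2 :=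
  (surfaceChain g).sum fun ab n =>
    (n : ℝ) • DForm.pullback (modelY I g) (I.prod I) (evalTwo ab) (omegaBar I G B)

/-- The map `ε_R : G^{2g} → G`, evaluation at the surface relation `R`. -/
def epsR {G : Type*} [Group G] {g : ℕ} (h : Fin (2 * g) → G) : G := FreeGroup.lift h (surfaceRelation g)

theorem epsR_eq {G : Type*} [Group G] {g : ℕ} (h : Fin (2 * g) → G) :
    epsR h = (List.ofFn fun i : Fin g =>
      h ⟨2 * i, by omega⟩ * h ⟨2 * i + 1, by omega⟩ *
        (h ⟨2 * i, by omega⟩)⁻¹ * (h ⟨2 * i + 1, by omega⟩)⁻¹).prod := by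
  simp [epsR, surfaceRelation, map_list_prod, List.map_ofFn, Function.comp_def]

/-- The map `e_β = β · exp : 𝔤 → G`. -/
def expBeta (β : G) (Λ : E) : G := β * lieExp I G Λ

variable (G) in
/-- The `2`-form `σ = I(exp^* λ)` on `𝔤`, where `λ` is the Cartan `3`-form. -/
def sigmaForm [FiniteDimensional ℝ E] [LieGroup I ∞ G] (B : E →L[ℝ] E →L[ℝ] ℝ) :
    DForm 𝓘(ℝ, E) E 2 :=
  homotopyOp (DForm.pullback 𝓘(ℝ, E) I (lieExp I G) (cartanForm I G B))

variable (G) in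
/-- The `2`-form `ω̃ = pr₁^* ω + pr₂^* σ` on `G^{2g} × 𝔤`. -/
def omegaTilde [FiniteDimensional ℝ E] [LieGroup I ∞ G] (B : E →L[ℝ] E →L[ℝ] ℝ) (g : ℕ) :
    DForm (modelYg I g) ((Fin (2 * g) → G) × E) 2 :=
  DForm.pullback (modelYg I g) (modelY I g) Prod.fst (omegaForm I G B g) +
    DForm.pullback (modelYg I g) 𝓘(ℝ, E) Prod.snd (sigmaForm I G B)

/-- The extended moduli space `X_β = {(h, Λ) : ε_R(h) = β exp Λ} ⊆ G^{2g} × 𝔤`. -/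
def extendedModuli (g : ℕ) (β : G) : Set ((Fin (2 * g) → G) × E) :=
  {p | epsR p.1 = expBeta I β p.2}

/-- The Zariski tangent space `{(H, ζ) : (ε_R)_* H = (e_β)_* ζ}` of `X_β` at `p = (h, Λ)`. At points
of `X_β` both sides of the equation lie in the same tangent space of `G`. -/
def zariskiTangent {g : ℕ} (β : G) (p : (Fin (2 * g) → G) × E) : Set ((Fin (2 * g) → E) × E) :=
  {u | (mfderiv (modelY I g) I epsR p.1 u.1 : E) = (mfderiv 𝓘(ℝ, E) I (expBeta I β) p.2 u.2 : E)}

/-- The action of `k ∈ G` on `G^{2g} × 𝔤`: conjugation on every factor of `G^{2g}` and the adjoint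
action on `𝔤`. -/
def conjAction {g : ℕ} (k : G) (p : (Fin (2 * g) → G) × E) : (Fin (2 * g) → G) × E :=
  (fun i => k * p.1 i * k⁻¹, lieAdjoint I k p.2)

end Moduli

end ExtendedModuli

end

open ExtendedModuli

open scoped Topology

set_option linter.unusedSectionVars false

noncomputable section

namespace ExtendedModuli

/-! ### Calculus of forms on finite-dimensional vector spaces -/

section VectorForms

variable {V : Type*} [NormedAddCommGroup V] [NormedSpace ℝ V]
  {E : Type*} [NormedAddCommGroup E] [NormedSpace ℝ E]

/-- Evaluation of alternating forms at all tuples of vectors of a basis. -/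
def evalBasis [FiniteDimensional ℝ V] (k : ℕ) :
    (V [⋀^Fin k]→L[ℝ] ℝ) →ₗ[ℝ] ((Fin k → Fin (Module.finrank ℝ V)) → ℝ) where
  toFun η m := η fun i => Module.finBasis ℝ V (m i)
  map_add' _ _ := rfl
  map_smul' _ _ := rfl

theorem evalBasis_injective [FiniteDimensional ℝ V] (k : ℕ) :
    Function.Injective (evalBasis (V := V) k) := by
  intro η ξ h
  apply ContinuousAlternatingMap.toAlternatingMap_injective
  exact (Module.finBasis ℝ V).ext_alternating fun m _ => congrFun h m

/-- A family of forms on a finite-dimensional space is smooth if all its evaluations are. -/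
theorem contDiffAt_form [FiniteDimensional ℝ V] {X : Type*} [NormedAddCommGroup X]
    [NormedSpace ℝ X] {k : ℕ} {n : WithTop ℕ∞} {η : X → V [⋀^Fin k]→L[ℝ] ℝ} {x : X}
    (h : ∀ m : Fin k → V, ContDiffAt ℝ n (fun y => η y m) x) : ContDiffAt ℝ n η x := by
  have : FiniteDimensional ℝ (V [⋀^Fin k]→L[ℝ] ℝ) :=
    FiniteDimensional.of_injective (evalBasis k) (evalBasis_injective k)
  obtain ⟨r, hr⟩ := (evalBasis (V := V) k).exists_leftInverse_of_injective
    (LinearMap.ker_eq_bot.2 (evalBasis_injective k))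
  have h1 : ContDiffAt ℝ n (fun y => evalBasis k (η y)) x :=
    contDiffAt_pi.2 fun m => h _
  have h2 := (LinearMap.toContinuousLinearMap r).contDiff.contDiffAt.comp x h1
  refine h2.congr_of_eventuallyEq (Filter.Eventually.of_forall fun y => ?_)
  exact (LinearMap.congr_fun hr (η y)).symm

/-- The properties of an inner product and a bracket that enter the form computations. -/
structure IsInvariantPairing (B : E →L[ℝ] E →L[ℝ] ℝ) (br : E →L[ℝ] E →L[ℝ] E) : Prop where
  symm : ∀ x y, B x y = B y x
  skew : ∀ x y, br x y = -br y x
  jacobi : ∀ x y z, br x (br y z) + br y (br z x) + br z (br x y) = 0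
  invariant : ∀ x y z, B (br x y) z = B x (br y z)

/-- The form `(1/6) φ · [φ, φ]` on `V`. -/
def cubicForm (B : E →L[ℝ] E →L[ℝ] ℝ) (br : E →L[ℝ] E →L[ℝ] E) (φ : V →L[ℝ] E) :
    V [⋀^Fin 3]→L[ℝ] ℝ := (1 / 6 : ℝ) • wedgeThree B br φ

theorem wedgeTwo_apply' (B : E →L[ℝ] E →L[ℝ] ℝ) (φ ψ : V →L[ℝ] E) (u : Fin 2 → V) :
    wedgeTwo B φ ψ u = B (φ (u 0)) (ψ (u 1)) - B (φ (u 1)) (ψ (u 0)) := by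
  have : u = ![u 0, u 1] := by ext i; fin_cases i <;> rfl
  conv_lhs => rw [this]
  exact wedgeTwo_apply B φ ψ _ _

variable {B : E →L[ℝ] E →L[ℝ] ℝ} {br : E →L[ℝ] E →L[ℝ] E}

theorem IsInvariantPairing.cycle (h : IsInvariantPairing B br) (x y z : E) :
    B y (br z x) = B x (br y z) := by
  rw [← h.invariant, h.symm]

theorem IsInvariantPairing.swap (h : IsInvariantPairing B br) (x y z : E) :
    B x (br z y) = -B x (br y z) := by
  rw [h.skew z y, map_neg]

theorem cubicForm_apply (h : IsInvariantPairing B br) (φ : V →L[ℝ] E) (u : Fin 3 → V) :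
    cubicForm B br φ u = B (φ (u 0)) (br (φ (u 1)) (φ (u 2))) := by
  have hu : (Finset.univ : Finset (Equiv.Perm (Fin 3))) =
      {1, Equiv.swap 0 1, Equiv.swap 0 2, Equiv.swap 1 2, Equiv.swap 0 1 * Equiv.swap 1 2,
        Equiv.swap 1 2 * Equiv.swap 0 1} := by decide
  have e : wedgeThree B br φ u = ∑ σ : Equiv.Perm (Fin 3), Equiv.Perm.sign σ •
      B (φ (u (σ 0))) (br (φ (u (σ 1))) (φ (u (σ 2)))) :=
    ContinuousMultilinearMap.alternatization_apply_apply _ _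
  have s1 : Equiv.Perm.sign (Equiv.swap (0 : Fin 3) 1) = -1 := by decide
  have s2 : Equiv.Perm.sign (Equiv.swap (0 : Fin 3) 2) = -1 := by decide
  have s3 : Equiv.Perm.sign (Equiv.swap (1 : Fin 3) 2) = -1 := by decide
  have s4 : Equiv.Perm.sign (Equiv.swap (0 : Fin 3) 1 * Equiv.swap 1 2) = 1 := by decide
  have s5 : Equiv.Perm.sign (Equiv.swap (1 : Fin 3) 2 * Equiv.swap 0 1) = 1 := by decide
  rw [cubicForm, ContinuousAlternatingMap.smul_apply, e, hu]
  rw [Finset.sum_insert (by decide), Finset.sum_insert (by decide), Finset.sum_insert (by decide),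
    Finset.sum_insert (by decide), Finset.sum_pair (by decide), s1, s2, s3, s4, s5]
  have p1 : (Equiv.swap (0 : Fin 3) 1) 2 = 2 := by decide
  have p2 : (Equiv.swap (0 : Fin 3) 2) 1 = 1 := by decide
  have p3 : (Equiv.swap (1 : Fin 3) 2) 0 = 0 := by decide
  simp only [Equiv.Perm.sign_one, one_smul, Equiv.Perm.coe_one, id, Equiv.swap_apply_left,
    Equiv.swap_apply_right, Equiv.Perm.coe_mul, Function.comp, p1, p2, p3, Units.neg_smul,
    smul_eq_mul]
  set x := φ (u 0); set y := φ (u 1); set z := φ (u 2)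
  have e1 := h.swap y z x
  have e2 := h.cycle x y z
  have e3 := h.swap z x y
  have e4 := h.cycle y z x
  have e5 := h.swap x y z
  linarith

theorem contDiffAt_wedgeTwo [FiniteDimensional ℝ V] {X : Type*} [NormedAddCommGroup X]
    [NormedSpace ℝ X] {n : WithTop ℕ∞} {A C : X → V →L[ℝ] E} {x : X}
    (hA : ContDiffAt ℝ n A x) (hC : ContDiffAt ℝ n C x) :
    ContDiffAt ℝ n (fun y => wedgeTwo B (A y) (C y)) x := by
  refine contDiffAt_form fun m => ?_
  simp only [wedgeTwo_apply']
  fun_prop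

theorem contDiffAt_cubicForm [FiniteDimensional ℝ V] {X : Type*} [NormedAddCommGroup X]
    [NormedSpace ℝ X] {n : WithTop ℕ∞} {A : X → V →L[ℝ] E} {x : X}
    (h : IsInvariantPairing B br) (hA : ContDiffAt ℝ n A x) :
    ContDiffAt ℝ n (fun y => cubicForm B br (A y)) x := by
  refine contDiffAt_form fun m => ?_
  simp only [cubicForm_apply h]
  fun_prop

theorem fderiv_pairing {A C : V → V →L[ℝ] E} {y : V} (hA : DifferentiableAt ℝ A y)
    (hC : DifferentiableAt ℝ C y) (a b w : V) :
    fderiv ℝ (fun x => B (A x a) (C x b)) y w =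
      B (fderiv ℝ A y w a) (C y b) + B (A y a) (fderiv ℝ C y w b) := by
  have h1 : HasFDerivAt (fun x => A x a) ((fderiv ℝ A y).flip a) y := by
    simpa using hA.hasFDerivAt.clm_apply (hasFDerivAt_const a y)
  have h2 : HasFDerivAt (fun x => C x b) ((fderiv ℝ C y).flip b) y := by
    simpa using hC.hasFDerivAt.clm_apply (hasFDerivAt_const b y)
  have h3 := (B.hasFDerivAt.comp y h1).clm_apply h2
  rw [show (fun x => B (A x a) (C x b)) = fun x => (B ∘ fun x => A x a) x (C x b) from rfl,
    h3.fderiv]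
  simp [add_comm]

theorem fderiv_triple {A : V → V →L[ℝ] E} {y : V} (hA : DifferentiableAt ℝ A y) (a b c w : V) :
    fderiv ℝ (fun x => B (A x a) (br (A x b) (A x c))) y w =
      B (fderiv ℝ A y w a) (br (A y b) (A y c)) + B (A y a) (br (fderiv ℝ A y w b) (A y c)) +
        B (A y a) (br (A y b) (fderiv ℝ A y w c)) := by
  have h1 : ∀ a, HasFDerivAt (fun x => A x a) ((fderiv ℝ A y).flip a) y := fun a => by
    simpa using hA.hasFDerivAt.clm_apply (hasFDerivAt_const a y)
  have h3 := (B.hasFDerivAt.comp y (h1 a)).clm_apply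
    ((br.hasFDerivAt.comp y (h1 b)).clm_apply (h1 c))
  rw [show (fun x => B (A x a) (br (A x b) (A x c))) = fun x => (B ∘ fun x => A x a) x
    ((br ∘ fun x => A x b) x (A x c)) from rfl, h3.fderiv]
  simp
  ring

/-- The exterior derivative of `A · C` when `dA = -[A, A]` and `dC = [C, C]`. -/
theorem extDeriv_wedgeTwo [FiniteDimensional ℝ V] (h : IsInvariantPairing B br)
    {A C : V → V →L[ℝ] E} {y : V} (hA : ContDiffAt ℝ 1 A y) (hC : ContDiffAt ℝ 1 C y)
    (dA : ∀ u v, fderiv ℝ A y u v - fderiv ℝ A y v u = -br (A y u) (A y v))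
    (dC : ∀ u v, fderiv ℝ C y u v - fderiv ℝ C y v u = br (C y u) (C y v)) :
    extDeriv (fun x => wedgeTwo B (A x) (C x)) y =
      cubicForm B br (A y) + cubicForm B br (C y) - cubicForm B br (A y + C y) := by
  have dA' := hA.differentiableAt one_ne_zero
  have dC' := hC.differentiableAt one_ne_zero
  ext u
  rw [extDeriv_apply ((contDiffAt_wedgeTwo hA hC).differentiableAt one_ne_zero)]
  refine (Fin.sum_univ_three _).trans ?_
  have key : ∀ a b w, fderiv ℝ (fun x => B (A x a) (C x b) - B (A x b) (C x a)) y w =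
      B (fderiv ℝ A y w a) (C y b) + B (A y a) (fderiv ℝ C y w b) -
      (B (fderiv ℝ A y w b) (C y a) + B (A y b) (fderiv ℝ C y w a)) := by
    intro a b w
    rw [fderiv_fun_sub (by fun_prop) (by fun_prop), sub_apply,
      fderiv_pairing dA' dC', fderiv_pairing dA' dC']
  simp only [wedgeTwo_apply', key, Fin.removeNth,
    ContinuousAlternatingMap.sub_apply, ContinuousAlternatingMap.add_apply, cubicForm_apply h]
  simp only [show (0 : Fin 3).succAbove 0 = 1 from rfl, show (0 : Fin 3).succAbove 1 = 2 from rfl,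
    show (1 : Fin 3).succAbove 0 = 0 from rfl, show (1 : Fin 3).succAbove 1 = 2 from rfl,
    show (2 : Fin 3).succAbove 0 = 0 from rfl, show (2 : Fin 3).succAbove 1 = 1 from rfl]
  have eA : ∀ u v z, B (fderiv ℝ A y u v) z - B (fderiv ℝ A y v u) z =
      -B (br (A y u) (A y v)) z := fun u v z => by
    rw [← sub_apply, ← map_sub, dA, map_neg, neg_apply]
  have eC : ∀ u v z, B z (fderiv ℝ C y u v) - B z (fderiv ℝ C y v u) =
      B z (br (C y u) (C y v)) := fun u v z => by
    rw [← map_sub, dC]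
  simp only [map_add, add_apply]
  have a1 := eA (u 0) (u 1) (C y (u 2))
  have a2 := eA (u 0) (u 2) (C y (u 1))
  have a3 := eA (u 1) (u 2) (C y (u 0))
  have c1 := eC (u 0) (u 1) (A y (u 2))
  have c2 := eC (u 0) (u 2) (A y (u 1))
  have c3 := eC (u 1) (u 2) (A y (u 0))
  simp only [h.invariant] at a1 a2 a3
  generalize A y (u 0) = x0 at *
  generalize A y (u 1) = x1 at *
  generalize A y (u 2) = x2 at *
  generalize C y (u 0) = z0 at *
  generalize C y (u 1) = z1 at *
  generalize C y (u 2) = z2 at *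
  have f1 := h.cycle x0 z1 x2
  have f2 := h.swap x0 z1 x2
  have f3 := h.cycle z0 x1 x2
  have f4 := h.cycle x2 z0 z1
  have f5 := h.cycle x1 z0 z2
  have f6 := h.swap x1 z0 z2
  have f7 := h.cycle z0 z1 x2
  have f8 := h.cycle z0 x1 z2
  have f9 := h.cycle x0 x1 z2
  have f10 := h.cycle z1 x0 x2
  have f11 := h.cycle z0 x1 x2
  norm_num
  linarith

/-- The form `(1/6) A · [A, A]` is closed when `dA = -[A, A]`. -/
theorem extDeriv_cubicForm [FiniteDimensional ℝ V] (h : IsInvariantPairing B br)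
    {A : V → V →L[ℝ] E} {y : V} (hA : ContDiffAt ℝ 1 A y)
    (dA : ∀ u v, fderiv ℝ A y u v - fderiv ℝ A y v u = -br (A y u) (A y v)) :
    extDeriv (fun x => cubicForm B br (A x)) y = 0 := by
  have dA' := hA.differentiableAt one_ne_zero
  ext u
  rw [extDeriv_apply ((contDiffAt_cubicForm h hA).differentiableAt one_ne_zero)]
  refine (Fin.sum_univ_four _).trans ?_
  simp only [cubicForm_apply h, fderiv_triple dA', Fin.removeNth]
  simp only [show (0 : Fin 4).succAbove 0 = 1 from rfl, show (0 : Fin 4).succAbove 1 = 2 from rfl,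
    show (0 : Fin 4).succAbove 2 = 3 from rfl, show (1 : Fin 4).succAbove 0 = 0 from rfl,
    show (1 : Fin 4).succAbove 1 = 2 from rfl, show (1 : Fin 4).succAbove 2 = 3 from rfl,
    show (2 : Fin 4).succAbove 0 = 0 from rfl, show (2 : Fin 4).succAbove 1 = 1 from rfl,
    show (2 : Fin 4).succAbove 2 = 3 from rfl, show (3 : Fin 4).succAbove 0 = 0 from rfl,
    show (3 : Fin 4).succAbove 1 = 1 from rfl, show (3 : Fin 4).succAbove 2 = 2 from rfl]
  have r1 : ∀ p q s, B p (br q s) = B q (br s p) := fun p q s => (h.cycle p q s).symm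
  have eA : ∀ u v z, B (fderiv ℝ A y u v) z - B (fderiv ℝ A y v u) z =
      -B (br (A y u) (A y v)) z := fun u v z => by
    rw [← sub_apply, ← map_sub, dA, map_neg, neg_apply]
  have t1 : ∀ w b a c, B (A y a) (br (fderiv ℝ A y w b) (A y c)) =
      B (fderiv ℝ A y w b) (br (A y c) (A y a)) := fun w b a c => r1 _ _ _
  have t2 : ∀ w c a b, B (A y a) (br (A y b) (fderiv ℝ A y w c)) =
      B (fderiv ℝ A y w c) (br (A y a) (A y b)) := fun w c a b => (r1 _ _ _).symm
  simp only [t1, t2]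
  have a1 := eA (u 0) (u 1) (br (A y (u 2)) (A y (u 3)))
  have a2 := eA (u 0) (u 2) (br (A y (u 3)) (A y (u 1)))
  have a3 := eA (u 0) (u 3) (br (A y (u 1)) (A y (u 2)))
  have a4 := eA (u 1) (u 2) (br (A y (u 0)) (A y (u 3)))
  have a5 := eA (u 1) (u 3) (br (A y (u 2)) (A y (u 0)))
  have a6 := eA (u 2) (u 3) (br (A y (u 0)) (A y (u 1)))
  have sw : ∀ i j z, B z (br (A y (u i)) (A y (u j))) = -B z (br (A y (u j)) (A y (u i))) :=
    fun i j z => h.swap _ _ _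
  have b1 := sw 3 0 (fderiv ℝ A y (u 1) (u 2))
  have b2 := sw 3 0 (fderiv ℝ A y (u 2) (u 1))
  have b3 := sw 0 2 (fderiv ℝ A y (u 1) (u 3))
  have b4 := sw 0 2 (fderiv ℝ A y (u 3) (u 1))
  have b5 := sw 1 0 (fderiv ℝ A y (u 2) (u 3))
  have b6 := sw 1 0 (fderiv ℝ A y (u 3) (u 2))
  have b7 := sw 3 1 (fderiv ℝ A y (u 0) (u 2))
  have b8 := sw 3 1 (fderiv ℝ A y (u 2) (u 0))
  have b9 := sw 2 1 (fderiv ℝ A y (u 0) (u 3))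
  have b10 := sw 2 1 (fderiv ℝ A y (u 3) (u 0))
  have b11 := sw 3 2 (fderiv ℝ A y (u 0) (u 1))
  have b12 := sw 3 2 (fderiv ℝ A y (u 1) (u 0))
  simp only [h.invariant] at a1 a2 a3 a4 a5 a6
  have j := congrArg (B (A y (u 0))) (h.jacobi (A y (u 1)) (A y (u 2)) (A y (u 3)))
  simp only [map_add, map_zero] at j
  have k4 : B (A y (u 1)) (br (A y (u 2)) (br (A y (u 0)) (A y (u 3)))) =
      B (A y (u 0)) (br (A y (u 3)) (br (A y (u 1)) (A y (u 2)))) := by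
    rw [← h.invariant, r1, r1]
  have k5 : B (A y (u 1)) (br (A y (u 3)) (br (A y (u 2)) (A y (u 0)))) =
      B (A y (u 0)) (br (A y (u 2)) (br (A y (u 3)) (A y (u 1)))) := by
    rw [← h.invariant, r1, r1, h.swap, h.skew (A y (u 1)), map_neg, map_neg, neg_neg]
  have k6 : B (A y (u 2)) (br (A y (u 3)) (br (A y (u 0)) (A y (u 1)))) =
      B (A y (u 0)) (br (A y (u 1)) (br (A y (u 2)) (A y (u 3)))) := by
    rw [← h.invariant, r1, r1]
  norm_num
  linarith

end VectorForms

/-! ### Smoothness of composition operators and of parametric integrals -/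

section Composition

universe u

variable {K : Type*} [TopologicalSpace K]

/-- The pairing of a family of linear maps with a family of vectors. -/
def pointwisePairing (K : Type*) [TopologicalSpace K] [CompactSpace K]
    (E W : Type*) [NormedAddCommGroup E] [NormedSpace ℝ E] [NormedAddCommGroup W]
    [NormedSpace ℝ W] : C(K, E →L[ℝ] W) →L[ℝ] C(K, E) →L[ℝ] C(K, W) :=
  LinearMap.mkContinuous₂
    (LinearMap.mk₂ ℝ (fun (D : C(K, E →L[ℝ] W)) (h : C(K, E)) =>
        (⟨fun t => D t (h t), by fun_prop⟩ : C(K, W)))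
      (fun _ _ _ => rfl) (fun _ _ _ => rfl)
      (fun D h h' => by ext t; exact map_add (D t) _ _)
      (fun c D h => by ext t; exact map_smul (D t) _ _))
    1 fun (D : C(K, E →L[ℝ] W)) (h : C(K, E)) => by
      rw [one_mul, ContinuousMap.norm_le _ (by positivity)]
      intro t
      exact ((D t).le_opNorm _).trans
        (mul_le_mul (D.norm_coe_le_norm t) (h.norm_coe_le_norm t) (norm_nonneg _)
          (by exact norm_nonneg D))

theorem pointwisePairing_apply [CompactSpace K] {E W : Type*} [NormedAddCommGroup E]
    [NormedSpace ℝ E] [NormedAddCommGroup W] [NormedSpace ℝ W] (D : C(K, E →L[ℝ] W)) (h : C(K, E))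
    (t : K) : pointwisePairing K E W D h t = D t (h t) := rfl

/-- The operator of composition with a continuous map. -/
def compOperator (K : Type*) [TopologicalSpace K] {E W : Type*} [NormedAddCommGroup E]
    [NormedAddCommGroup W] {F : E → W} (hF : Continuous F) (γ : C(K, E)) : C(K, W) :=
  (⟨F, hF⟩ : C(E, W)).comp γ

theorem continuous_compOperator {E W : Type*} [NormedAddCommGroup E]
    [NormedAddCommGroup W] {F : E → W} (hF : Continuous F) : Continuous (compOperator K hF) :=
  ContinuousMap.continuous_postcomp _

theorem hasFDerivAt_compOperator [CompactSpace K] {E W : Type*} [NormedAddCommGroup E] [NormedSpace ℝ E]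
    [NormedAddCommGroup W] [NormedSpace ℝ W] {F : E → W} (hF : ContDiff ℝ 1 F) (γ : C(K, E)) :
    HasFDerivAt (compOperator K hF.continuous) (pointwisePairing K E W
      (compOperator K (hF.continuous_fderiv one_ne_zero) γ)) γ := by
  have hD := hF.continuous_fderiv one_ne_zero
  rw [hasFDerivAt_iff_isLittleO_nhds_zero, Asymptotics.isLittleO_iff]
  intro ε hε
  have hc := (continuous_compOperator (K := K) hD).continuousAt (x := γ)
  rw [Metric.continuousAt_iff] at hc
  obtain ⟨δ, hδ, hc⟩ := hc ε hε
  have key : ∀ t, ∀ z ∈ Metric.ball (γ t) δ, ‖fderiv ℝ F z - fderiv ℝ F (γ t)‖ ≤ ε := by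
    intro t z hz
    have h1 := @hc (γ + ContinuousMap.const K (z - γ t)) (by
      rw [dist_eq_norm, add_sub_cancel_left, ContinuousMap.norm_lt_iff _ hδ]
      intro _
      simpa [dist_eq_norm] using hz)
    rw [dist_eq_norm, ContinuousMap.norm_lt_iff _ hε] at h1
    simpa [compOperator] using (h1 t).le
  filter_upwards [Metric.ball_mem_nhds (0 : C(K, E)) hδ] with h hh
  rw [ContinuousMap.norm_le _ (by positivity)]
  intro t
  have hht : ‖h t‖ < δ := (h.norm_coe_le_norm t).trans_lt (by simpa using hh)
  have h2 := (convex_ball (γ t) δ).norm_image_sub_le_of_norm_hasFDerivWithin_le'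
    (f := F) (f' := fderiv ℝ F) (φ := fderiv ℝ F (γ t)) (C := ε)
    (fun z _ => (hF.differentiable one_ne_zero z).hasFDerivAt.hasFDerivWithinAt) (key t)
    (Metric.mem_ball_self hδ) (y := γ t + h t) (by simpa [dist_eq_norm] using hht)
  rw [add_sub_cancel_left] at h2
  refine le_trans (le_of_eq ?_) (h2.trans (mul_le_mul_of_nonneg_left (h.norm_coe_le_norm t) hε.le))
  rfl

theorem contDiff_compOperator [CompactSpace K] {E W : Type u} [NormedAddCommGroup E] [NormedSpace ℝ E]
    [NormedAddCommGroup W] [NormedSpace ℝ W] {F : E → W} (hF : ContDiff ℝ ∞ F) :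
    ContDiff ℝ ∞ (compOperator K hF.continuous) := by
  refine contDiff_infty.2 fun n => ?_
  induction n generalizing W with
  | zero => exact contDiff_zero.2 (continuous_compOperator _)
  | succ n ih =>
    have hD : ContDiff ℝ ∞ (fderiv ℝ F) := (contDiff_infty_iff_fderiv.1 hF).2
    push_cast
    rw [contDiff_succ_iff_hasFDerivAt]
    have hp : ContDiff ℝ n (pointwisePairing K E W) := ContinuousLinearMap.contDiff _
    exact ⟨fun γ => pointwisePairing K E W (compOperator K hD.continuous γ),
      hp.comp (ih hD),
      fun γ => hasFDerivAt_compOperator (hF.of_le (by simp)) γ⟩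

/-- Primitives from `0`, as an operator on continuous functions on a compact interval. -/
def primitiveOperator {a b : ℝ} (ha : a ≤ 0) (hb : 0 ≤ b) (W : Type*) [NormedAddCommGroup W]
    [NormedSpace ℝ W] : C(Icc a b, W) →L[ℝ] C(Icc a b, W) :=
  have hab : a ≤ b := ha.trans hb
  LinearMap.mkContinuous
    { toFun := fun γ => ⟨fun t => ∫ s in (0 : ℝ)..t, γ (projIcc a b hab s), by
        have : Continuous fun s => γ (projIcc a b hab s) := γ.continuous.comp continuous_projIcc
        exact (intervalIntegral.continuous_primitive (fun _ _ => this.intervalIntegrable _ _)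
          0).comp continuous_subtype_val⟩
      map_add' := fun γ γ' => by
        ext t
        have : ∀ γ : C(Icc a b, W), Continuous fun s => γ (projIcc a b hab s) :=
          fun γ => γ.continuous.comp continuous_projIcc
        exact intervalIntegral.integral_add ((this γ).intervalIntegrable _ _)
          ((this γ').intervalIntegrable _ _)
      map_smul' := fun c γ => by
        ext t
        exact intervalIntegral.integral_smul c _ }
    (b - a) fun γ => by
      rw [ContinuousMap.norm_le _ (mul_nonneg (sub_nonneg.2 hab) (norm_nonneg _))]
      intro t
      refine (intervalIntegral.norm_integral_le_of_norm_le_const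
        (fun s _ => γ.norm_coe_le_norm _)).trans ?_
      rw [mul_comm, sub_zero]
      refine mul_le_mul_of_nonneg_right (abs_le.2 ⟨?_, ?_⟩) (norm_nonneg _)
      · linarith [t.2.1]
      · linarith [t.2.2]

/-- The curves `t ↦ (t, v)`, `t ∈ [0, 1]`. -/
def horizontalCurve {V : Type*} [NormedAddCommGroup V] (v : V) :
    C(Icc (0 : ℝ) 1, ℝ × V) := ⟨fun t => (t, v), by fun_prop⟩

/-- The constant curves, as a linear map. -/
def constCurve (K : Type*) [TopologicalSpace K] [CompactSpace K] (V : Type*)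
    [NormedAddCommGroup V] [NormedSpace ℝ V] : V →L[ℝ] C(K, V) :=
  LinearMap.mkContinuous
    { toFun := fun v => ContinuousMap.const K v
      map_add' := fun _ _ => rfl
      map_smul' := fun _ _ => rfl } 1 fun v => by
    rw [one_mul, ContinuousMap.norm_le _ (norm_nonneg _)]
    exact fun _ => le_rfl

theorem constCurve_apply {K : Type*} [TopologicalSpace K] [CompactSpace K] {V : Type*}
    [NormedAddCommGroup V] [NormedSpace ℝ V] (v : V) (t : K) : constCurve K V v t = v := rfl

theorem horizontalCurve_eq {V : Type*} [NormedAddCommGroup V] [NormedSpace ℝ V] :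
    horizontalCurve (V := V) = fun v => horizontalCurve (0 : V) +
      ((constCurve (Icc (0 : ℝ) 1) (ℝ × V)).comp (ContinuousLinearMap.inr ℝ ℝ V)) v := by
  funext v
  ext t <;> simp [horizontalCurve, constCurve_apply]

theorem hasFDerivAt_horizontalCurve {V : Type*} [NormedAddCommGroup V] [NormedSpace ℝ V] (v : V) :
    HasFDerivAt (horizontalCurve (V := V))
      ((constCurve (Icc (0 : ℝ) 1) (ℝ × V)).comp (ContinuousLinearMap.inr ℝ ℝ V)) v := by
  rw [horizontalCurve_eq]
  exact (ContinuousLinearMap.hasFDerivAt _).const_add _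

theorem contDiff_horizontalCurve {V : Type*} [NormedAddCommGroup V] [NormedSpace ℝ V]
    {n : WithTop ℕ∞} : ContDiff ℝ n (horizontalCurve (V := V)) := by
  rw [horizontalCurve_eq]
  exact contDiff_const.add (ContinuousLinearMap.contDiff _)

/-- The integral over `[0, 1]`, as an operator on `C([0, 1], W)`. -/
def integralOperator (W : Type*) [NormedAddCommGroup W] [NormedSpace ℝ W] :
    C(Icc (0 : ℝ) 1, W) →L[ℝ] W :=
  (ContinuousMap.evalCLM ℝ (⟨1, by simp⟩ : Icc (0 : ℝ) 1)).comp
    (primitiveOperator le_rfl zero_le_one W)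

theorem integralOperator_apply {W : Type*} [NormedAddCommGroup W] [NormedSpace ℝ W]
    {f : ℝ → W} {γ : C(Icc (0 : ℝ) 1, W)} (h : ∀ t : Icc (0 : ℝ) 1, γ t = f t) :
    integralOperator W γ = ∫ t in (0 : ℝ)..1, f t := by
  refine intervalIntegral.integral_congr fun t ht => ?_
  rw [uIcc_of_le zero_le_one] at ht
  simp only [h, projIcc_of_mem _ ht]

theorem contDiff_integral {V W : Type u} [NormedAddCommGroup V] [NormedSpace ℝ V]
    [NormedAddCommGroup W] [NormedSpace ℝ W] {F : ℝ × V → W} (hF : ContDiff ℝ ∞ F) :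
    ContDiff ℝ ∞ fun v => ∫ t in (0 : ℝ)..1, F (t, v) := by
  have h := (integralOperator W).contDiff.comp
    ((contDiff_compOperator (K := Icc (0 : ℝ) 1) hF).comp contDiff_horizontalCurve)
  convert h with v
  exact (integralOperator_apply fun t => rfl).symm

theorem fderiv_integral {V W : Type*} [NormedAddCommGroup V] [NormedSpace ℝ V]
    [NormedAddCommGroup W] [NormedSpace ℝ W] {F : ℝ × V → W} (hF : ContDiff ℝ 1 F) (v w : V) :
    fderiv ℝ (fun v => ∫ t in (0 : ℝ)..1, F (t, v)) v w =
      ∫ t in (0 : ℝ)..1, fderiv ℝ F (t, v) (0, w) := by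
  have h := (integralOperator W).hasFDerivAt.comp v
    ((hasFDerivAt_compOperator (K := Icc (0 : ℝ) 1) hF _).comp v (hasFDerivAt_horizontalCurve v))
  have e : (fun v => ∫ t in (0 : ℝ)..1, F (t, v)) = integralOperator W ∘
      (compOperator (Icc (0 : ℝ) 1) hF.continuous ∘ horizontalCurve) := by
    ext v
    exact (integralOperator_apply fun t => rfl).symm
  rw [e, h.fderiv]
  exact integralOperator_apply fun t => pointwisePairing_apply _ _ t

end Composition

/-! ### The Poincaré lemma -/

section Homotopy

variable {V : Type*} [NormedAddCommGroup V] [NormedSpace ℝ V] {k : ℕ}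
  {γ : V → V [⋀^Fin (k + 1)]→L[ℝ] ℝ}

/-- Insertion of a vector into the first argument, as a continuous bilinear map. -/
def insertFirst (V : Type*) [NormedAddCommGroup V] [NormedSpace ℝ V] (k : ℕ) :
    (V [⋀^Fin (k + 1)]→L[ℝ] ℝ) →L[ℝ] V →L[ℝ] V [⋀^Fin k]→L[ℝ] ℝ :=
  let L : (V [⋀^Fin (k + 1)]→L[ℝ] ℝ) →ₗ[ℝ] V →L[ℝ] V [⋀^Fin k]→L[ℝ] ℝ :=
    { toFun := fun f => f.curryLeft
      map_add' := ContinuousAlternatingMap.curryLeft_add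
      map_smul' := ContinuousAlternatingMap.curryLeft_smul }
  { toLinearMap := L
    cont := (ContinuousAlternatingMap.curryLeftLI (𝕜 := ℝ) (E := V) (F := ℝ) (n := k)).continuous }

theorem insertFirst_apply (f : V [⋀^Fin (k + 1)]→L[ℝ] ℝ) : insertFirst V k f = f.curryLeft := rfl

/-- The integrand of the homotopy operator. -/
def homotopyIntegrand (γ : V → V [⋀^Fin (k + 1)]→L[ℝ] ℝ) (p : ℝ × V) : V [⋀^Fin k]→L[ℝ] ℝ :=
  p.1 ^ k • insertFirst V k (γ (p.1 • p.2)) p.2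

/-- The homotopy operator on forms on a vector space, viewed as form-valued functions. -/
def vectorHomotopyOp (γ : V → V [⋀^Fin (k + 1)]→L[ℝ] ℝ) (v : V) : V [⋀^Fin k]→L[ℝ] ℝ :=
  ∫ t in (0 : ℝ)..1, homotopyIntegrand γ (t, v)

theorem compContinuousLinearMap_smul_id (f : V [⋀^Fin k]→L[ℝ] ℝ) (t : ℝ) :
    f.compContinuousLinearMap (t • ContinuousLinearMap.id ℝ V) = t ^ k • f := by
  ext m
  exact (f.map_smul_univ (fun _ => t) m).trans (by simp)

theorem homotopyOp_eq (γ : V → V [⋀^Fin (k + 1)]→L[ℝ] ℝ) (v : V) :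
    homotopyOp γ v = vectorHomotopyOp γ v :=
  intervalIntegral.integral_congr (E := V [⋀^Fin k]→L[ℝ] ℝ) fun t _ =>
    compContinuousLinearMap_smul_id ((γ (t • v)).curryLeft v) t

theorem contDiff_homotopyIntegrand {n : WithTop ℕ∞} (hγ : ContDiff ℝ n γ) :
    ContDiff ℝ n (homotopyIntegrand γ) := by
  have h : ContDiff ℝ n fun p : ℝ × V => γ (p.1 • p.2) := hγ.comp (by fun_prop)
  have hi : ContDiff ℝ n (insertFirst V k) := ContinuousLinearMap.contDiff _
  exact (contDiff_fst.pow k).smul ((hi.comp h).clm_apply contDiff_snd)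

theorem contDiff_vectorHomotopyOp (hγ : ContDiff ℝ ∞ γ) : ContDiff ℝ ∞ (vectorHomotopyOp γ) :=
  contDiff_integral (contDiff_homotopyIntegrand hγ)

theorem fderiv_homotopyIntegrand (hγ : ContDiff ℝ 1 γ) (t : ℝ) (v w : V) :
    fderiv ℝ (homotopyIntegrand γ) (t, v) (0, w) =
      t ^ k • (t • (fderiv ℝ γ (t • v) w).curryLeft v + (γ (t • v)).curryLeft w) := by
  have h1 : HasFDerivAt (fun v => γ (t • v))
      ((fderiv ℝ γ (t • v)).comp (t • ContinuousLinearMap.id ℝ V)) v :=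
    ((hγ.differentiable one_ne_zero) (t • v)).hasFDerivAt.comp v ((hasFDerivAt_id v).const_smul t)
  have hi : HasFDerivAt (insertFirst V k) (insertFirst V k) (γ (t • v)) :=
    ContinuousLinearMap.hasFDerivAt _
  have hj : HasFDerivAt (fun v => insertFirst V k (γ (t • v))) ((insertFirst V k).comp
      ((fderiv ℝ γ (t • v)).comp (t • ContinuousLinearMap.id ℝ V))) v :=
    HasFDerivAt.comp (F := V [⋀^Fin (k + 1)]→L[ℝ] ℝ) (G := V →L[ℝ] V [⋀^Fin k]→L[ℝ] ℝ) v hi h1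
  have h2 := (hj.clm_apply (hasFDerivAt_id v)).const_smul (t ^ k)
  have h3 := ((contDiff_homotopyIntegrand hγ).differentiable one_ne_zero (t, v)).hasFDerivAt.comp v
    (hasFDerivAt_prodMk_right t v)
  have h4 := congrArg (fun L => L w) (h3.unique h2)
  refine Eq.trans (by simp) (h4.trans ?_)
  simp [add_comm, insertFirst_apply]

theorem alternatize_curryLeft_of_closed (D : V →L[ℝ] V [⋀^Fin (k + 1)]→L[ℝ] ℝ)
    (hD : ContinuousAlternatingMap.alternatizeUncurryFin D = 0) (v : V) (u : Fin (k + 1) → V) :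
    ∑ i : Fin (k + 1), (-1 : ℤ) ^ (i : ℕ) • (D (u i)).curryLeft v (i.removeNth u) = D v u := by
  have h := congrArg (fun η => η (Matrix.vecCons v u)) hD
  rw [ContinuousAlternatingMap.alternatizeUncurryFin_apply,
    show (0 : V [⋀^Fin (k + 1 + 1)]→L[ℝ] ℝ) (Matrix.vecCons v u) = 0 from rfl] at h
  rw [Fin.sum_univ_succ] at h
  have e0 : (0 : Fin (k + 2)).removeNth (Matrix.vecCons v u) = u := rfl
  have e1 : ∀ i : Fin (k + 1), i.succ.removeNth (Matrix.vecCons v u) =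
      Matrix.vecCons v (i.removeNth u) := fun i => by
    ext j
    refine Fin.cases ?_ (fun j => ?_) j <;> simp [Fin.removeNth]
  simp only [e0, e1, Fin.val_zero, pow_zero, one_smul, Matrix.cons_val_zero, Matrix.cons_val_succ,
    Fin.val_succ, pow_succ, mul_neg, mul_one, neg_smul, Finset.sum_neg_distrib] at h
  simp only [ContinuousAlternatingMap.curryLeft_apply_apply]
  linarith

theorem hasDerivAt_homotopy (hγ : ContDiff ℝ 1 γ) {t : ℝ} {v : V}
    (hd : extDeriv γ (t • v) = 0) (u : Fin (k + 1) → V) :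
    HasDerivAt (fun t : ℝ => t ^ (k + 1) * γ (t • v) u)
      (∑ i : Fin (k + 1), (-1 : ℤ) ^ (i : ℕ) •
        fderiv ℝ (homotopyIntegrand γ) (t, v) (0, u i) (i.removeNth u)) t := by
  have h1 : HasDerivAt (fun t : ℝ => γ (t • v)) (fderiv ℝ γ (t • v) ((1 : ℝ) • v)) t :=
    ((hγ.differentiable one_ne_zero) (t • v)).hasFDerivAt.comp_hasDerivAt t
      ((hasDerivAt_id t).smul_const v)
  rw [one_smul] at h1
  have h2 : HasDerivAt (fun t : ℝ => γ (t • v) u) (fderiv ℝ γ (t • v) v u) t :=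
    (ContinuousAlternatingMap.apply ℝ V ℝ u).hasFDerivAt.comp_hasDerivAt t h1
  have h3 := (hasDerivAt_pow (k + 1) t).mul h2
  have hc := alternatize_curryLeft_of_closed (fderiv ℝ γ (t • v)) hd v u
  have ha := congrArg (fun η => η u)
    (ContinuousAlternatingMap.alternatizeUncurryFin_curryLeft (γ (t • v)))
  rw [ContinuousAlternatingMap.alternatizeUncurryFin_apply] at ha
  have ha' : (((k : ℝ) + 1) * γ (t • v) u) = ∑ i : Fin (k + 1), (-1 : ℤ) ^ (i : ℕ) •
      (γ (t • v)).curryLeft (u i) (i.removeNth u) := by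
    rw [ha]; simp
  refine h3.congr_deriv ?_
  have hs : ∀ i : Fin (k + 1), (-1 : ℤ) ^ (i : ℕ) •
      fderiv ℝ (homotopyIntegrand γ) (t, v) (0, u i) (i.removeNth u) =
      t ^ (k + 1) * ((-1 : ℤ) ^ (i : ℕ) • (fderiv ℝ γ (t • v) (u i)).curryLeft v (i.removeNth u)) +
        t ^ k * ((-1 : ℤ) ^ (i : ℕ) • (γ (t • v)).curryLeft (u i) (i.removeNth u)) := fun i => by
    rw [fderiv_homotopyIntegrand hγ, ContinuousAlternatingMap.smul_apply,
      ContinuousAlternatingMap.add_apply, ContinuousAlternatingMap.smul_apply]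
    simp only [smul_eq_mul, zsmul_eq_mul]
    ring
  rw [Finset.sum_congr rfl fun i _ => hs i, Finset.sum_add_distrib, ← Finset.mul_sum,
    ← Finset.mul_sum, hc, ← ha']
  push_cast
  ring

theorem extDeriv_vectorHomotopyOp (hγ : ContDiff ℝ ∞ γ) (hd : extDeriv γ = 0) (v : V) :
    extDeriv (vectorHomotopyOp γ) v = γ v := by
  have hγ1 : ContDiff ℝ 1 γ := hγ.of_le (by simp)
  have hcF : Continuous fun t : ℝ => fderiv ℝ (homotopyIntegrand γ) (t, v) :=
    ((contDiff_homotopyIntegrand hγ1).continuous_fderiv one_ne_zero).comp (by fun_prop)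
  have hcw : ∀ w : V, Continuous fun t : ℝ =>
      fderiv ℝ (homotopyIntegrand γ) (t, v) (0, w) := fun w => hcF.clm_apply continuous_const
  have hcont : ∀ w : V, ∀ m : Fin k → V, Continuous fun t : ℝ =>
      fderiv ℝ (homotopyIntegrand γ) (t, v) (0, w) m := fun w m =>
    (ContinuousAlternatingMap.apply ℝ V ℝ m).continuous.comp (hcw w)
  have hint : ∀ w : V, ∀ m : Fin k → V, fderiv ℝ (vectorHomotopyOp γ) v w m =
      ∫ t in (0 : ℝ)..1, fderiv ℝ (homotopyIntegrand γ) (t, v) (0, w) m := fun w m => by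
    have h1 := fderiv_integral (contDiff_homotopyIntegrand hγ1) v w
    have h2 := (ContinuousAlternatingMap.apply ℝ V ℝ m).intervalIntegral_comp_comm
      ((hcw w).intervalIntegrable (μ := MeasureTheory.volume) 0 1)
    exact (congrArg (fun η => η m) h1).trans h2.symm
  ext u
  rw [extDeriv, ContinuousAlternatingMap.alternatizeUncurryFin_apply]
  simp only [hint]
  have hsum : ∑ i : Fin (k + 1), (-1 : ℤ) ^ (i : ℕ) • (∫ t in (0 : ℝ)..1,
        fderiv ℝ (homotopyIntegrand γ) (t, v) (0, u i) (i.removeNth u)) =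
      ∫ t in (0 : ℝ)..1, ∑ i : Fin (k + 1), (-1 : ℤ) ^ (i : ℕ) •
        fderiv ℝ (homotopyIntegrand γ) (t, v) (0, u i) (i.removeNth u) := by
    simp only [zsmul_eq_mul]
    rw [intervalIntegral.integral_finsetSum fun i _ =>
      ((hcont (u i) _).const_mul _).intervalIntegrable 0 1]
    exact Finset.sum_congr rfl fun i _ => (intervalIntegral.integral_const_mul _ _).symm
  have hcs : Continuous fun t : ℝ => ∑ i : Fin (k + 1), (-1 : ℤ) ^ (i : ℕ) •
        fderiv ℝ (homotopyIntegrand γ) (t, v) (0, u i) (i.removeNth u) :=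
    continuous_finsetSum _ fun i _ => by
      simpa only [zsmul_eq_mul] using (hcont (u i) (i.removeNth u)).const_mul _
  rw [hsum, intervalIntegral.integral_eq_sub_of_hasDerivAt
    (fun t _ => hasDerivAt_homotopy hγ1 (congrFun hd (t • v)) u) (hcs.intervalIntegrable 0 1)]
  simp

end Homotopy

/-! ### Derivatives of maps between manifolds as maps between the model spaces -/

section ModelDerivative

variable {E : Type*} [NormedAddCommGroup E] [NormedSpace ℝ E]
  {H : Type*} [TopologicalSpace H] (I : ModelWithCorners ℝ E H)
  {M : Type*} [TopologicalSpace M] [ChartedSpace H M]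
  {E' : Type*} [NormedAddCommGroup E'] [NormedSpace ℝ E']
  {H' : Type*} [TopologicalSpace H'] (I' : ModelWithCorners ℝ E' H')
  {M' : Type*} [TopologicalSpace M'] [ChartedSpace H' M']
  {E'' : Type*} [NormedAddCommGroup E''] [NormedSpace ℝ E'']
  {H'' : Type*} [TopologicalSpace H''] (I'' : ModelWithCorners ℝ E'' H'')
  {M'' : Type*} [TopologicalSpace M''] [ChartedSpace H'' M'']

/-- The derivative of a map of manifolds, as a map between the model spaces. -/
def mderiv (f : M → M') (x : M) : E →L[ℝ] E' := mfderiv I I' f x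

variable {I I' I''}

theorem mderiv_comp {g : M' → M''} {f : M → M'} {x : M} (hg : MDifferentiableAt I' I'' g (f x))
    (hf : MDifferentiableAt I I' f x) :
    mderiv I I'' (fun y => g (f y)) x = (mderiv I' I'' g (f x)).comp (mderiv I I' f x) :=
  mfderiv_comp x hg hf

theorem mderiv_id (x : M) : mderiv I I (fun y : M => y) x = ContinuousLinearMap.id ℝ E :=
  mfderiv_id

theorem mderiv_const (c : M') (x : M) : mderiv I I' (fun _ : M => c) x = 0 :=
  mfderiv_const

theorem mderiv_congr {f g : M → M'} {x : M} (h : f =ᶠ[𝓝 x] g) :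
    mderiv I I' f x = mderiv I I' g x :=
  h.mfderiv_eq

theorem mderiv_eq_fderiv {f : E → E'} {x : E} : mderiv 𝓘(ℝ, E) 𝓘(ℝ, E') f x = fderiv ℝ f x :=
  mfderiv_eq_fderiv

theorem mderiv_prodMk {f : M → M'} {g : M → M''} {x : M} (hf : MDifferentiableAt I I' f x)
    (hg : MDifferentiableAt I I'' g x) :
    mderiv I (I'.prod I'') (fun y => (f y, g y)) x = (mderiv I I' f x).prod (mderiv I I'' g x) :=
  mfderiv_prodMk hf hg

theorem mderiv_fst (p : M × M') :
    mderiv (I.prod I') I (Prod.fst : M × M' → M) p = ContinuousLinearMap.fst ℝ E E' :=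
  mfderiv_fst

theorem mderiv_snd (p : M × M') :
    mderiv (I.prod I') I' (Prod.snd : M × M' → M') p = ContinuousLinearMap.snd ℝ E E' :=
  mfderiv_snd

theorem mderiv_prod_apply {f : M × M' → M''} {p : M × M'}
    (hf : MDifferentiableAt (I.prod I') I'' f p) (u : E) (v : E') :
    mderiv (I.prod I') I'' f p (u, v) =
      mderiv I I'' (fun z => f (z, p.2)) p.1 u + mderiv I' I'' (fun z => f (p.1, z)) p.2 v :=
  mfderiv_prod_eq_add_apply (v := ((u, v) : E × E')) hf

/-- The derivative of a map from a vector space, in the preferred chart. -/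
theorem mderiv_eq_fderiv_chart {f : E → M'} {x : E} (hf : MDifferentiableAt 𝓘(ℝ, E) I' f x) :
    mderiv 𝓘(ℝ, E) I' f x = fderiv ℝ (fun z => extChartAt I' (f x) (f z)) x := by
  have h : mfderiv 𝓘(ℝ, E) I' f x = fderivWithin ℝ (writtenInExtChartAt 𝓘(ℝ, E) I' x f)
    (range 𝓘(ℝ, E)) (extChartAt 𝓘(ℝ, E) x x) := by
    unfold mfderiv
    exact if_pos hf
  refine Eq.trans h ?_
  simp only [modelWithCornersSelf_coe, range_id, fderivWithin_univ, writtenInExtChartAt,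
    extChartAt_model_space_eq_id, PartialEquiv.refl_symm, PartialEquiv.refl_coe]
  rfl

theorem eventually_mdifferentiableAt [IsManifold I ∞ M] [IsManifold I' ∞ M'] {f : M → M'} {x : M}
    (hf : ContMDiffAt I I' ∞ f x) : ∀ᶠ y in 𝓝 x, MDifferentiableAt I I' f y :=
  ((contMDiffAt_iff_contMDiffAt_nhds (by simp)).1
    (hf.of_le (show (1 : WithTop ℕ∞) ≤ ∞ by simp))).mono fun _ hy => hy.mdifferentiableAt one_ne_zero

end ModelDerivative

section DarbouxDerivative

variable {E : Type*} [NormedAddCommGroup E] [NormedSpace ℝ E]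
  {H : Type*} [TopologicalSpace H] (I : ModelWithCorners ℝ E H)
  {G : Type*} [TopologicalSpace G] [ChartedSpace H G] [Group G]
  {V : Type*} [NormedAddCommGroup V] [NormedSpace ℝ V]
  {W : Type*} [NormedAddCommGroup W] [NormedSpace ℝ W]

/-- The pullback of the left Maurer-Cartan form by a map from a vector space. -/
def darboux (φ : V → G) (y : V) : V →L[ℝ] E :=
  (mderiv I I (fun x : G => (φ y)⁻¹ * x) (φ y)).comp (mderiv 𝓘(ℝ, V) I φ y)

/-- The pullback of the right Maurer-Cartan form by a map from a vector space. -/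
def darbouxRight (φ : V → G) (y : V) : V →L[ℝ] E :=
  (mderiv I I (fun x : G => x * (φ y)⁻¹) (φ y)).comp (mderiv 𝓘(ℝ, V) I φ y)

theorem lieAdjoint_eq (a : G) : lieAdjoint I a = mderiv I I (fun x : G => a * x * a⁻¹) 1 := rfl

variable {I}

theorem darboux_congr {φ ψ : V → G} {y : V} (h : φ =ᶠ[𝓝 y] ψ) : darboux I φ y = darboux I ψ y := by
  rw [darboux, darboux, mderiv_congr h, h.self_of_nhds]

variable (I) in
theorem darboux_const (c : G) (y : V) : darboux I (fun _ : V => c) y = 0 := by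
  rw [darboux, mderiv_const, ContinuousLinearMap.comp_zero]

theorem darboux_comp {φ : V → G} {f : W → V} {y : W} (hφ : MDifferentiableAt 𝓘(ℝ, V) I φ (f y))
    (hf : DifferentiableAt ℝ f y) :
    darboux I (fun z => φ (f z)) y = (darboux I φ (f y)).comp (fderiv ℝ f y) := by
  rw [darboux, mderiv_comp hφ hf.mdifferentiableAt, mderiv_eq_fderiv]
  rfl

variable [LieGroup I ∞ G]

variable (I G) in
theorem mdifferentiable_mul : MDifferentiable (I.prod I) I fun p : G × G => p.1 * p.2 :=
  (contMDiff_mul I ∞).mdifferentiable (by simp)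

variable (I) in
theorem mdifferentiable_left (a : G) : MDifferentiable I I fun x : G => a * x :=
  (contMDiff_mul_left (n := ∞)).mdifferentiable (by simp)

variable (I) in
theorem mdifferentiable_right (a : G) : MDifferentiable I I fun x : G => x * a :=
  (contMDiff_mul_right (n := ∞)).mdifferentiable (by simp)

variable (I) in
theorem contMDiff_conj (a : G) : ContMDiff I I ∞ fun x : G => a * x * a⁻¹ :=
  contMDiff_mul_right.comp contMDiff_mul_left

variable (I) in
theorem mdifferentiable_conj (a : G) : MDifferentiable I I fun x : G => a * x * a⁻¹ :=
  (contMDiff_conj I a).mdifferentiable (by simp)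

theorem mdifferentiableAt_mul {φ ψ : V → G} {y : V} (hφ : MDifferentiableAt 𝓘(ℝ, V) I φ y)
    (hψ : MDifferentiableAt 𝓘(ℝ, V) I ψ y) :
    MDifferentiableAt 𝓘(ℝ, V) I (fun z => φ z * ψ z) y :=
  (mdifferentiable_mul I G (φ y, ψ y)).comp y (hφ.prodMk hψ)

theorem mdifferentiableAt_inv {φ : V → G} {y : V} (hφ : MDifferentiableAt 𝓘(ℝ, V) I φ y) :
    MDifferentiableAt 𝓘(ℝ, V) I (fun z => (φ z)⁻¹) y :=
  ((contMDiff_inv I ∞).mdifferentiable (by simp) (φ y)).comp y hφ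

theorem darboux_eq_mderiv {φ : V → G} {y : V} (hφ : MDifferentiableAt 𝓘(ℝ, V) I φ y) :
    darboux I φ y = mderiv 𝓘(ℝ, V) I (fun z => (φ y)⁻¹ * φ z) y :=
  (mderiv_comp (mdifferentiable_left I _ _) hφ).symm

theorem darbouxRight_eq_mderiv {φ : V → G} {y : V} (hφ : MDifferentiableAt 𝓘(ℝ, V) I φ y) :
    darbouxRight I φ y = mderiv 𝓘(ℝ, V) I (fun z => φ z * (φ y)⁻¹) y :=
  (mderiv_comp (mdifferentiable_right I _ _) hφ).symm

theorem darboux_eq_fderiv {φ : V → G} {y : V} (hφ : MDifferentiableAt 𝓘(ℝ, V) I φ y) :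
    darboux I φ y = fderiv ℝ (fun z => extChartAt I (1 : G) ((φ y)⁻¹ * φ z)) y := by
  rw [darboux_eq_mderiv hφ, mderiv_eq_fderiv_chart (f := fun z => (φ y)⁻¹ * φ z)
    ((mdifferentiable_left I _ _).comp y hφ),
    inv_mul_cancel]

theorem mderiv_mul_one {p q : V → G} {y : V} (hp : MDifferentiableAt 𝓘(ℝ, V) I p y)
    (hq : MDifferentiableAt 𝓘(ℝ, V) I q y) (hp1 : p y = 1) (hq1 : q y = 1) :
    mderiv 𝓘(ℝ, V) I (fun z => p z * q z) y =
      mderiv 𝓘(ℝ, V) I p y + mderiv 𝓘(ℝ, V) I q y := by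
  have h := mderiv_comp (f := fun z => (p z, q z)) (g := fun p : G × G => p.1 * p.2)
    (mdifferentiable_mul I G (p y, q y)) (hp.prodMk hq)
  refine h.trans ?_
  rw [mderiv_prodMk hp hq]
  ext v
  refine (mderiv_prod_apply (mdifferentiable_mul I G _) _ _).trans ?_
  simp only [hp1, hq1, mul_one, one_mul, mderiv_id]
  rfl

theorem darboux_mul {φ ψ : V → G} {y : V} (hφ : MDifferentiableAt 𝓘(ℝ, V) I φ y)
    (hψ : MDifferentiableAt 𝓘(ℝ, V) I ψ y) :
    darboux I (fun z => φ z * ψ z) y =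
      (lieAdjoint I (ψ y)⁻¹).comp (darboux I φ y) + darboux I ψ y := by
  have h1 : MDifferentiableAt 𝓘(ℝ, V) I (fun z => (φ y)⁻¹ * φ z) y :=
    (mdifferentiable_left I _ _).comp y hφ
  have h2 : MDifferentiableAt 𝓘(ℝ, V) I (fun z => (ψ y)⁻¹ * ψ z) y :=
    (mdifferentiable_left I _ _).comp y hψ
  have h3 := mderiv_comp (mdifferentiable_conj I (ψ y)⁻¹ _) h1
  rw [darboux_eq_mderiv (mdifferentiableAt_mul hφ hψ), darboux_eq_mderiv hφ, darboux_eq_mderiv hψ,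
    lieAdjoint_eq]
  rw [inv_mul_cancel] at h3
  have h4 : MDifferentiableAt 𝓘(ℝ, V) I
      (fun z => (ψ y)⁻¹ * ((φ y)⁻¹ * φ z) * (ψ y)⁻¹⁻¹) y :=
    (mdifferentiable_conj I (ψ y)⁻¹ _).comp y h1
  rw [← h3, ← mderiv_mul_one h4 h2 (by simp) (by simp)]
  congr 1
  funext z
  group

variable (I) in
theorem lieAdjoint_mul (a b : G) :
    lieAdjoint I (a * b) = (lieAdjoint I a).comp (lieAdjoint I b) := by
  have h := mderiv_comp (x := (1 : G)) (mdifferentiable_conj I a _) (mdifferentiable_conj I b _)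
  rw [mul_one, mul_inv_cancel] at h
  rw [lieAdjoint_eq, lieAdjoint_eq, lieAdjoint_eq, ← h]
  congr 1
  funext z
  group

omit [LieGroup I ∞ G] in
variable (I G) in
theorem lieAdjoint_one : lieAdjoint I (1 : G) = ContinuousLinearMap.id ℝ E := by
  rw [lieAdjoint_eq, ← mderiv_id (I := I) (1 : G)]
  simp

theorem darboux_mul_left {φ : V → G} {y : V} (hφ : MDifferentiableAt 𝓘(ℝ, V) I φ y) (a : G) :
    darboux I (fun z => a * φ z) y = darboux I φ y := by
  rw [darboux_mul mdifferentiableAt_const hφ, darboux_const, ContinuousLinearMap.comp_zero,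
    zero_add]

theorem darboux_conj {φ : V → G} {y : V} (hφ : MDifferentiableAt 𝓘(ℝ, V) I φ y) (a : G) :
    darboux I (fun z => a * φ z * a⁻¹) y = (lieAdjoint I a).comp (darboux I φ y) := by
  rw [darboux_mul (mdifferentiableAt_mul mdifferentiableAt_const hφ) mdifferentiableAt_const,
    darboux_const, add_zero, darboux_mul_left hφ, inv_inv]

theorem darbouxRight_eq {φ : V → G} {y : V} (hφ : MDifferentiableAt 𝓘(ℝ, V) I φ y) :
    darbouxRight I φ y = (lieAdjoint I (φ y)).comp (darboux I φ y) := by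
  have h1 : MDifferentiableAt 𝓘(ℝ, V) I (fun z => (φ y)⁻¹ * φ z) y :=
    (mdifferentiable_left I _ _).comp y hφ
  have h3 := mderiv_comp (mdifferentiable_conj I (φ y) _) h1
  rw [inv_mul_cancel] at h3
  rw [darbouxRight_eq_mderiv hφ, darboux_eq_mderiv hφ, lieAdjoint_eq, ← h3]
  congr 1
  funext z
  group

theorem darboux_inv {φ : V → G} {y : V} (hφ : MDifferentiableAt 𝓘(ℝ, V) I φ y) :
    darboux I (fun z => (φ z)⁻¹) y = -darbouxRight I φ y := by
  have h := darboux_mul hφ (mdifferentiableAt_inv hφ)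
  simp only [mul_inv_cancel, inv_inv, darboux_const] at h
  rw [darbouxRight_eq hφ]
  exact (neg_eq_of_add_eq_zero_right h.symm).symm

theorem darboux_mul' {φ ψ : V → G} {y : V} (hφ : MDifferentiableAt 𝓘(ℝ, V) I φ y)
    (hψ : MDifferentiableAt 𝓘(ℝ, V) I ψ y) :
    darboux I (fun z => φ z * ψ z) y =
      (lieAdjoint I (ψ y)⁻¹).comp (darboux I φ y + darbouxRight I ψ y) := by
  rw [darboux_mul hφ hψ, darbouxRight_eq hψ, ContinuousLinearMap.comp_add,
    ← ContinuousLinearMap.comp_assoc, ← lieAdjoint_mul, inv_mul_cancel, lieAdjoint_one,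
    ContinuousLinearMap.id_comp]

theorem contDiffAt_darboux {φ : V → G} {y : V} (hφ : ContMDiffAt 𝓘(ℝ, V) I ∞ φ y) :
    ContDiffAt ℝ ∞ (darboux I φ) y := by
  have h1 : ContMDiffAt 𝓘(ℝ, V × V) I ∞ (fun p : V × V => (φ p.1)⁻¹ * φ p.2) (y, y) :=
    ((ContMDiffAt.comp (y, y) hφ contDiffAt_fst.contMDiffAt).inv).mul
      (ContMDiffAt.comp (y, y) hφ contDiffAt_snd.contMDiffAt)
  have h2 : ContMDiffAt I 𝓘(ℝ, E) ∞ (extChartAt I (1 : G)) ((φ y)⁻¹ * φ y) := by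
    rw [inv_mul_cancel]
    exact contMDiffAt_extChartAt
  have h3 : ContDiffAt ℝ ∞ (Function.uncurry fun x z : V =>
      extChartAt I (1 : G) ((φ x)⁻¹ * φ z)) (y, y) := by
    rw [← contMDiffAt_iff_contDiffAt]
    exact ContMDiffAt.comp (y, y) h2 h1
  have h4 : ContDiffAt ℝ ∞ (fun x => fderiv ℝ (fun z => extChartAt I (1 : G) ((φ x)⁻¹ * φ z)) x) y :=
    ContDiffAt.fderiv h3 contDiffAt_id (by simp)
  refine h4.congr_of_eventuallyEq ?_
  exact (eventually_mdifferentiableAt hφ).mono fun x hx => darboux_eq_fderiv hx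

end DarbouxDerivative

/-! ### The Maurer-Cartan equation -/

section MaurerCartan

variable {E : Type*} [NormedAddCommGroup E] [NormedSpace ℝ E]
  {H : Type*} [TopologicalSpace H] {I : ModelWithCorners ℝ E H} [I.Boundaryless]
  {G : Type*} [TopologicalSpace G] [ChartedSpace H G] [Group G] [LieGroup I ∞ G]
  {V : Type*} [NormedAddCommGroup V] [NormedSpace ℝ V]

variable (I G) in
/-- The inverse of the preferred chart at the identity. -/
def expChart : E → G := (extChartAt I (1 : G)).symm

variable (I G) in
/-- The base point of the preferred chart at the identity. -/
def chartOrigin : E := extChartAt I (1 : G) 1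

variable (I G) in
theorem expChart_chartOrigin : expChart I G (chartOrigin I G) = 1 := extChartAt_to_inv _

variable (I G) in
theorem target_mem_nhds : (extChartAt I (1 : G)).target ∈ 𝓝 (chartOrigin I G) :=
  extChartAt_target_mem_nhds 1

theorem contMDiffAt_expChart {x : E} (hx : x ∈ (extChartAt I (1 : G)).target) :
    ContMDiffAt 𝓘(ℝ, E) I ∞ (expChart I G) x :=
  (contMDiffOn_extChartAt_symm (1 : G)).contMDiffAt ((isOpen_extChartAt_target 1).mem_nhds hx)

theorem mdifferentiableAt_expChart {x : E} (hx : x ∈ (extChartAt I (1 : G)).target) :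
    MDifferentiableAt 𝓘(ℝ, E) I (expChart I G) x :=
  (contMDiffAt_expChart hx).mdifferentiableAt (by simp)

variable (I G) in
/-- The left Maurer-Cartan form in the preferred chart at the identity. -/
def chartForm : E → E →L[ℝ] E := darboux I (expChart I G)

variable (I G) in
theorem chartForm_origin : chartForm I G (chartOrigin I G) = ContinuousLinearMap.id ℝ E := by
  have h0 : chartOrigin I G ∈ (extChartAt I (1 : G)).target := mem_extChartAt_target 1
  rw [chartForm, darboux_eq_fderiv (mdifferentiableAt_expChart h0), expChart_chartOrigin]
  have h : (fun z => extChartAt I (1 : G) ((1 : G)⁻¹ * expChart I G z)) =ᶠ[𝓝 (chartOrigin I G)]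
      fun z => z := by
    filter_upwards [target_mem_nhds I G] with z hz
    rw [inv_one, one_mul]
    exact (extChartAt I (1 : G)).right_inv hz
  rw [h.fderiv_eq, fderiv_fun_id]

theorem contDiffAt_chartForm {x : E} (hx : x ∈ (extChartAt I (1 : G)).target) :
    ContDiffAt ℝ ∞ (chartForm I G) x :=
  contDiffAt_darboux (contMDiffAt_expChart hx)

variable (I) in
/-- Left-invariant vector fields, with values in the model space. -/
theorem mderiv_left_inverse (a : G) (v : E) :
    mderiv I I (fun x : G => a⁻¹ * x) a (mderiv I I (fun x : G => a * x) 1 v) = v := by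
  have h := mderiv_comp (x := (1 : G)) (mdifferentiable_left I a⁻¹ (a * 1))
    (mdifferentiable_left I a 1)
  simp only [inv_mul_cancel_left, mderiv_id, mul_one] at h
  exact (congrArg (fun L => L v) h).symm

variable (I) in
theorem mderiv_right_inverse (a : G) (v : E) :
    mderiv I I (fun x : G => a * x) 1 (mderiv I I (fun x : G => a⁻¹ * x) a v) = v := by
  have h := mderiv_comp (x := a) (mdifferentiable_left I a (a⁻¹ * a))
    (mdifferentiable_left I a⁻¹ a)
  simp only [mul_inv_cancel_left, mderiv_id, inv_mul_cancel] at h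
  exact (congrArg (fun L => L v) h).symm

variable [CompleteSpace E]

variable (I G) in
/-- The left-invariant vector field with value `v` at the identity, in the preferred chart. -/
def chartField (x v : E) : E := (chartForm I G x).inverse v

variable (I G) in
theorem eventually_isInvertible_chartForm :
    ∀ᶠ x in 𝓝 (chartOrigin I G), (chartForm I G x).IsInvertible := by
  have h1 : ContinuousAt (chartForm I G) (chartOrigin I G) :=
    (contDiffAt_chartForm (mem_extChartAt_target (1 : G))).continuousAt
  refine h1.eventually ?_
  rw [chartForm_origin]
  exact ContinuousLinearEquiv.nhds (ContinuousLinearEquiv.refl ℝ E)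

variable (I G) in
theorem eventually_chartForm_chartField (v : E) :
    ∀ᶠ x in 𝓝 (chartOrigin I G), chartForm I G x (chartField I G x v) = v := by
  filter_upwards [eventually_isInvertible_chartForm I G] with x hx
  obtain ⟨e, he⟩ := hx
  rw [chartField, ← he, ContinuousLinearMap.inverse_equiv]
  exact e.apply_symm_apply v

variable (I G) in
theorem contDiffAt_inverse_chartForm :
    ContDiffAt ℝ ∞ (fun x => (chartForm I G x).inverse) (chartOrigin I G) := by
  have h1 : ContDiffAt ℝ ∞ (chartForm I G) (chartOrigin I G) :=
    contDiffAt_chartForm (mem_extChartAt_target (1 : G))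
  have h2 : ContDiffAt ℝ ∞ ContinuousLinearMap.inverse (chartForm I G (chartOrigin I G)) := by
    rw [chartForm_origin]
    exact contDiffAt_map_inverse (ContinuousLinearEquiv.refl ℝ E)
  exact h2.comp _ h1

variable (I G) in
theorem chartField_origin (v : E) : chartField I G (chartOrigin I G) v = v := by
  rw [chartField, chartForm_origin, ContinuousLinearMap.inverse_id]
  rfl

theorem fderiv_chartField (u v : E) :
    fderiv ℝ (fun x => chartField I G x v) (chartOrigin I G) u =
      -fderiv ℝ (chartForm I G) (chartOrigin I G) u v := by
  have h1 : HasFDerivAt (chartForm I G) (fderiv ℝ (chartForm I G) (chartOrigin I G))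
      (chartOrigin I G) := ((contDiffAt_chartForm (mem_extChartAt_target (1 : G))).differentiableAt
        (by simp)).hasFDerivAt
  have h2 : HasFDerivAt (fun x => chartField I G x v)
      (fderiv ℝ (fun x => chartField I G x v) (chartOrigin I G)) (chartOrigin I G) :=
    (((contDiffAt_inverse_chartForm I G).differentiableAt (by simp)).clm_apply
      (differentiableAt_const v)).hasFDerivAt
  have h3 := (h1.clm_apply h2).congr_of_eventuallyEq
    ((eventually_chartForm_chartField I G v).mono fun x hx => hx.symm)
  have h4 := congrArg (fun L => L u) (h3.unique (hasFDerivAt_const v _))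
  simp only [chartField_origin, chartForm_origin] at h4
  exact eq_neg_of_add_eq_zero_left h4

theorem mderiv_expChart_origin :
    mderiv 𝓘(ℝ, E) I (expChart I G) (chartOrigin I G) = ContinuousLinearMap.id ℝ E := by
  have h := chartForm_origin I G
  rw [chartForm, darboux, expChart_chartOrigin] at h
  simpa only [inv_one, one_mul, mderiv_id, ContinuousLinearMap.id_comp] using h

theorem mpullbackWithin_mulInvariantVectorField (v : E) :
    (fun x => (VectorField.mpullbackWithin 𝓘(ℝ, E) I (extChartAt I (1 : G)).symm
      (mulInvariantVectorField (I := I) (v : GroupLieAlgebra I G)) (range I) x : E))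
      =ᶠ[𝓝 (chartOrigin I G)] fun x => chartField I G x v := by
  filter_upwards [target_mem_nhds I G, eventually_isInvertible_chartForm I G] with x hx hA
  obtain ⟨e, he⟩ := hA
  have hD : (mderiv 𝓘(ℝ, E) I (expChart I G) x).IsInvertible := by
    have := isInvertible_mfderivWithin_extChartAt_symm hx
    rw [I.range_eq_univ, mfderivWithin_univ] at this
    exact this
  obtain ⟨d, hd⟩ := hD
  have h1 : (VectorField.mpullbackWithin 𝓘(ℝ, E) I (extChartAt I (1 : G)).symm
      (mulInvariantVectorField (I := I) (v : GroupLieAlgebra I G)) (range I) x : E) =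
      (mderiv 𝓘(ℝ, E) I (expChart I G) x).inverse
        (mderiv I I (fun z : G => expChart I G x * z) 1 v) := by
    rw [VectorField.mpullbackWithin_apply, I.range_eq_univ, mfderivWithin_univ]
    rfl
  refine h1.trans ?_
  rw [chartField, ← he, ContinuousLinearMap.inverse_equiv]
  refine (e.symm_apply_eq.2 ?_).symm
  have h2 : e (d.symm (mderiv I I (fun z : G => expChart I G x * z) 1 v)) =
      chartForm I G x (d.symm (mderiv I I (fun z : G => expChart I G x * z) 1 v)) := by
    rw [← he]; rfl
  rw [← hd, ContinuousLinearMap.inverse_equiv]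
  refine Eq.trans ?_ h2.symm
  rw [chartForm, darboux, ContinuousLinearMap.comp_apply, ← hd]
  refine (mderiv_left_inverse I (expChart I G x) v).symm.trans ?_
  congr 1
  exact (d.apply_symm_apply _).symm

theorem bracket_eq_fderiv_chartForm (u v : E) :
    (VectorField.mlieBracket I (mulInvariantVectorField (I := I) (u : GroupLieAlgebra I G))
      (mulInvariantVectorField (I := I) (v : GroupLieAlgebra I G)) (1 : G) : E) =
      -(fderiv ℝ (chartForm I G) (chartOrigin I G) u v -
        fderiv ℝ (chartForm I G) (chartOrigin I G) v u) := by
  have h1 : mderiv I 𝓘(ℝ, E) (extChartAt I (1 : G)) 1 = ContinuousLinearMap.id ℝ E := by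
    have h2 := mfderiv_extChartAt_comp_mfderivWithin_extChartAt_symm (I := I)
      (mem_extChartAt_target (I := I) (1 : G))
    rw [I.range_eq_univ, mfderivWithin_univ, extChartAt_to_inv] at h2
    have h3 : (mderiv I 𝓘(ℝ, E) (extChartAt I (1 : G)) 1).comp
      (mderiv 𝓘(ℝ, E) I (expChart I G) (chartOrigin I G)) = ContinuousLinearMap.id ℝ E := h2
    rwa [mderiv_expChart_origin, ContinuousLinearMap.comp_id] at h3
  set U : E → E := fun x => VectorField.mpullbackWithin 𝓘(ℝ, E) I (extChartAt I (1 : G)).symm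
    (mulInvariantVectorField (I := I) (u : GroupLieAlgebra I G)) (range I) x with hU
  set W : E → E := fun x => VectorField.mpullbackWithin 𝓘(ℝ, E) I (extChartAt I (1 : G)).symm
    (mulInvariantVectorField (I := I) (v : GroupLieAlgebra I G)) (range I) x with hW
  have hr : (extChartAt I (1 : G)).symm ⁻¹' univ ∩ range I = univ := by
    rw [I.range_eq_univ, preimage_univ, inter_univ]
  have h4 : (VectorField.mlieBracket I (mulInvariantVectorField (I := I) (u : GroupLieAlgebra I G))
      (mulInvariantVectorField (I := I) (v : GroupLieAlgebra I G)) (1 : G) : E) =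
      (mderiv I 𝓘(ℝ, E) (extChartAt I (1 : G)) 1).inverse
        (VectorField.lieBracketWithin ℝ U W
          ((extChartAt I (1 : G)).symm ⁻¹' univ ∩ range I) (chartOrigin I G)) := rfl
  have eU : U =ᶠ[𝓝 (chartOrigin I G)] fun x => chartField I G x u :=
    mpullbackWithin_mulInvariantVectorField u
  have eW : W =ᶠ[𝓝 (chartOrigin I G)] fun x => chartField I G x v :=
    mpullbackWithin_mulInvariantVectorField v
  have eU0 : U (chartOrigin I G) = u := eU.self_of_nhds.trans (chartField_origin I G u)
  have eW0 : W (chartOrigin I G) = v := eW.self_of_nhds.trans (chartField_origin I G v)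
  have h5 : VectorField.lieBracketWithin ℝ U W
      ((extChartAt I (1 : G)).symm ⁻¹' univ ∩ range I) (chartOrigin I G) =
      -(fderiv ℝ (chartForm I G) (chartOrigin I G) u v -
        fderiv ℝ (chartForm I G) (chartOrigin I G) v u) := by
    rw [hr, VectorField.lieBracketWithin_univ, VectorField.lieBracket, eU.fderiv_eq, eW.fderiv_eq,
      eU0, eW0, fderiv_chartField, fderiv_chartField]
    abel
  rw [h1, ContinuousLinearMap.inverse_id] at h4
  exact h4.trans h5

end MaurerCartan

section StructureEquation

variable {E : Type*} [NormedAddCommGroup E] [NormedSpace ℝ E] [FiniteDimensional ℝ E]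
  {H : Type*} [TopologicalSpace H] {I : ModelWithCorners ℝ E H} [I.Boundaryless]
  {G : Type*} [TopologicalSpace G] [ChartedSpace H G] [Group G] [LieGroup I ∞ G]
  {V : Type*} [NormedAddCommGroup V] [NormedSpace ℝ V]

variable (I G) in
theorem fderiv_chartForm_origin (u v : E) :
    fderiv ℝ (chartForm I G) (chartOrigin I G) u v -
      fderiv ℝ (chartForm I G) (chartOrigin I G) v u = -lieBracketL I G u v := by
  have : CompleteSpace E := FiniteDimensional.complete ℝ E
  have h : lieBracketL I G u v = -(fderiv ℝ (chartForm I G) (chartOrigin I G) u v -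
        fderiv ℝ (chartForm I G) (chartOrigin I G) v u) := bracket_eq_fderiv_chartForm u v
  rw [h, neg_neg]

variable (I) in
/-- The coordinates, in the preferred chart at the identity, of the left translate of `φ` which maps
`y` to the identity. -/
def translatedChart (φ : V → G) (y z : V) : E := extChartAt I (1 : G) ((φ y)⁻¹ * φ z)

theorem contDiffAt_translatedChart {φ : V → G} {y : V} (hφ : ContMDiffAt 𝓘(ℝ, V) I ∞ φ y) :
    ContDiffAt ℝ ∞ (translatedChart I φ y) y := by
  have h2 : ContMDiffAt I 𝓘(ℝ, E) ∞ (extChartAt I (1 : G)) ((φ y)⁻¹ * φ y) := by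
    rw [inv_mul_cancel]
    exact contMDiffAt_extChartAt
  rw [← contMDiffAt_iff_contDiffAt]
  exact ContMDiffAt.comp y h2 (contMDiffAt_const.mul hφ)

theorem translatedChart_self (φ : V → G) (y : V) : translatedChart I φ y y = chartOrigin I G := by
  rw [translatedChart, inv_mul_cancel, chartOrigin]

theorem eventually_expChart_translatedChart {φ : V → G} {y : V} (hφ : ContinuousAt φ y) :
    ∀ᶠ z in 𝓝 y, expChart I G (translatedChart I φ y z) = (φ y)⁻¹ * φ z := by
  have : IsTopologicalGroup G := topologicalGroup_of_lieGroup I ∞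
  have h : ContinuousAt (fun z => (φ y)⁻¹ * φ z) y := continuousAt_const.mul hφ
  have h1 : (extChartAt I (1 : G)).source ∈ 𝓝 ((φ y)⁻¹ * φ y) := by
    rw [inv_mul_cancel]
    exact extChartAt_source_mem_nhds 1
  filter_upwards [h h1] with z hz
  exact (extChartAt I (1 : G)).left_inv hz

theorem eventually_darboux_eq {φ : V → G} {y : V} (hφ : ContMDiffAt 𝓘(ℝ, V) I ∞ φ y) :
    darboux I φ =ᶠ[𝓝 y] fun z => (chartForm I G (translatedChart I φ y z)).comp
      (fderiv ℝ (translatedChart I φ y) z) := by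
  have hf := contDiffAt_translatedChart hφ
  have h1 : ∀ᶠ z in 𝓝 y, translatedChart I φ y z ∈ (extChartAt I (1 : G)).target := by
    have := target_mem_nhds I G
    rw [← translatedChart_self φ y] at this
    exact hf.continuousAt this
  have h2 : ∀ᶠ z in 𝓝 y, DifferentiableAt ℝ (translatedChart I φ y) z :=
    ((hf.of_le (show (1 : WithTop ℕ∞) ≤ ∞ by simp)).eventually (by simp)).mono
      fun z hz => hz.differentiableAt one_ne_zero
  filter_upwards [h1, h2, eventually_mdifferentiableAt hφ,
    (eventually_expChart_translatedChart (I := I) hφ.continuousAt).eventually_nhds]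
    with z h1 h2 h3 h4
  rw [chartForm, ← darboux_comp (mdifferentiableAt_expChart h1) h2, darboux_congr h4,
    darboux_mul_left h3]

/-- The Maurer-Cartan equation `dA = -[A, A] / 2` for a left Darboux derivative. -/
theorem fderiv_darboux {φ : V → G} {y : V} (hφ : ContMDiffAt 𝓘(ℝ, V) I ∞ φ y) (u v : V) :
    fderiv ℝ (darboux I φ) y u v - fderiv ℝ (darboux I φ) y v u =
      -lieBracketL I G (darboux I φ y u) (darboux I φ y v) := by
  set f := translatedChart I φ y with hf
  have hfc : ContDiffAt ℝ ∞ f y := contDiffAt_translatedChart hφ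
  have hf0 : f y = chartOrigin I G := translatedChart_self φ y
  have hA : HasFDerivAt (chartForm I G) (fderiv ℝ (chartForm I G) (f y)) (f y) := by
    rw [hf0]
    exact ((contDiffAt_chartForm (mem_extChartAt_target (1 : G))).differentiableAt
      (by simp)).hasFDerivAt
  have h1 : HasFDerivAt f (fderiv ℝ f y) y := (hfc.differentiableAt (by simp)).hasFDerivAt
  have h2 : HasFDerivAt (fderiv ℝ f) (fderiv ℝ (fderiv ℝ f) y) y :=
    ((hfc.fderiv_right (m := 1) (by rw [one_add_one_eq_two]; exact ENat.LEInfty.out)).differentiableAt one_ne_zero).hasFDerivAt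
  have h3 := (hA.comp y h1).clm_comp h2
  have hs : IsSymmSndFDerivAt ℝ f y := hfc.isSymmSndFDerivAt (by
    rw [minSmoothness_of_isRCLikeNormedField]; exact ENat.LEInfty.out)
  have h4 : darboux I φ y = fderiv ℝ f y := by
    refine (eventually_darboux_eq hφ).self_of_nhds.trans ?_
    change (chartForm I G (f y)).comp (fderiv ℝ f y) = _
    rw [hf0, chartForm_origin, ContinuousLinearMap.id_comp]
  have h5 : ∀ u v, fderiv ℝ (darboux I φ) y u v =
      fderiv ℝ (chartForm I G) (chartOrigin I G) (fderiv ℝ f y u) (fderiv ℝ f y v) +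
        fderiv ℝ (fderiv ℝ f) y u v := by
    intro u v
    have h6 : fderiv ℝ (darboux I φ) y = _ :=
      (eventually_darboux_eq hφ).fderiv_eq.trans h3.fderiv
    rw [h6]
    simp only [Function.comp_apply, hf0, chartForm_origin]
    simp [add_comm]
  rw [h5, h5, h4, hs u v, add_sub_add_right_eq_sub, fderiv_chartForm_origin]

theorem contDiffAt_darbouxRight {φ : V → G} {y : V} (hφ : ContMDiffAt 𝓘(ℝ, V) I ∞ φ y) :
    ContDiffAt ℝ ∞ (darbouxRight I φ) y := by
  have h := (contDiffAt_darboux hφ.inv).neg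
  refine h.congr_of_eventuallyEq ((eventually_mdifferentiableAt hφ).mono fun z hz => ?_)
  exact (neg_eq_iff_eq_neg.2 (darboux_inv hz)).symm

/-- The Maurer-Cartan equation `dC = [C, C] / 2` for a right Darboux derivative. -/
theorem fderiv_darbouxRight {φ : V → G} {y : V} (hφ : ContMDiffAt 𝓘(ℝ, V) I ∞ φ y) (u v : V) :
    fderiv ℝ (darbouxRight I φ) y u v - fderiv ℝ (darbouxRight I φ) y v u =
      lieBracketL I G (darbouxRight I φ y u) (darbouxRight I φ y v) := by
  have h1 : darbouxRight I φ =ᶠ[𝓝 y] fun z => -darboux I (fun z => (φ z)⁻¹) z :=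
    (eventually_mdifferentiableAt hφ).mono fun z hz => (neg_eq_iff_eq_neg.2 (darboux_inv hz)).symm
  have h2 := fderiv_darboux hφ.inv u v
  rw [h1.fderiv_eq, fderiv_fun_neg, h1.self_of_nhds]
  simp only [neg_apply, map_neg, neg_neg]
  rw [← neg_eq_iff_eq_neg.2 h2]
  abel

end StructureEquation

/-! ### One-parameter subgroups and the exponential map -/

section OneParameter

variable {E : Type*} [NormedAddCommGroup E] [NormedSpace ℝ E] [FiniteDimensional ℝ E]
  {H : Type*} [TopologicalSpace H] {I : ModelWithCorners ℝ E H} [I.Boundaryless]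
  {G : Type*} [TopologicalSpace G] [ChartedSpace H G] [Group G] [LieGroup I ∞ G]

theorem hasMFDerivAt_mulInvariantVectorField_iff {γ : ℝ → G} {t : ℝ} {v : E} :
    HasMFDerivAt 𝓘(ℝ, ℝ) I γ t ((1 : ℝ →L[ℝ] ℝ).smulRight
      (mulInvariantVectorField (I := I) (v : GroupLieAlgebra I G) (γ t))) ↔
      MDifferentiableAt 𝓘(ℝ, ℝ) I γ t ∧ darboux I γ t 1 = v := by
  have key : ∀ w : E, w = mderiv I I (fun x : G => γ t * x) 1 v ↔
      mderiv I I (fun x : G => (γ t)⁻¹ * x) (γ t) w = v := fun w =>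
    ⟨fun h => h ▸ mderiv_left_inverse I (γ t) v, fun h => h ▸ (mderiv_right_inverse I (γ t) w).symm⟩
  constructor
  · intro h
    refine ⟨h.mdifferentiableAt, (key _).1 ?_⟩
    have h1 : mderiv 𝓘(ℝ, ℝ) I γ t = ((1 : ℝ →L[ℝ] ℝ).smulRight
      (mderiv I I (fun x : G => γ t * x) 1 v)) := h.mfderiv
    rw [h1]
    exact one_smul ℝ _
  · rintro ⟨h, h1⟩
    have h2 : mderiv 𝓘(ℝ, ℝ) I γ t = ((1 : ℝ →L[ℝ] ℝ).smulRight
        (mderiv I I (fun x : G => γ t * x) 1 v)) := by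
      ext
      exact ((key _).2 h1).trans (one_smul ℝ _).symm
    have h3 := h.hasMFDerivAt
    have h4 : mfderiv 𝓘(ℝ, ℝ) I γ t = ((1 : ℝ →L[ℝ] ℝ).smulRight
      (mulInvariantVectorField (I := I) (v : GroupLieAlgebra I G) (γ t))) := h2
    exact h4 ▸ h3

theorem isMIntegralCurve_mulInvariantVectorField_iff {γ : ℝ → G} {v : E} :
    IsMIntegralCurve γ (mulInvariantVectorField (I := I) (v : GroupLieAlgebra I G)) ↔
      ∀ t, MDifferentiableAt 𝓘(ℝ, ℝ) I γ t ∧ darboux I γ t 1 = v :=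
  forall_congr' fun _ => hasMFDerivAt_mulInvariantVectorField_iff

theorem contMDiff_one_mulInvariantVectorField (v : E) :
    ContMDiff I I.tangent 1 fun x : G =>
      (⟨x, mulInvariantVectorField (I := I) (v : GroupLieAlgebra I G) x⟩ : TangentBundle I G) := by
  have : LieGroup I (minSmoothness ℝ 3) G :=
    LieGroup.of_le (n := ∞) (by rw [minSmoothness_of_isRCLikeNormedField]; exact ENat.LEInfty.out)
  exact (contMDiff_mulInvariantVectorField (I := I) (G := G) v).of_le
    (by rw [minSmoothness_of_isRCLikeNormedField]; exact one_le_two)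

variable [T2Space G]

theorem leftInvariantCurve_unique {γ γ' : ℝ → G} {v : E}
    (h : ∀ t, MDifferentiableAt 𝓘(ℝ, ℝ) I γ t ∧ darboux I γ t 1 = v)
    (h' : ∀ t, MDifferentiableAt 𝓘(ℝ, ℝ) I γ' t ∧ darboux I γ' t 1 = v) (h0 : γ 0 = γ' 0) :
    γ = γ' :=
  isMIntegralCurve_Ioo_eq_of_contMDiff_boundaryless (contMDiff_one_mulInvariantVectorField v)
    (isMIntegralCurve_mulInvariantVectorField_iff.2 h)
    (isMIntegralCurve_mulInvariantVectorField_iff.2 h') h0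

theorem leftInvariantCurve_unique_Ioo {γ γ' : ℝ → G} {v : E} {a b : ℝ} (ha : a < 0) (hb : 0 < b)
    (h : ∀ t ∈ Ioo a b, MDifferentiableAt 𝓘(ℝ, ℝ) I γ t ∧ darboux I γ t 1 = v)
    (h' : ∀ t ∈ Ioo a b, MDifferentiableAt 𝓘(ℝ, ℝ) I γ' t ∧ darboux I γ' t 1 = v)
    (h0 : γ 0 = γ' 0) : EqOn γ γ' (Ioo a b) :=
  isMIntegralCurveOn_Ioo_eqOn_of_contMDiff_boundaryless (t₀ := 0) ⟨ha, hb⟩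
    (contMDiff_one_mulInvariantVectorField v)
    (fun t ht => (hasMFDerivAt_mulInvariantVectorField_iff.2 (h t ht)).hasMFDerivWithinAt)
    (fun t ht => (hasMFDerivAt_mulInvariantVectorField_iff.2 (h' t ht)).hasMFDerivWithinAt) h0

theorem leftInvariantCurve_translate {γ : ℝ → G} {v : E} {t : ℝ} (a : G)
    (h : MDifferentiableAt 𝓘(ℝ, ℝ) I γ t ∧ darboux I γ t 1 = v) :
    MDifferentiableAt 𝓘(ℝ, ℝ) I (fun s => a * γ s) t ∧ darboux I (fun s => a * γ s) t 1 = v :=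
  ⟨(mdifferentiable_left I a _).comp t h.1, by rw [darboux_mul_left h.1, h.2]⟩

theorem exists_leftInvariantCurve (v : E) :
    ∃ γ : ℝ → G, γ 0 = 1 ∧
      IsMIntegralCurve γ (mulInvariantVectorField (I := I) (v : GroupLieAlgebra I G)) := by
  have : CompleteSpace E := FiniteDimensional.complete ℝ E
  have hv := contMDiff_one_mulInvariantVectorField (I := I) (G := G) v
  obtain ⟨γ, hγ0, hγ⟩ := exists_isMIntegralCurveAt_of_contMDiffAt_boundaryless (t₀ := 0)
    (hv.contMDiffAt (x := (1 : G)))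
  obtain ⟨ε, hε, hγ⟩ := Metric.eventually_nhds_iff_ball.1 hγ
  refine exists_isMIntegralCurve_of_isMIntegralCurveOn hv hε (fun x => ?_) 1
  refine ⟨fun t => x * γ t, by simp [hγ0], fun t ht => ?_⟩
  have ht' : t ∈ Metric.ball (0 : ℝ) ε := by rwa [Real.ball_eq_Ioo, zero_sub, zero_add]
  exact (hasMFDerivAt_mulInvariantVectorField_iff.2 (leftInvariantCurve_translate x
    (hasMFDerivAt_mulInvariantVectorField_iff.1 (hγ t ht')))).hasMFDerivWithinAt

theorem lieExp_eq {γ : ℝ → G} {v : E} (h0 : γ 0 = 1)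
    (h : ∀ t, MDifferentiableAt 𝓘(ℝ, ℝ) I γ t ∧ darboux I γ t 1 = v) : lieExp I G v = γ 1 := by
  have he := exists_leftInvariantCurve (I := I) (G := G) v
  rw [lieExp, dif_pos he]
  exact congrFun (leftInvariantCurve_unique
    (isMIntegralCurve_mulInvariantVectorField_iff.1 he.choose_spec.2) h
    (he.choose_spec.1.trans h0.symm)) 1

theorem leftInvariantCurve_comp {γ : ℝ → G} {v : E}
    (h : ∀ t, MDifferentiableAt 𝓘(ℝ, ℝ) I γ t ∧ darboux I γ t 1 = v) {f : ℝ → ℝ} {c : ℝ}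
    (hf : ∀ t, HasDerivAt f c t) (t : ℝ) :
    MDifferentiableAt 𝓘(ℝ, ℝ) I (fun s => γ (f s)) t ∧ darboux I (fun s => γ (f s)) t 1 = c • v := by
  refine ⟨(h (f t)).1.comp t (hf t).differentiableAt.mdifferentiableAt, ?_⟩
  rw [darboux_comp (h (f t)).1 (hf t).differentiableAt, ContinuousLinearMap.comp_apply,
    fderiv_eq_smul_deriv, (hf t).deriv, one_smul, ← mul_one c, ← smul_eq_mul, map_smul, (h _).2,
    smul_eq_mul, mul_one]

variable (I G) in
theorem leftInvariantCurve_lieExp (v : E) (t : ℝ) :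
    MDifferentiableAt 𝓘(ℝ, ℝ) I (fun s : ℝ => lieExp I G (s • v)) t ∧
      darboux I (fun s : ℝ => lieExp I G (s • v)) t 1 = v := by
  obtain ⟨γ, h0, hγ⟩ := exists_leftInvariantCurve (I := I) (G := G) v
  have h := isMIntegralCurve_mulInvariantVectorField_iff.1 hγ
  have e : (fun s : ℝ => lieExp I G (s • v)) = γ := by
    funext s
    have h1 := leftInvariantCurve_comp h (f := fun t => s * t) (c := s) fun t => by
      simpa using (hasDerivAt_id t).const_mul s
    rw [lieExp_eq (γ := fun t => γ (s * t)) (by simpa using h0) h1, mul_one]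
  rw [e]
  exact h t

variable (I G) in
theorem lieExp_zero : lieExp I G 0 = 1 :=
  lieExp_eq (γ := fun _ => 1) rfl fun _ => ⟨mdifferentiableAt_const, by
    rw [darboux_const]; rfl⟩

variable (I G) in
theorem lieExp_add_smul (s t : ℝ) (v : E) :
    lieExp I G ((s + t) • v) = lieExp I G (s • v) * lieExp I G (t • v) := by
  have h := leftInvariantCurve_lieExp I G v
  have h1 := leftInvariantCurve_comp h (f := fun t => s + t) (c := 1)
    fun t => (hasDerivAt_id t).const_add s
  simp only [one_smul] at h1
  refine congrFun (leftInvariantCurve_unique h1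
    (fun t => leftInvariantCurve_translate (lieExp I G (s • v)) (h t)) ?_) t
  simp [lieExp_zero]

variable (I G) in
theorem lieExp_nsmul (n : ℕ) (v : E) : lieExp I G ((n : ℝ) • v) = lieExp I G v ^ n := by
  induction n with
  | zero => simp [lieExp_zero]
  | succ n ih => rw [Nat.cast_succ, lieExp_add_smul, ih, one_smul, pow_succ]

theorem lieExp_lieAdjoint (k : G) (v : E) :
    lieExp I G (lieAdjoint I k v) = k * lieExp I G v * k⁻¹ := by
  have h := leftInvariantCurve_lieExp I G v
  rw [lieExp_eq (γ := fun t => k * lieExp I G (t • v) * k⁻¹) (by simp [lieExp_zero]), one_smul]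
  refine fun t => ⟨(mdifferentiable_conj I k _).comp t (h t).1, ?_⟩
  rw [darboux_conj (h t).1, ContinuousLinearMap.comp_apply, (h t).2]

theorem lieAdjoint_lieExp_smul (s : ℝ) (v : E) : lieAdjoint I (lieExp I G (s • v)) v = v := by
  have h := leftInvariantCurve_lieExp I G v 0
  have e : (fun t : ℝ => lieExp I G (s • v) * lieExp I G (t • v) * (lieExp I G (s • v))⁻¹) =
      fun t => lieExp I G (t • v) := by
    funext t
    rw [mul_inv_eq_iff_eq_mul, ← lieExp_add_smul, ← lieExp_add_smul, add_comm]
  have h1 := darboux_conj h.1 (lieExp I G (s • v))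
  rw [e] at h1
  have h2 := congrArg (fun L => L 1) h1
  simp only [ContinuousLinearMap.comp_apply, h.2] at h2
  exact h2.symm

end OneParameter

/-! ### Smooth dependence on parameters for autonomous equations linear in the parameter -/

section Parameters

variable {E : Type*} [NormedAddCommGroup E] [NormedSpace ℝ E]

/-- The shear `(v, γ) ↦ (v, γ - S v)`. -/
def shearEquiv {W : Type*} [NormedAddCommGroup W] [NormedSpace ℝ W] (S : E →L[ℝ] W) :
    (E × W) ≃L[ℝ] (E × W) :=
  ContinuousLinearEquiv.equivOfInverse
    ((ContinuousLinearMap.fst ℝ E W).prod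
      (ContinuousLinearMap.snd ℝ E W - S.comp (ContinuousLinearMap.fst ℝ E W)))
    ((ContinuousLinearMap.fst ℝ E W).prod
      (ContinuousLinearMap.snd ℝ E W + S.comp (ContinuousLinearMap.fst ℝ E W)))
    (fun p => by ext <;> simp) (fun p => by ext <;> simp)

/-- The integral equation `γ = x₀ + ∫ f(γ) v` on `[-2, 2]` has, for small `v`, a solution which
depends smoothly on `v`. -/
theorem exists_contDiffAt_integralEquation [CompleteSpace E] {f : E → E →L[ℝ] E}
    (hf : ContDiff ℝ ∞ f) (x₀ : E) :
    ∃ Γ : E → C(Icc (-2 : ℝ) 2, E), ContDiffAt ℝ ∞ Γ 0 ∧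
      Γ 0 = constCurve (Icc (-2 : ℝ) 2) E x₀ ∧
      ∀ᶠ v in 𝓝 (0 : E), ∀ t : Icc (-2 : ℝ) 2, Γ v t = x₀ + ∫ s in (0 : ℝ)..t,
        f (Γ v (projIcc (-2) 2 (by norm_num) s)) v := by
  set K := Icc (-2 : ℝ) 2
  set J := primitiveOperator (a := -2) (b := 2) (by norm_num) (by norm_num) E
  set c := constCurve K E
  set N := fun p : E × C(K, E) =>
    J (pointwisePairing K E E (compOperator K hf.continuous p.2) (c p.1)) with hN
  have hcomp : ContDiff ℝ ∞ fun p : E × C(K, E) =>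
      pointwisePairing K E E (compOperator K hf.continuous p.2) := by
    have h1 : ContDiff ℝ ∞ fun p : E × C(K, E) => compOperator K hf.continuous p.2 :=
      (contDiff_compOperator (K := K) hf).comp contDiff_snd
    have h2 : ContDiff ℝ ∞ (pointwisePairing K E E) := ContinuousLinearMap.contDiff _
    exact h2.comp h1
  have hcfst : ContDiff ℝ ∞ fun p : E × C(K, E) => c p.1 := c.contDiff.comp contDiff_fst
  have hNs : ContDiff ℝ ∞ N := J.contDiff.comp (hcomp.clm_apply hcfst)
  set S : E →L[ℝ] C(K, E) :=
    J.comp ((pointwisePairing K E E (compOperator K hf.continuous (c x₀))).comp c) with hS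
  have hN' : HasFDerivAt N (S.comp (ContinuousLinearMap.fst ℝ E C(K, E))) (0, c x₀) := by
    have h1 := (hcomp.differentiable (by simp) (0, c x₀)).hasFDerivAt
    have h2 : HasFDerivAt (fun p : E × C(K, E) => c p.1)
      (c.comp (ContinuousLinearMap.fst ℝ E C(K, E))) (0, c x₀) :=
      c.hasFDerivAt.comp (0, c x₀) hasFDerivAt_fst
    refine (J.hasFDerivAt.comp (0, c x₀) (h1.clm_apply h2)).congr_fderiv ?_
    refine ContinuousLinearMap.ext fun p => ?_
    simp [hS]
  set Ψ := fun p : E × C(K, E) => (p.1, p.2 - c x₀ - N p) with hΨ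
  have hΨs : ContDiff ℝ ∞ Ψ :=
    contDiff_fst.prodMk ((contDiff_snd.sub contDiff_const).sub hNs)
  have hΨ' : HasFDerivAt Ψ ((shearEquiv S : (E × C(K, E)) ≃L[ℝ] (E × C(K, E))) :
      (E × C(K, E)) →L[ℝ] (E × C(K, E))) (0, c x₀) :=
    HasFDerivAt.prodMk hasFDerivAt_fst ((hasFDerivAt_snd.sub_const _).sub hN')
  have hΨ0 : Ψ (0, c x₀) = (0, 0) := by simp [hΨ, hN]
  have hΨat : ContDiffAt ℝ ∞ Ψ (0, c x₀) := hΨs.contDiffAt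
  set g := hΨat.localInverse hΨ' (by simp) with hg
  have hgs : ContDiffAt ℝ ∞ g (0, 0) := hΨ0 ▸ hΨat.to_localInverse hΨ' (by simp)
  have hg0 : g (0, 0) = (0, c x₀) := hΨ0 ▸ hΨat.localInverse_apply_image hΨ' (by simp)
  have hinv : ∀ᶠ q in 𝓝 ((0, 0) : E × C(K, E)), Ψ (g q) = q := by
    have := (hΨat.hasStrictFDerivAt' hΨ' (by simp)).eventually_right_inverse
    rwa [hΨ0] at this
  have hc : ContDiff ℝ ∞ fun v : E => ((v, 0) : E × C(K, E)) :=
    contDiff_id.prodMk contDiff_const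
  refine ⟨fun v => (g (v, 0)).2, ?_, congrArg Prod.snd hg0, ?_⟩
  · exact contDiffAt_snd.comp (0 : E) (ContDiffAt.comp (0 : E) hgs hc.contDiffAt)
  · filter_upwards [(hc.continuous.tendsto 0).eventually hinv] with v hv t
    have h1 : (g (v, 0)).1 = v := congrArg Prod.fst hv
    have h2 : (g (v, 0)).2 - c x₀ - N (g (v, 0)) = 0 := congrArg Prod.snd hv
    rw [sub_sub, sub_eq_zero] at h2
    have h3 := congrArg (fun γ : C(K, E) => γ t) h2
    refine h3.trans ?_
    rw [ContinuousMap.add_apply, hN]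
    simp only [h1]
    rfl

end Parameters

section Smoothness

variable {E : Type*} [NormedAddCommGroup E] [NormedSpace ℝ E] [FiniteDimensional ℝ E]
  {H : Type*} [TopologicalSpace H] {I : ModelWithCorners ℝ E H} [I.Boundaryless]
  {G : Type*} [TopologicalSpace G] [ChartedSpace H G] [Group G] [LieGroup I ∞ G]

variable (I G) in
theorem exists_contDiff_eq_inverse_chartForm : ∃ f : E → E →L[ℝ] E, ContDiff ℝ ∞ f ∧
    f =ᶠ[𝓝 (chartOrigin I G)] fun x => (chartForm I G x).inverse := by
  have : CompleteSpace E := FiniteDimensional.complete ℝ E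
  set P := fun x => (chartForm I G x).inverse with hP
  have h1 : ∀ᶠ x in 𝓝 (chartOrigin I G), ContDiffAt ℝ ∞ P x := by
    filter_upwards [target_mem_nhds I G, eventually_isInvertible_chartForm I G] with x h1 h2
    obtain ⟨e, he⟩ := h2
    have h3 : ContDiffAt ℝ ∞ ContinuousLinearMap.inverse (chartForm I G x) :=
      he ▸ contDiffAt_map_inverse e
    exact h3.comp x (contDiffAt_chartForm h1)
  obtain ⟨r, hr, h1⟩ := Metric.eventually_nhds_iff_ball.1 h1
  let b : ContDiffBump (chartOrigin I G) := ⟨r / 3, r / 2, by positivity, by linarith⟩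
  refine ⟨fun x => b x • P x, contDiff_iff_contDiffAt.2 fun x => ?_, ?_⟩
  · by_cases hx : x ∈ Metric.ball (chartOrigin I G) r
    · exact b.contDiffAt.smul (h1 x hx)
    · have h2 : x ∉ tsupport b := by
        rw [b.tsupport_eq, Metric.mem_closedBall]
        rw [Metric.mem_ball] at hx
        change ¬ dist x _ ≤ r / 2
        linarith
      refine (contDiffAt_const (c := 0)).congr_of_eventuallyEq ?_
      filter_upwards [notMem_tsupport_iff_eventuallyEq.1 h2] with y hy
      rw [hy, Pi.zero_apply, zero_smul]
  · filter_upwards [b.eventuallyEq_one] with x hx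
    rw [hx, Pi.one_apply, one_smul]

variable [T2Space G]

variable (I G) in
theorem exists_contDiffAt_lieExp_eq : ∃ θ : E → E, ContDiffAt ℝ ∞ θ 0 ∧ θ 0 = chartOrigin I G ∧
    ∀ᶠ v in 𝓝 (0 : E), lieExp I G v = expChart I G (θ v) := by
  have : CompleteSpace E := FiniteDimensional.complete ℝ E
  obtain ⟨f, hf, hfe⟩ := exists_contDiff_eq_inverse_chartForm I G
  obtain ⟨Γ, hΓ, hΓ0, hΓe⟩ := exists_contDiffAt_integralEquation hf (chartOrigin I G)
  set t1 : Icc (-2 : ℝ) 2 := ⟨1, by norm_num⟩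
  have hθ : ContDiffAt ℝ ∞ (fun v => Γ v t1) 0 := ContDiffAt.comp (0 : E)
    (ContinuousLinearMap.contDiff (ContinuousMap.evalCLM (M := E) ℝ t1)).contDiffAt hΓ
  refine ⟨fun v => Γ v t1, hθ, congrArg (fun γ => γ t1) hΓ0, ?_⟩
  have hgood : ∀ᶠ x in 𝓝 (chartOrigin I G), x ∈ (extChartAt I (1 : G)).target ∧
      ∀ v, chartForm I G x (f x v) = v := by
    filter_upwards [target_mem_nhds I G, eventually_isInvertible_chartForm I G, hfe]
      with x h1 h2 h3
    refine ⟨h1, fun v => ?_⟩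
    obtain ⟨e, he⟩ := h2
    rw [h3, ← he, ContinuousLinearMap.inverse_equiv]
    exact e.apply_symm_apply v
  obtain ⟨ε, hε, hgood⟩ := Metric.eventually_nhds_iff_ball.1 hgood
  have hclose : ∀ᶠ v in 𝓝 (0 : E), ∀ t, Γ v t ∈ Metric.ball (chartOrigin I G) ε := by
    have h1 : ∀ᶠ v in 𝓝 (0 : E), dist (Γ v) (Γ 0) < ε :=
      hΓ.continuousAt.eventually (Metric.ball_mem_nhds _ hε)
    filter_upwards [h1] with v hv t
    have h2 := (ContinuousMap.dist_apply_le_dist (f := Γ v) (g := Γ 0) t).trans_lt hv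
    rwa [hΓ0, constCurve_apply] at h2
  filter_upwards [hΓe, hclose] with v hv hc
  have hle : (-2 : ℝ) ≤ 2 := by norm_num
  set q : ℝ → E := fun s => f (Γ v (projIcc (-2) 2 hle s)) v with hq
  have hqc : Continuous q :=
    (hf.continuous.comp ((Γ v).continuous.comp continuous_projIcc)).clm_apply continuous_const
  set x : ℝ → E := fun t => chartOrigin I G + ∫ s in (0 : ℝ)..t, q s with hx
  have hx' : ∀ t, HasDerivAt x (q t) t := fun t =>
    (intervalIntegral.integral_hasDerivAt_right (hqc.intervalIntegrable _ _)
      (hqc.stronglyMeasurableAtFilter _ _) hqc.continuousAt).const_add _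
  have hxΓ : ∀ (t : ℝ) (ht : t ∈ Icc (-2 : ℝ) 2), x t = Γ v ⟨t, ht⟩ := fun t ht => (hv ⟨t, ht⟩).symm
  have h1 : ∀ t ∈ Ioo (-2 : ℝ) 2, MDifferentiableAt 𝓘(ℝ, ℝ) I (fun t => expChart I G (x t)) t ∧
      darboux I (fun t => expChart I G (x t)) t 1 = v := by
    intro t ht
    have ht' := Ioo_subset_Icc_self ht
    have hxt := hgood _ (hc ⟨t, ht'⟩)
    rw [← hxΓ] at hxt
    have hm := mdifferentiableAt_expChart hxt.1
    refine ⟨hm.comp t (hx' t).differentiableAt.mdifferentiableAt, ?_⟩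
    rw [darboux_comp hm (hx' t).differentiableAt, ContinuousLinearMap.comp_apply,
      (hx' t).hasFDerivAt.fderiv, ContinuousLinearMap.toSpanSingleton_apply, one_smul, hq]
    simp only [projIcc_of_mem _ ht', ← hxΓ]
    exact hxt.2 v
  have h2 := leftInvariantCurve_unique_Ioo (by norm_num) (by norm_num)
    (fun t _ => leftInvariantCurve_lieExp I G v t) h1 (by simp [hx, lieExp_zero, expChart_chartOrigin])
    (show (1 : ℝ) ∈ Ioo (-2 : ℝ) 2 by norm_num)
  have h3 : lieExp I G ((1 : ℝ) • v) = expChart I G (x 1) := h2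
  rw [one_smul] at h3
  rw [h3, hxΓ 1 (by norm_num)]

variable (I G) in
theorem contMDiff_lieExp : ContMDiff 𝓘(ℝ, E) I ∞ (lieExp I G) := by
  obtain ⟨θ, hθ, hθ0, hexp⟩ := exists_contDiffAt_lieExp_eq I G
  have h0 : ContMDiffAt 𝓘(ℝ, E) I ∞ (lieExp I G) 0 := by
    have h1 : ContMDiffAt 𝓘(ℝ, E) I ∞ (expChart I G) (θ 0) :=
      contMDiffAt_expChart (hθ0 ▸ mem_extChartAt_target 1)
    exact (h1.comp (0 : E) hθ.contMDiffAt).congr_of_eventuallyEq hexp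
  refine contMDiff_infty.2 fun m v => ?_
  have hm : LieGroup I m G := LieGroup.of_le (n := ∞) (by exact_mod_cast le_top)
  have h1 : ∀ᶠ w in 𝓝 (0 : E), ContMDiffAt 𝓘(ℝ, E) I m (lieExp I G) w :=
    (contMDiffAt_iff_contMDiffAt_nhds (by simp)).1 (h0.of_le (by exact_mod_cast le_top))
  have h2 : Filter.Tendsto (fun n : ℕ => (1 / ((n : ℝ) + 1)) • v) Filter.atTop (𝓝 0) := by
    simpa using (tendsto_one_div_add_atTop_nhds_zero_nat (𝕜 := ℝ)).smul_const v
  obtain ⟨n, hn⟩ := (h2.eventually h1).exists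
  have hn0 : ((n : ℝ) + 1) ≠ 0 := by positivity
  have e : lieExp I G = fun w : E => lieExp I G ((1 / ((n : ℝ) + 1)) • w) ^ (n + 1) := by
    funext w
    rw [← lieExp_nsmul, smul_smul, Nat.cast_succ, mul_one_div_cancel hn0, one_smul]
  rw [e]
  exact (contMDiff_pow (n + 1)).contMDiffAt.comp v
    (ContMDiffAt.comp v hn (contDiff_const_smul _).contDiffAt.contMDiffAt)

end Smoothness

/-! ### Invariance of the bracket and of the inner product -/

section Invariance

variable {E : Type*} [NormedAddCommGroup E] [NormedSpace ℝ E] [FiniteDimensional ℝ E]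
  {H : Type*} [TopologicalSpace H] {I : ModelWithCorners ℝ E H} [I.Boundaryless]
  {G : Type*} [TopologicalSpace G] [ChartedSpace H G] [Group G] [LieGroup I ∞ G]

omit [I.Boundaryless] in
variable (I G) in
theorem lieBracketL_skew (x y : E) : lieBracketL I G x y = -lieBracketL I G y x := by
  have : LieGroup I (minSmoothness ℝ 3) G :=
    LieGroup.of_le (n := ∞) (by rw [minSmoothness_of_isRCLikeNormedField]; exact ENat.LEInfty.out)
  have : CompleteSpace E := FiniteDimensional.complete ℝ E
  have h (x y : GroupLieAlgebra I G) : ⁅x, y⁆ = -⁅y, x⁆ := (lie_skew x y).symm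
  exact h x y

omit [I.Boundaryless] in
variable (I G) in
theorem lieBracketL_jacobi (x y z : E) :
    lieBracketL I G x (lieBracketL I G y z) + lieBracketL I G y (lieBracketL I G z x) +
      lieBracketL I G z (lieBracketL I G x y) = 0 := by
  have : LieGroup I (minSmoothness ℝ 3) G :=
    LieGroup.of_le (n := ∞) (by rw [minSmoothness_of_isRCLikeNormedField]; exact ENat.LEInfty.out)
  have : CompleteSpace E := FiniteDimensional.complete ℝ E
  have h (x y z : GroupLieAlgebra I G) : ⁅x, ⁅y, z⁆⁆ + ⁅y, ⁅z, x⁆⁆ + ⁅z, ⁅x, y⁆⁆ = 0 :=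
    lie_jacobi x y z
  exact h x y z

theorem lieAdjoint_lieBracketL (a : G) (u v : E) :
    lieAdjoint I a (lieBracketL I G u v) =
      lieBracketL I G (lieAdjoint I a u) (lieAdjoint I a v) := by
  have h0 : chartOrigin I G ∈ (extChartAt I (1 : G)).target := mem_extChartAt_target 1
  have hx := contMDiffAt_expChart h0
  have hψ : ContMDiffAt 𝓘(ℝ, E) I ∞ (fun z => a * expChart I G z * a⁻¹) (chartOrigin I G) :=
    (contMDiff_conj I a).contMDiffAt.comp _ hx
  have h1 := fderiv_darboux hψ u v
  have h2 : darboux I (fun z => a * expChart I G z * a⁻¹) =ᶠ[𝓝 (chartOrigin I G)]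
      fun z => (lieAdjoint I a).comp (chartForm I G z) :=
    (eventually_mdifferentiableAt hx).mono fun z hz => darboux_conj hz a
  have h3 : HasFDerivAt (chartForm I G) (fderiv ℝ (chartForm I G) (chartOrigin I G))
      (chartOrigin I G) := ((contDiffAt_chartForm h0).differentiableAt (by simp)).hasFDerivAt
  have h4 : HasFDerivAt (fun z => (lieAdjoint I a).comp (chartForm I G z)) _ (chartOrigin I G) :=
    (hasFDerivAt_const (lieAdjoint I a) _).clm_comp h3
  have h5 := h2.self_of_nhds
  simp only [chartForm_origin] at h5
  rw [h2.fderiv_eq, h4.fderiv, h5] at h1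
  have h6 := fderiv_chartForm_origin I G u v
  rw [← neg_eq_iff_eq_neg] at h6
  have h7 : lieBracketL I G (lieAdjoint I a u) (lieAdjoint I a v) =
      -(lieAdjoint I a (fderiv ℝ (chartForm I G) (chartOrigin I G) u v) -
        lieAdjoint I a (fderiv ℝ (chartForm I G) (chartOrigin I G) v u)) := by
    refine (neg_eq_iff_eq_neg.2 h1).symm.trans ?_
    simp
  rw [h7, ← h6, map_neg, map_sub]

variable (I G) in
theorem contDiffAt_lieAdjoint_expChart :
    ContDiffAt ℝ ∞ (fun x => lieAdjoint I (expChart I G x)) (chartOrigin I G) := by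
  have : CompleteSpace E := FiniteDimensional.complete ℝ E
  have h0 : chartOrigin I G ∈ (extChartAt I (1 : G)).target := mem_extChartAt_target 1
  have hx := contMDiffAt_expChart h0
  refine ((contDiffAt_darbouxRight hx).clm_comp
    (contDiffAt_inverse_chartForm I G)).congr_of_eventuallyEq ?_
  filter_upwards [eventually_mdifferentiableAt hx, eventually_isInvertible_chartForm I G]
    with x h1 h2
  rw [darbouxRight_eq h1]
  obtain ⟨e, he⟩ := h2
  change _ = ((lieAdjoint I (expChart I G x)).comp (chartForm I G x)).comp (chartForm I G x).inverse
  rw [← he, ContinuousLinearMap.inverse_equiv]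
  ext v
  simp

variable [T2Space G]

/-- One-parameter subgroups in the preferred chart at the identity. -/
theorem exists_hasDerivAt_lieExp_eq (u : E) : ∃ c : ℝ → E, HasDerivAt c u 0 ∧
    c 0 = chartOrigin I G ∧ ∀ᶠ t in 𝓝 (0 : ℝ), lieExp I G (t • u) = expChart I G (c t) := by
  have h0 : chartOrigin I G ∈ (extChartAt I (1 : G)).target := mem_extChartAt_target 1
  obtain ⟨θ, hθ, hθ0, hexp⟩ := exists_contDiffAt_lieExp_eq I G
  have hc : HasDerivAt (fun t : ℝ => t • u) u 0 := by
    simpa using (hasDerivAt_id (0 : ℝ)).smul_const u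
  have hc0 : Filter.Tendsto (fun t : ℝ => t • u) (𝓝 0) (𝓝 0) := by
    simpa using hc.continuousAt.tendsto
  have hθ' : HasFDerivAt θ (fderiv ℝ θ 0) ((0 : ℝ) • u) := by
    rw [zero_smul]
    exact (hθ.differentiableAt (by simp)).hasFDerivAt
  have hx' : HasDerivAt (fun t : ℝ => θ (t • u)) (fderiv ℝ θ 0 u) 0 := hθ'.comp_hasDerivAt 0 hc
  have hx0 : θ ((0 : ℝ) • u) = chartOrigin I G := by rw [zero_smul, hθ0]
  have he : (fun t : ℝ => lieExp I G (t • u)) =ᶠ[𝓝 0] fun t => expChart I G (θ (t • u)) :=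
    hc0.eventually hexp
  have h4 : fderiv ℝ θ 0 u = u := by
    have h5 := (leftInvariantCurve_lieExp I G u 0).2
    rw [darboux_congr he, darboux_comp (hx0 ▸ mdifferentiableAt_expChart h0)
      hx'.differentiableAt] at h5
    change (chartForm I G (θ ((0 : ℝ) • u))) _ = u at h5
    rw [hx0, chartForm_origin, hx'.hasFDerivAt.fderiv] at h5
    simpa using h5
  rw [h4] at hx'
  exact ⟨fun t => θ (t • u), hx', hx0, he⟩

omit [FiniteDimensional ℝ E] in
theorem hasFDerivAt_apply_eq_zero {P : E → E →L[ℝ] E} {D : E →L[ℝ] E →L[ℝ] E} {x u : E}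
    (hD : HasFDerivAt P D x) {c : ℝ → E} (hc : HasDerivAt c u 0) (hc0 : c 0 = x)
    (h : ∀ᶠ t in 𝓝 (0 : ℝ), P (c t) u = u) : D u u = 0 := by
  subst hc0
  have h1 : HasFDerivAt (fun x => P x u) (D.flip u) (c 0) := by
    simpa using hD.clm_apply (hasFDerivAt_const u (c 0))
  exact (h1.comp_hasDerivAt 0 hc).unique ((hasDerivAt_const (0 : ℝ) u).congr_of_eventuallyEq h)

omit [T2Space G] in
theorem fderiv_lieAdjoint_expChart_sub (u v : E) :
    fderiv ℝ (fun x => lieAdjoint I (expChart I G x)) (chartOrigin I G) u v -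
      fderiv ℝ (fun x => lieAdjoint I (expChart I G x)) (chartOrigin I G) v u =
      (2 : ℝ) • lieBracketL I G u v := by
  have h0 : chartOrigin I G ∈ (extChartAt I (1 : G)).target := mem_extChartAt_target 1
  have hx := contMDiffAt_expChart h0
  have hD := ((contDiffAt_lieAdjoint_expChart I G).differentiableAt (by simp)).hasFDerivAt
  have hA : HasFDerivAt (chartForm I G) (fderiv ℝ (chartForm I G) (chartOrigin I G))
      (chartOrigin I G) := ((contDiffAt_chartForm h0).differentiableAt (by simp)).hasFDerivAt
  have hPA : darbouxRight I (expChart I G) =ᶠ[𝓝 (chartOrigin I G)]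
      fun x => (lieAdjoint I (expChart I G x)).comp (chartForm I G x) :=
    (eventually_mdifferentiableAt hx).mono fun x hx => darbouxRight_eq hx
  have h1 : ∀ u v, fderiv ℝ (darbouxRight I (expChart I G)) (chartOrigin I G) u v =
      fderiv ℝ (fun x => lieAdjoint I (expChart I G x)) (chartOrigin I G) u v +
        fderiv ℝ (chartForm I G) (chartOrigin I G) u v := by
    intro u v
    rw [hPA.fderiv_eq, (hD.clm_comp hA).fderiv, expChart_chartOrigin, lieAdjoint_one,
      chartForm_origin]
    simp [add_comm]
  have h3 := fderiv_darbouxRight hx u v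
  have h4 := fderiv_chartForm_origin I G u v
  have h5 := hPA.self_of_nhds
  simp only [expChart_chartOrigin, lieAdjoint_one, chartForm_origin,
    ContinuousLinearMap.comp_id] at h5
  rw [h1, h1, add_sub_add_comm, h4, h5] at h3
  rw [two_smul, ← sub_eq_iff_eq_add, sub_eq_add_neg]
  exact h3

/-- The derivative of the adjoint representation is the bracket. -/
theorem fderiv_lieAdjoint_expChart (u v : E) :
    fderiv ℝ (fun x => lieAdjoint I (expChart I G x)) (chartOrigin I G) u v =
      lieBracketL I G u v := by
  have hD := ((contDiffAt_lieAdjoint_expChart I G).differentiableAt (by simp)).hasFDerivAt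
  have h5 := fderiv_lieAdjoint_expChart_sub (I := I) (G := G) u v
  set D : E →L[ℝ] E →L[ℝ] E :=
    fderiv ℝ (fun x => lieAdjoint I (expChart I G x)) (chartOrigin I G)
  have h3 : ∀ u, D u u = 0 := fun u => by
    obtain ⟨c, hc, hc0, hce⟩ := exists_hasDerivAt_lieExp_eq (I := I) (G := G) u
    refine hasFDerivAt_apply_eq_zero hD hc hc0 (hce.mono fun t ht => ?_)
    rw [← ht]
    exact lieAdjoint_lieExp_smul t u
  have h4 : D u v + D v u = 0 := by
    have h4 := h3 (u + v)
    rw [map_add, map_add, add_apply, add_apply, h3, h3, zero_add, add_zero] at h4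
    rw [add_comm]
    exact h4
  rw [add_comm, ← eq_neg_iff_add_eq_zero] at h4
  rw [h4, sub_neg_eq_add, ← two_smul ℝ] at h5
  exact smul_right_injective E (two_ne_zero (α := ℝ)) h5

variable {B : E →L[ℝ] E →L[ℝ] ℝ}

theorem IsInvariantInnerProduct.isInvariantPairing (hB : IsInvariantInnerProduct I G B) :
    IsInvariantPairing B (lieBracketL I G) := by
  refine ⟨hB.symm, lieBracketL_skew I G, lieBracketL_jacobi I G, fun x y z => ?_⟩
  · set P := fun x => lieAdjoint I (expChart I G x) with hP
    have hP0 : P (chartOrigin I G) = ContinuousLinearMap.id ℝ E := by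
      rw [hP]
      simp only [expChart_chartOrigin, lieAdjoint_one]
    have hD : HasFDerivAt P (fderiv ℝ P (chartOrigin I G)) (chartOrigin I G) :=
      ((contDiffAt_lieAdjoint_expChart I G).differentiableAt (by simp)).hasFDerivAt
    have h1 : ∀ w, HasFDerivAt (fun x => P x w) ((fderiv ℝ P (chartOrigin I G)).flip w)
        (chartOrigin I G) := fun w => by
      simpa using hD.clm_apply (hasFDerivAt_const w (chartOrigin I G))
    have h2 := ((B.hasFDerivAt.comp (chartOrigin I G) (h1 x))).clm_apply (h1 z)
    have h3 : (fun c => (B ∘ fun x_1 => (P x_1) x) c ((P c) z)) = fun _ => B x z :=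
      funext fun c => hB.invariant _ _ _
    rw [h3] at h2
    have h4 := congrArg (fun L => L y) (h2.unique (hasFDerivAt_const _ _))
    simp only [Function.comp_apply, hP0] at h4
    have h5 : B x (lieBracketL I G y z) + B (lieBracketL I G y x) z = 0 := by
      rw [← fderiv_lieAdjoint_expChart, ← fderiv_lieAdjoint_expChart]
      exact h4
    rw [lieBracketL_skew, map_neg, neg_apply]
    linarith

theorem cubicForm_lieAdjoint (hB : IsInvariantInnerProduct I G B) {V : Type*}
    [NormedAddCommGroup V] [NormedSpace ℝ V] (a : G) (φ : V →L[ℝ] E) :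
    cubicForm B (lieBracketL I G) ((lieAdjoint I a).comp φ) = cubicForm B (lieBracketL I G) φ := by
  ext u
  rw [cubicForm_apply hB.isInvariantPairing, cubicForm_apply hB.isInvariantPairing]
  simp only [ContinuousLinearMap.comp_apply]
  rw [← lieAdjoint_lieBracketL, hB.invariant]

end Invariance

/-! ### The fundamental formula of Fox calculus and the boundary of the surface chain -/

section FoxCalculus

/-- The additive extension of a function on a group to its integral group ring. -/
def groupRingEval {Γ W : Type*} [AddCommGroup W] (Λ : Γ → W) : MonoidAlgebra ℤ Γ →+ W :=
  (Finsupp.liftAddHom fun a => (smulAddHom ℤ W).flip (Λ a)).comp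
    MonoidAlgebra.coeffAddEquiv.toAddMonoidHom

theorem groupRingEval_apply {Γ W : Type*} [AddCommGroup W] (Λ : Γ → W) (z : MonoidAlgebra ℤ Γ) :
    groupRingEval Λ z = z.coeff.sum fun a n => n • Λ a := rfl

theorem groupRingEval_single {Γ W : Type*} [AddCommGroup W] (Λ : Γ → W) (a : Γ) (n : ℤ) :
    groupRingEval Λ (MonoidAlgebra.single a n) = n • Λ a := by
  rw [groupRingEval_apply]
  exact Finsupp.sum_single_index (zero_smul ℤ _)

theorem groupRingEval_of {Γ W : Type*} [Monoid Γ] [AddCommGroup W] (Λ : Γ → W) (a : Γ) :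
    groupRingEval Λ (MonoidAlgebra.of ℤ Γ a) = Λ a := by
  rw [MonoidAlgebra.of_apply, groupRingEval_single, one_smul]

theorem groupRingEval_of_mul {Γ W : Type*} [Monoid Γ] [AddCommGroup W] (Λ : Γ → W) (a : Γ)
    (z : MonoidAlgebra ℤ Γ) :
    groupRingEval Λ (MonoidAlgebra.of ℤ Γ a * z) = groupRingEval (fun b => Λ (a * b)) z := by
  induction z using MonoidAlgebra.induction_linear with
  | zero => simp
  | add x y hx hy => rw [mul_add, map_add, map_add, hx, hy]
  | single b n =>
    rw [MonoidAlgebra.of_apply, MonoidAlgebra.single_mul_single, one_mul, groupRingEval_single,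
      groupRingEval_single]

theorem groupRingEval_mul_of {Γ W : Type*} [Monoid Γ] [AddCommGroup W] (Λ : Γ → W) (a : Γ)
    (z : MonoidAlgebra ℤ Γ) :
    groupRingEval Λ (z * MonoidAlgebra.of ℤ Γ a) = groupRingEval (fun b => Λ (b * a)) z := by
  induction z using MonoidAlgebra.induction_linear with
  | zero => simp
  | add x y hx hy => rw [add_mul, map_add, map_add, hx, hy]
  | single b n =>
    rw [MonoidAlgebra.of_apply, MonoidAlgebra.single_mul_single, mul_one, groupRingEval_single,
      groupRingEval_single]

theorem groupRingEval_const {Γ W : Type*} [AddCommGroup W] (c : W) (z : MonoidAlgebra ℤ Γ) :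
    groupRingEval (fun _ => c) z = groupRingEval (fun _ : Γ => (1 : ℤ)) z • c := by
  induction z using MonoidAlgebra.induction_linear with
  | zero => simp
  | add x y hx hy => rw [map_add, map_add, hx, hy, add_smul]
  | single b n => rw [groupRingEval_single, groupRingEval_single, smul_eq_mul, mul_one]

theorem groupRingEval_add_sub {Γ W : Type*} [AddCommGroup W] (Λ Λ' Λ'' : Γ → W)
    (z : MonoidAlgebra ℤ Γ) :
    groupRingEval (fun a => Λ a + Λ' a - Λ'' a) z =
      groupRingEval Λ z + groupRingEval Λ' z - groupRingEval Λ'' z := by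
  simp only [groupRingEval_apply, smul_sub, smul_add, Finsupp.sum_sub, Finsupp.sum_add]

variable {ι : Type*} [DecidableEq ι]

theorem foxDeriv_one (i : ι) : foxDeriv i (1 : FreeGroup ι) = 0 := by
  rw [foxDeriv, map_one, Equiv.Perm.one_apply]

/-- The augmented Fox derivative, i.e. the exponent sum of a generator. -/
def exponentSum (i : ι) : FreeGroup ι →* Multiplicative ℤ where
  toFun w := Multiplicative.ofAdd (groupRingEval (fun _ => 1) (foxDeriv i w))
  map_one' := by rw [foxDeriv_one, map_zero, ofAdd_zero]
  map_mul' u v := by rw [foxDeriv_mul, map_add, groupRingEval_of_mul, ofAdd_add]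

theorem exponentSum_surfaceRelation (g : ℕ) (i : Fin (2 * g)) :
    exponentSum i (surfaceRelation g) = 1 := by
  rw [surfaceRelation, map_list_prod, List.map_ofFn]
  refine List.prod_eq_one fun x hx => ?_
  obtain ⟨j, rfl⟩ := List.mem_ofFn.1 hx
  simp only [Function.comp_apply, map_mul, map_inv]
  rw [mul_inv_eq_one, mul_inv_eq_iff_eq_mul, mul_comm]

/-- The fundamental formula of Fox calculus. -/
theorem sum_foxDeriv_mul [Fintype ι] (w : FreeGroup ι) :
    ∑ i, foxDeriv i w * (MonoidAlgebra.of ℤ _ (FreeGroup.of i) - 1) =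
      MonoidAlgebra.of ℤ _ w - 1 := by
  have hmul : ∀ u v : FreeGroup ι,
      ∑ i, foxDeriv i (u * v) * (MonoidAlgebra.of ℤ _ (FreeGroup.of i) - 1) =
        ∑ i, foxDeriv i u * (MonoidAlgebra.of ℤ _ (FreeGroup.of i) - 1) +
        MonoidAlgebra.of ℤ _ u *
          ∑ i, foxDeriv i v * (MonoidAlgebra.of ℤ _ (FreeGroup.of i) - 1) := fun u v => by
    simp only [foxDeriv_mul, add_mul, Finset.sum_add_distrib, Finset.mul_sum, mul_assoc]
  have hof : ∀ j : ι, ∑ i, foxDeriv i (FreeGroup.of j) *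
      (MonoidAlgebra.of ℤ _ (FreeGroup.of i) - 1) = MonoidAlgebra.of ℤ _ (FreeGroup.of j) - 1 :=
    fun j => by simp [foxDeriv_of, -MonoidAlgebra.of_apply]
  induction w using FreeGroup.induction_on with
  | C1 => simp [foxDeriv_one, -MonoidAlgebra.of_apply]
  | of j => exact hof j
  | inv_of j _ =>
    have h := hmul (FreeGroup.of j)⁻¹ (FreeGroup.of j)
    rw [hof, inv_mul_cancel, mul_sub, mul_one, ← map_mul, inv_mul_cancel, map_one] at h
    simp only [foxDeriv_one, zero_mul, Finset.sum_const_zero] at h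
    rw [eq_comm, ← eq_neg_iff_add_eq_zero, neg_sub] at h
    exact h
  | mul u v hu hv =>
    rw [hmul, hu, hv, map_mul, mul_sub, mul_one]
    abel

theorem surfaceChain_sum {W : Type*} [AddCommGroup W] (g : ℕ)
    (h : FreeGroup (Fin (2 * g)) × FreeGroup (Fin (2 * g)) → W) :
    ((surfaceChain g).sum fun ab n => n • h ab) =
      ∑ i, groupRingEval (fun a => h (a, FreeGroup.of i)) (foxDeriv i (surfaceRelation g)) := by
  rw [surfaceChain, ← Finsupp.sum_finsetSum_index (h := fun ab n => n • h ab)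
    (fun _ => zero_smul ℤ _) (fun _ _ _ => add_smul _ _ _)]
  refine Finset.sum_congr rfl fun i _ => ?_
  rw [groupRingEval_apply, Finsupp.sum_mapDomain_index (h := fun ab n => n • h ab)
    (fun _ => zero_smul ℤ _) (fun _ _ _ => add_smul _ _ _)]

/-- The boundary of the surface chain is the surface relation. -/
theorem surfaceChain_boundary {W : Type*} [AddCommGroup W] (g : ℕ)
    (Λ : FreeGroup (Fin (2 * g)) → W) :
    ((surfaceChain g).sum fun ab n => n • (Λ ab.1 + Λ ab.2 - Λ (ab.1 * ab.2))) =
      Λ 1 - Λ (surfaceRelation g) := by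
  rw [surfaceChain_sum g fun ab => Λ ab.1 + Λ ab.2 - Λ (ab.1 * ab.2)]
  have h1 : ∀ i : Fin (2 * g), groupRingEval (fun a => Λ a + Λ (FreeGroup.of i) -
      Λ (a * FreeGroup.of i)) (foxDeriv i (surfaceRelation g)) =
      -groupRingEval Λ (foxDeriv i (surfaceRelation g) *
        (MonoidAlgebra.of ℤ _ (FreeGroup.of i) - 1)) := fun i => by
    have h2 : groupRingEval (fun _ : FreeGroup (Fin (2 * g)) => (1 : ℤ))
      (foxDeriv i (surfaceRelation g)) = 0 := exponentSum_surfaceRelation g i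
    rw [groupRingEval_add_sub, groupRingEval_const, h2, zero_smul, mul_sub, mul_one, map_sub,
      groupRingEval_mul_of]
    abel
  simp only [h1]
  rw [Finset.sum_neg_distrib, ← map_sum, sum_foxDeriv_mul, map_sub, groupRingEval_of,
    ← map_one (MonoidAlgebra.of ℤ (FreeGroup (Fin (2 * g)))), groupRingEval_of, neg_sub]

end FoxCalculus

/-! ### Finite powers of a manifold -/

section PiManifold

variable {ι : Type*} [Fintype ι] {E : Type*} [NormedAddCommGroup E] [NormedSpace ℝ E]
  {H : Type*} [TopologicalSpace H] {I : ModelWithCorners ℝ E H}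
  {M : Type*} [TopologicalSpace M] [ChartedSpace H M]
  {E' : Type*} [NormedAddCommGroup E'] [NormedSpace ℝ E']
  {H' : Type*} [TopologicalSpace H'] {I' : ModelWithCorners ℝ E' H'}
  {N : Type*} [TopologicalSpace N] [ChartedSpace H' N]

instance boundaryless_pi [I.Boundaryless] :
    (ModelWithCorners.pi fun _ : ι => I).Boundaryless where
  range_eq_univ := by
    refine eq_univ_of_forall fun v => ?_
    have h : ∀ i, ∃ x, I x = v i := fun i => by
      rw [← mem_range, I.range_eq_univ]
      trivial
    choose x hx using h
    exact ⟨x, funext hx⟩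

instance isManifold_pi {n : WithTop ℕ∞} [IsManifold I n M] :
    IsManifold (ModelWithCorners.pi fun _ : ι => I) n (ι → M) := by
  refine isManifold_of_contDiffOn _ _ _ ?_
  rintro _ _ ⟨e, he, rfl⟩ ⟨e', he', rfl⟩
  refine contDiffOn_pi.2 fun i => ?_
  have h1 : ContDiffOn ℝ n (I ∘ (e i).symm.trans (e' i) ∘ I.symm)
      (I.symm ⁻¹' ((e i).symm.trans (e' i)).source ∩ range I) :=
    (contDiffGroupoid n I).compatible (he i trivial) (he' i trivial) |>.1
  refine h1.comp (contDiff_apply ℝ E i).contDiffOn ?_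
  rintro _ ⟨hx, x, rfl⟩
  exact ⟨⟨hx.1 i trivial, hx.2 i trivial⟩, x i, rfl⟩

theorem contMDiffAt_pi_iff {n : WithTop ℕ∞} {f : N → ι → M} {x : N} :
    ContMDiffAt I' (ModelWithCorners.pi fun _ : ι => I) n f x ↔
      ∀ i, ContMDiffAt I' I n (fun z => f z i) x := by
  simp only [contMDiffAt_iff, continuousAt_pi, contDiffWithinAt_pi, forall_and]
  rfl

theorem contMDiff_pi_apply {n : WithTop ℕ∞} (i : ι) [IsManifold I n M] :
    ContMDiff (ModelWithCorners.pi fun _ : ι => I) I n fun x : ι → M => x i := fun _ =>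
  contMDiffAt_pi_iff.1 contMDiffAt_id i

end PiManifold

section FormsAlongMaps

variable {E : Type*} [NormedAddCommGroup E] [NormedSpace ℝ E]
  {H : Type*} [TopologicalSpace H] {I : ModelWithCorners ℝ E H}
  {M : Type*} [TopologicalSpace M] [ChartedSpace H M]
  {E' : Type*} [NormedAddCommGroup E'] [NormedSpace ℝ E']
  {H' : Type*} [TopologicalSpace H'] {I' : ModelWithCorners ℝ E' H'}
  {M' : Type*} [TopologicalSpace M'] [ChartedSpace H' M']
  {V : Type*} [NormedAddCommGroup V] [NormedSpace ℝ V]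

variable (I) in
/-- The pullback of a form by a map from a vector space, as a form-valued function. -/
def pullVec {k : ℕ} (φ : V → M) (η : DForm I M k) (y : V) : V [⋀^Fin k]→L[ℝ] ℝ :=
  DForm.pullback 𝓘(ℝ, V) I φ η y

theorem pullVec_pullback {k : ℕ} {φ : V → M} {f : M → M'} {η : DForm I' M' k} {y : V}
    (hf : MDifferentiableAt I I' f (φ y)) (hφ : MDifferentiableAt 𝓘(ℝ, V) I φ y) :
    pullVec I φ (DForm.pullback I I' f η) y = pullVec I' (fun z => f (φ z)) η y := by
  have h := mderiv_comp hf hφ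
  ext u
  change η (f (φ y)) (fun i => mderiv I I' f (φ y) (mderiv 𝓘(ℝ, V) I φ y (u i))) =
    η (f (φ y)) fun i => mderiv 𝓘(ℝ, V) I' (fun z => f (φ z)) y (u i)
  rw [h]
  rfl

variable [I.Boundaryless] [IsManifold I ∞ M]

theorem mdifferentiableAt_extChartAt_symm {x₀ : M} {y : E} (hy : y ∈ (extChartAt I x₀).target) :
    MDifferentiableAt 𝓘(ℝ, E) I (extChartAt I x₀).symm y :=
  ((contMDiffOn_extChartAt_symm (n := ∞) x₀).contMDiffAt
    ((isOpen_extChartAt_target x₀).mem_nhds hy)).mdifferentiableAt (by simp)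

theorem inChart_eq {k : ℕ} (η : DForm I M k) (x₀ : M) :
    η.inChart I x₀ = pullVec I (extChartAt I x₀).symm η := by
  funext y
  have h : mfderivWithin 𝓘(ℝ, E) I (extChartAt I x₀).symm (range I) y =
      mfderiv 𝓘(ℝ, E) I (extChartAt I x₀).symm y := by rw [I.range_eq_univ, mfderivWithin_univ]
  rw [DForm.inChart, h]
  rfl

theorem isSmooth_of_pullVec {k : ℕ} {η : DForm I M k}
    (h : ∀ (x₀ : M), ∀ y ∈ (extChartAt I x₀).target,
      ContDiffAt ℝ ∞ (pullVec I (extChartAt I x₀).symm η) y) : η.IsSmooth I := fun x₀ y hy => by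
  rw [inChart_eq]
  exact (h x₀ y hy).contDiffWithinAt

theorem d_eq {k : ℕ} (η : DForm I M k) (x : M) :
    η.d I x = (extDeriv (pullVec I (extChartAt I x).symm η)
      (extChartAt I x x)).compContinuousLinearMap (mfderiv I 𝓘(ℝ, E) (extChartAt I x) x) := by
  rw [DForm.d, inChart_eq, I.range_eq_univ, extDerivWithin_univ]

theorem mderiv_extChartAt_symm_comp (x : M) :
    (mderiv 𝓘(ℝ, E) I (extChartAt I x).symm (extChartAt I x x)).comp
      (mderiv I 𝓘(ℝ, E) (extChartAt I x) x) = ContinuousLinearMap.id ℝ E := by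
  have h1 : MDifferentiableAt I 𝓘(ℝ, E) (extChartAt I x) x := mdifferentiableAt_extChartAt
    (mem_chart_source H x)
  rw [← mderiv_comp (mdifferentiableAt_extChartAt_symm (mem_extChartAt_target x)) h1,
    ← mderiv_id (I := I) x]
  refine mderiv_congr ?_
  filter_upwards [extChartAt_source_mem_nhds (I := I) x] with z hz
  exact (extChartAt I x).left_inv hz

/-- Forms on a manifold agree if their pullbacks under the inverse charts agree. -/
theorem eq_of_pullVec_eq {k : ℕ} {η η' : DForm I M k}
    (h : ∀ x : M, pullVec I (extChartAt I x).symm η (extChartAt I x x) =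
      pullVec I (extChartAt I x).symm η' (extChartAt I x x)) : η = η' := by
  have key : ∀ (η : DForm I M k) (x : M) (u : Fin k → E), η x u =
      pullVec I (extChartAt I x).symm η (extChartAt I x x)
        fun i => mderiv I 𝓘(ℝ, E) (extChartAt I x) x (u i) := by
    intro η x u
    have h1 : ∀ x', x' = x → (η x' : E [⋀^Fin k]→L[ℝ] ℝ) u = (η x : E [⋀^Fin k]→L[ℝ] ℝ) u :=
      fun x' hx => by rw [hx]
    refine (h1 _ (extChartAt_to_inv (I := I) x)).symm.trans ?_
    change (η _ : E [⋀^Fin k]→L[ℝ] ℝ) u = (η _ : E [⋀^Fin k]→L[ℝ] ℝ)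
      fun i => mderiv 𝓘(ℝ, E) I (extChartAt I x).symm (extChartAt I x x)
        (mderiv I 𝓘(ℝ, E) (extChartAt I x) x (u i))
    congr 1
    funext i
    exact (congrArg (fun L => L (u i)) (mderiv_extChartAt_symm_comp (I := I) x)).symm
  funext x
  refine ContinuousAlternatingMap.ext fun u => ?_
  refine (key η x u).trans (Eq.trans ?_ (key η' x u).symm)
  rw [h]

end FormsAlongMaps

/-! ### The forms on the extended moduli space along maps from vector spaces -/

section FormCalculus

variable {V : Type*} [NormedAddCommGroup V] [NormedSpace ℝ V]
  {W : Type*} [NormedAddCommGroup W] [NormedSpace ℝ W]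

theorem contDiffAt_form_apply {n : WithTop ℕ∞} {k : ℕ} {η : V → W [⋀^Fin k]→L[ℝ] ℝ}
    {a : Fin k → V → W} {y : V} (hη : ContDiffAt ℝ n η y) (ha : ∀ i, ContDiffAt ℝ n (a i) y) :
    ContDiffAt ℝ n (fun z => η z fun i => a i z) y := by
  induction k with
  | zero =>
    have h : (fun z => η z fun i => a i z) = fun z =>
        ContinuousAlternatingMap.apply ℝ W ℝ (0 : Fin 0 → W) (η z) := by
      funext z
      exact congrArg (η z) (Subsingleton.elim _ _)
    rw [h]
    exact (ContinuousLinearMap.contDiff _).contDiffAt.comp y hη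
  | succ k ih =>
    have hi : ContDiff ℝ n (insertFirst W k) := ContinuousLinearMap.contDiff _
    have h := ih ((hi.contDiffAt.comp y hη).clm_apply (ha 0)) fun i => ha i.succ
    refine h.congr_of_eventuallyEq (Filter.Eventually.of_forall fun z => ?_)
    change η z _ = η z (Matrix.vecCons (a 0 z) fun i => a i.succ z)
    congr 1
    funext i
    refine Fin.cases rfl (fun _ => rfl) i

theorem contDiffAt_pullback_form [FiniteDimensional ℝ V] {k : ℕ} {η : W → W [⋀^Fin k]→L[ℝ] ℝ}
    {f : V → W} {y : V} (hη : ContDiffAt ℝ ∞ η (f y)) (hf : ContDiffAt ℝ ∞ f y) :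
    ContDiffAt ℝ ∞ (fun z => (η (f z)).compContinuousLinearMap (fderiv ℝ f z)) y :=
  contDiffAt_form fun m => contDiffAt_form_apply (η := fun z => η (f z))
    (a := fun i z => fderiv ℝ f z (m i)) (hη.comp y hf) fun i =>
      (hf.fderiv_right (m := ∞) (by simp)).clm_apply contDiffAt_const

theorem extDeriv_finset_sum_smul {ι : Type*} {k : ℕ} {s : Finset ι} {c : ι → ℝ}
    {η : ι → V → V [⋀^Fin k]→L[ℝ] ℝ} {y : V} (h : ∀ i ∈ s, DifferentiableAt ℝ (η i) y) :
    extDeriv (fun z => ∑ i ∈ s, c i • η i z) y = ∑ i ∈ s, c i • extDeriv (η i) y := by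
  classical
  induction s using Finset.induction_on with
  | empty =>
    simp only [Finset.sum_empty]
    have h0 := extDeriv_smul (x := y) (0 : ℝ) fun _ : V => (0 : V [⋀^Fin k]→L[ℝ] ℝ)
    rwa [zero_smul, zero_smul] at h0
  | insert i s hi ih =>
    simp only [Finset.sum_insert hi]
    rw [extDeriv_fun_add, ← extDeriv_smul, ih fun j hj => h j (Finset.mem_insert_of_mem hj)]
    · rfl
    · exact (h i (Finset.mem_insert_self i s)).const_smul (c i)
    · exact DifferentiableAt.fun_sum fun j hj =>
        (h j (Finset.mem_insert_of_mem hj)).const_smul (c j)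

end FormCalculus

section PullVec

variable {E : Type*} [NormedAddCommGroup E] [NormedSpace ℝ E]
  {H : Type*} [TopologicalSpace H] {I : ModelWithCorners ℝ E H}
  {M : Type*} [TopologicalSpace M] [ChartedSpace H M]
  {V : Type*} [NormedAddCommGroup V] [NormedSpace ℝ V] {k : ℕ}

theorem pullVec_add (φ : V → M) (η ξ : DForm I M k) (y : V) :
    pullVec I φ (η + ξ) y = pullVec I φ η y + pullVec I φ ξ y := rfl

theorem pullVec_finset_sum_smul {ι : Type*} (s : Finset ι) (c : ι → ℝ) (φ : V → M)
    (η : ι → DForm I M k) (y : V) :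
    pullVec I φ (∑ i ∈ s, c i • η i) y = ∑ i ∈ s, c i • pullVec I φ (η i) y := by
  classical
  induction s using Finset.induction_on with
  | empty => rfl
  | insert i s hi ih =>
    rw [Finset.sum_insert hi, Finset.sum_insert hi, pullVec_add, ih]
    rfl

end PullVec

section OmegaForm

variable {E : Type*} [NormedAddCommGroup E] [NormedSpace ℝ E]
  {H : Type*} [TopologicalSpace H] {I : ModelWithCorners ℝ E H}
  {G : Type*} [TopologicalSpace G] [ChartedSpace H G] [Group G] [LieGroup I ∞ G]
  {V : Type*} [NormedAddCommGroup V] [NormedSpace ℝ V]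

variable (I G) in
theorem contMDiff_freeGroup_lift {ι : Type*} [Fintype ι] (w : FreeGroup ι) :
    ContMDiff (ModelWithCorners.pi fun _ : ι => I) I ∞
      fun h : ι → G => FreeGroup.lift h w := by
  induction w using FreeGroup.induction_on with
  | C1 => simpa using contMDiff_const
  | of i => simpa using contMDiff_pi_apply i
  | inv_of i _ => simpa using (contMDiff_pi_apply (I := I) (n := ∞) i).inv
  | mul u v hu hv =>
    have h := hu.mul hv
    simp only [map_mul]
    exact h

variable {g : ℕ} {φ : V → Fin (2 * g) → G} {y : V}

theorem mdifferentiableAt_word (hφ : MDifferentiableAt 𝓘(ℝ, V) (modelY I g) φ y)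
    (w : FreeGroup (Fin (2 * g))) :
    MDifferentiableAt 𝓘(ℝ, V) I (fun z => FreeGroup.lift (φ z) w) y :=
  ((contMDiff_freeGroup_lift I G w).mdifferentiable (by simp) (φ y)).comp y hφ

theorem contMDiffAt_word (hφ : ContMDiffAt 𝓘(ℝ, V) (modelY I g) ∞ φ y)
    (w : FreeGroup (Fin (2 * g))) :
    ContMDiffAt 𝓘(ℝ, V) I ∞ (fun z => FreeGroup.lift (φ z) w) y :=
  (contMDiff_freeGroup_lift I G w).contMDiffAt.comp y hφ

theorem pullVec_omegaBar (B : E →L[ℝ] E →L[ℝ] ℝ) {p q : V → G}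
    (hp : MDifferentiableAt 𝓘(ℝ, V) I p y) (hq : MDifferentiableAt 𝓘(ℝ, V) I q y) :
    pullVec (I.prod I) (fun z => (p z, q z)) (omegaBar I G B) y =
      wedgeTwo B (darboux I p y) (darbouxRight I q y) := by
  have h : mderiv 𝓘(ℝ, V) (I.prod I) (fun z => (p z, q z)) y =
    (mderiv 𝓘(ℝ, V) I p y).prod (mderiv 𝓘(ℝ, V) I q y) := mderiv_prodMk hp hq
  have h1 : pullVec (I.prod I) (fun z => (p z, q z)) (omegaBar I G B) y =
      (wedgeTwo B
        ((mderiv I I (fun x : G => (p y)⁻¹ * x) (p y)).comp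
          (mderiv (I.prod I) I (Prod.fst : G × G → G) (p y, q y)))
        ((mderiv I I (fun x : G => x * (q y)⁻¹) (q y)).comp
          (mderiv (I.prod I) I (Prod.snd : G × G → G) (p y, q y)))).compContinuousLinearMap
        (mderiv 𝓘(ℝ, V) (I.prod I) (fun z => (p z, q z)) y) := rfl
  rw [h1, h, mderiv_fst, mderiv_snd]
  ext u
  rw [ContinuousAlternatingMap.compContinuousLinearMap_apply, wedgeTwo_apply', wedgeTwo_apply']
  rfl

theorem pullVec_omegaForm (B : E →L[ℝ] E →L[ℝ] ℝ)
    (hφ : MDifferentiableAt 𝓘(ℝ, V) (modelY I g) φ y) :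
    pullVec (modelY I g) φ (omegaForm I G B g) y =
      (surfaceChain g).sum fun ab n => (n : ℝ) •
        wedgeTwo B (darboux I (fun z => FreeGroup.lift (φ z) ab.1) y)
          (darbouxRight I (fun z => FreeGroup.lift (φ z) ab.2) y) := by
  rw [omegaForm, Finsupp.sum, pullVec_finset_sum_smul, Finsupp.sum]
  refine Finset.sum_congr rfl fun ab _ => ?_
  rw [← pullVec_omegaBar B (mdifferentiableAt_word hφ ab.1) (mdifferentiableAt_word hφ ab.2)]
  rw [pullVec_pullback (I := modelY I g) (f := evalTwo ab) _ hφ]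
  · rfl
  · exact ((contMDiff_freeGroup_lift I G ab.1).mdifferentiable (by simp) (φ y)).prodMk
      ((contMDiff_freeGroup_lift I G ab.2).mdifferentiable (by simp) (φ y))

end OmegaForm

section SigmaForm

variable {E : Type*} [NormedAddCommGroup E] [NormedSpace ℝ E] [FiniteDimensional ℝ E]
  {H : Type*} [TopologicalSpace H] {I : ModelWithCorners ℝ E H} [I.Boundaryless]
  {G : Type*} [TopologicalSpace G] [ChartedSpace H G] [Group G] [LieGroup I ∞ G] [T2Space G]
  {B : E →L[ℝ] E →L[ℝ] ℝ}
  {V : Type*} [NormedAddCommGroup V] [NormedSpace ℝ V]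

variable (I G B) in
/-- The pullback of the Cartan form by the exponential map. -/
def expCartanForm (v : E) : E [⋀^Fin 3]→L[ℝ] ℝ :=
  cubicForm B (lieBracketL I G) (darboux I (lieExp I G) v)

variable (I G B) in
/-- The form `sigmaForm` as a form-valued function. -/
def vectorSigma : E → E [⋀^Fin 2]→L[ℝ] ℝ := vectorHomotopyOp (expCartanForm I G B)

theorem sigmaForm_eq (v : E) :
    (sigmaForm I G B v : E [⋀^Fin 2]→L[ℝ] ℝ) = vectorSigma I G B v := by
  refine (homotopyOp_eq _ v).trans ?_
  rw [vectorSigma]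
  congr 1

theorem contDiff_expCartanForm (hB : IsInvariantInnerProduct I G B) :
    ContDiff ℝ ∞ (expCartanForm I G B) :=
  contDiff_iff_contDiffAt.2 fun _ => contDiffAt_cubicForm hB.isInvariantPairing
    (contDiffAt_darboux (contMDiff_lieExp I G).contMDiffAt)

theorem extDeriv_expCartanForm (hB : IsInvariantInnerProduct I G B) :
    extDeriv (expCartanForm I G B) = 0 :=
  funext fun _ => extDeriv_cubicForm hB.isInvariantPairing
    ((contDiffAt_darboux (contMDiff_lieExp I G).contMDiffAt).of_le (by simp))
    fun u v => fderiv_darboux (contMDiff_lieExp I G).contMDiffAt u v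

theorem contDiff_vectorSigma (hB : IsInvariantInnerProduct I G B) :
    ContDiff ℝ ∞ (vectorSigma I G B) :=
  contDiff_vectorHomotopyOp (contDiff_expCartanForm hB)

theorem extDeriv_vectorSigma (hB : IsInvariantInnerProduct I G B) (v : E) :
    extDeriv (vectorSigma I G B) v = expCartanForm I G B v :=
  extDeriv_vectorHomotopyOp (contDiff_expCartanForm hB) (extDeriv_expCartanForm hB) v

theorem mdifferentiable_lieExp : MDifferentiable 𝓘(ℝ, E) I (lieExp I G) :=
  (contMDiff_lieExp I G).mdifferentiable (by simp)

theorem darboux_lieExp_lieAdjoint (k : G) (v : E) :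
    (darboux I (lieExp I G) (lieAdjoint I k v)).comp (lieAdjoint I k) =
      (lieAdjoint I k).comp (darboux I (lieExp I G) v) := by
  have h := darboux_comp (y := v) (f := lieAdjoint I k)
    (mdifferentiable_lieExp (I := I) (G := G) _) (lieAdjoint I k).differentiableAt
  rw [(lieAdjoint I k).fderiv] at h
  rw [← h, ← darboux_conj (mdifferentiable_lieExp v)]
  congr 1
  funext z
  exact lieExp_lieAdjoint k z

theorem expCartanForm_lieAdjoint (hB : IsInvariantInnerProduct I G B) (k : G) (v : E)
    (u : Fin 3 → E) : expCartanForm I G B (lieAdjoint I k v) (fun i => lieAdjoint I k (u i)) =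
      expCartanForm I G B v u := by
  have h := congrArg (fun η => η u) (cubicForm_lieAdjoint hB k (darboux I (lieExp I G) v))
  rw [← darboux_lieExp_lieAdjoint] at h
  simp only [cubicForm_apply hB.isInvariantPairing] at h
  rw [expCartanForm, expCartanForm, cubicForm_apply hB.isInvariantPairing,
    cubicForm_apply hB.isInvariantPairing]
  exact h

theorem vectorSigma_lieAdjoint (hB : IsInvariantInnerProduct I G B) (k : G) (v : E) :
    (vectorSigma I G B (lieAdjoint I k v)).compContinuousLinearMap (lieAdjoint I k) =
      vectorSigma I G B v := by
  have hc : ∀ w : E, Continuous fun t : ℝ => homotopyIntegrand (expCartanForm I G B) (t, w) :=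
    fun w => (contDiff_homotopyIntegrand (contDiff_expCartanForm hB)).continuous.comp
      (by fun_prop)
  have h := ContinuousLinearMap.intervalIntegral_comp_comm
    (ContinuousAlternatingMap.compContinuousLinearMapCLM (ι := Fin 2) (F := ℝ) (lieAdjoint I k))
    ((hc (lieAdjoint I k v)).intervalIntegrable (μ := MeasureTheory.volume) 0 1)
  refine h.symm.trans ?_
  rw [vectorSigma, vectorHomotopyOp]
  congr 1
  funext t
  ext u
  change t ^ 2 • expCartanForm I G B (t • lieAdjoint I k v) (Matrix.vecCons (lieAdjoint I k v)
    fun i => lieAdjoint I k (u i)) = t ^ 2 • expCartanForm I G B (t • v) (Matrix.vecCons v u)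
  congr 1
  refine Eq.trans ?_ (expCartanForm_lieAdjoint hB k (t • v) (Matrix.vecCons v u))
  rw [map_smul]
  congr 1
  funext i
  refine Fin.cases rfl (fun _ => rfl) i

end SigmaForm

section OmegaTilde

variable {E : Type*} [NormedAddCommGroup E] [NormedSpace ℝ E] [FiniteDimensional ℝ E]
  {H : Type*} [TopologicalSpace H] {I : ModelWithCorners ℝ E H} [I.Boundaryless]
  {G : Type*} [TopologicalSpace G] [ChartedSpace H G] [Group G] [LieGroup I ∞ G]
  {B : E →L[ℝ] E →L[ℝ] ℝ} {V : Type*} [NormedAddCommGroup V] [NormedSpace ℝ V]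
  {g : ℕ} {φ : V → Fin (2 * g) → G} {y : V}

theorem contDiffAt_pullVec_omegaForm [FiniteDimensional ℝ V]
    (hφ : ContMDiffAt 𝓘(ℝ, V) (modelY I g) ∞ φ y) :
    ContDiffAt ℝ ∞ (pullVec (modelY I g) φ (omegaForm I G B g)) y := by
  have h : ContDiffAt ℝ ∞ (fun z => (surfaceChain g).sum fun ab n => (n : ℝ) •
      wedgeTwo B (darboux I (fun z => FreeGroup.lift (φ z) ab.1) z)
        (darbouxRight I (fun z => FreeGroup.lift (φ z) ab.2) z)) y := by
    refine ContDiffAt.sum fun ab _ => ?_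
    exact ContDiffAt.const_smul _ (contDiffAt_wedgeTwo
      (contDiffAt_darboux (contMDiffAt_word hφ _)) (contDiffAt_darbouxRight (contMDiffAt_word hφ _)))
  refine h.congr_of_eventuallyEq ?_
  exact (eventually_mdifferentiableAt hφ).mono fun z hz => pullVec_omegaForm B hz

variable [T2Space G]

theorem extDeriv_pullVec_omegaForm [FiniteDimensional ℝ V] (hB : IsInvariantInnerProduct I G B)
    (hφ : ContMDiffAt 𝓘(ℝ, V) (modelY I g) ∞ φ y) :
    extDeriv (pullVec (modelY I g) φ (omegaForm I G B g)) y =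
      -cubicForm B (lieBracketL I G) (darboux I (fun z => epsR (φ z)) y) := by
  have hev : pullVec (modelY I g) φ (omegaForm I G B g) =ᶠ[𝓝 y] fun z =>
      ∑ ab ∈ (surfaceChain g).support, (surfaceChain g ab : ℝ) •
        wedgeTwo B (darboux I (fun z => FreeGroup.lift (φ z) ab.1) z)
          (darbouxRight I (fun z => FreeGroup.lift (φ z) ab.2) z) :=
    (eventually_mdifferentiableAt hφ).mono fun z hz => pullVec_omegaForm B hz
  set Λ : FreeGroup (Fin (2 * g)) → V [⋀^Fin 3]→L[ℝ] ℝ := fun w =>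
    cubicForm B (lieBracketL I G) (darboux I (fun z => FreeGroup.lift (φ z) w) y) with hΛ
  have hb := surfaceChain_boundary g Λ
  have h1 : Λ 1 = 0 := by
    simp only [hΛ, map_one, darboux_const]
    ext u
    rw [cubicForm_apply hB.isInvariantPairing]
    simp
  rw [h1, zero_sub] at hb
  refine Eq.trans ?_ hb
  have hm := hφ.mdifferentiableAt (by simp)
  rw [hev.extDeriv_eq, extDeriv_finset_sum_smul, Finsupp.sum]
  · refine Finset.sum_congr rfl fun ab _ => ?_
    rw [Int.cast_smul_eq_zsmul]
    congr 1
    have ha := contMDiffAt_word hφ ab.1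
    have hb := contMDiffAt_word hφ ab.2
    rw [extDeriv_wedgeTwo hB.isInvariantPairing ((contDiffAt_darboux ha).of_le (by simp))
      ((contDiffAt_darbouxRight hb).of_le (by simp)) (fderiv_darboux ha) (fderiv_darbouxRight hb)]
    have hma := mdifferentiableAt_word hm ab.1
    have hmb := mdifferentiableAt_word hm ab.2
    have h2 := darboux_mul' hma hmb
    simp only [hΛ, map_mul]
    rw [h2, cubicForm_lieAdjoint hB, darbouxRight_eq hmb, cubicForm_lieAdjoint hB]
  · exact fun ab _ => (contDiffAt_wedgeTwo (contDiffAt_darboux (contMDiffAt_word hφ _))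
      (contDiffAt_darbouxRight (contMDiffAt_word hφ _))).differentiableAt (by simp)

variable {ψ : V → (Fin (2 * g) → G) × E}

theorem pullVec_omegaTilde (hψ : MDifferentiableAt 𝓘(ℝ, V) (modelYg I g) ψ y) :
    pullVec (modelYg I g) ψ (omegaTilde I G B g) y =
      pullVec (modelY I g) (fun z => (ψ z).1) (omegaForm I G B g) y +
        (vectorSigma I G B (ψ y).2).compContinuousLinearMap (fderiv ℝ (fun z => (ψ z).2) y) := by
  rw [omegaTilde, pullVec_add, pullVec_pullback mdifferentiableAt_fst hψ,
    pullVec_pullback mdifferentiableAt_snd hψ, ← sigmaForm_eq, ← mderiv_eq_fderiv]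
  rfl

variable [FiniteDimensional ℝ V]

theorem eventually_pullVec_omegaTilde (hψ : ContMDiffAt 𝓘(ℝ, V) (modelYg I g) ∞ ψ y) :
    pullVec (modelYg I g) ψ (omegaTilde I G B g) =ᶠ[𝓝 y] fun z =>
      pullVec (modelY I g) (fun z => (ψ z).1) (omegaForm I G B g) z +
        (vectorSigma I G B (ψ z).2).compContinuousLinearMap (fderiv ℝ (fun z => (ψ z).2) z) :=
  (eventually_mdifferentiableAt hψ).mono fun _ hz => pullVec_omegaTilde hz

theorem contDiffAt_snd_of_contMDiffAt (hψ : ContMDiffAt 𝓘(ℝ, V) (modelYg I g) ∞ ψ y) :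
    ContDiffAt ℝ ∞ (fun z => (ψ z).2) y :=
  contMDiffAt_iff_contDiffAt.1 hψ.snd

theorem contDiffAt_pullVec_omegaTilde (hB : IsInvariantInnerProduct I G B)
    (hψ : ContMDiffAt 𝓘(ℝ, V) (modelYg I g) ∞ ψ y) :
    ContDiffAt ℝ ∞ (pullVec (modelYg I g) ψ (omegaTilde I G B g)) y :=
  ((contDiffAt_pullVec_omegaForm hψ.fst).add (contDiffAt_pullback_form
    (contDiff_vectorSigma hB).contDiffAt (contDiffAt_snd_of_contMDiffAt hψ))).congr_of_eventuallyEq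
      (eventually_pullVec_omegaTilde hψ)

theorem extDeriv_pullVec_omegaTilde (hB : IsInvariantInnerProduct I G B)
    (hψ : ContMDiffAt 𝓘(ℝ, V) (modelYg I g) ∞ ψ y) :
    extDeriv (pullVec (modelYg I g) ψ (omegaTilde I G B g)) y =
      -cubicForm B (lieBracketL I G) (darboux I (fun z => epsR (ψ z).1) y) +
        cubicForm B (lieBracketL I G) (darboux I (fun z => lieExp I G (ψ z).2) y) := by
  have h2 := contDiffAt_snd_of_contMDiffAt hψ
  have hσ := contDiff_vectorSigma hB
  rw [(eventually_pullVec_omegaTilde hψ).extDeriv_eq, extDeriv_fun_add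
    ((contDiffAt_pullVec_omegaForm hψ.fst).differentiableAt (by simp))
    ((contDiffAt_pullback_form hσ.contDiffAt h2).differentiableAt (by simp)),
    extDeriv_pullVec_omegaForm hB hψ.fst,
    extDeriv_pullback (f := fun z => (ψ z).2) (hσ.differentiable (by simp) _) h2
      (by rw [minSmoothness_of_isRCLikeNormedField]; exact ENat.LEInfty.out),
    extDeriv_vectorSigma hB, expCartanForm,
    darboux_comp (f := fun z => (ψ z).2) (mdifferentiable_lieExp _) (h2.differentiableAt (by simp))]
  rfl

end OmegaTilde

/-! ### Closedness and invariance on the extended moduli space -/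

section ExtendedModuliSpace

variable {E : Type*} [NormedAddCommGroup E] [NormedSpace ℝ E] [FiniteDimensional ℝ E]
  {H : Type*} [TopologicalSpace H] {I : ModelWithCorners ℝ E H} [I.Boundaryless]
  {G : Type*} [TopologicalSpace G] [ChartedSpace H G] [Group G] [LieGroup I ∞ G] [T2Space G]
  {B : E →L[ℝ] E →L[ℝ] ℝ} {g : ℕ} {β : G}

theorem contMDiffAt_extChartAt_symm_of_mem {E' : Type*} [NormedAddCommGroup E'] [NormedSpace ℝ E']
    {H' : Type*} [TopologicalSpace H'] {J : ModelWithCorners ℝ E' H'} [J.Boundaryless]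
    {M : Type*} [TopologicalSpace M] [ChartedSpace H' M] [IsManifold J ∞ M] {x₀ : M} {y : E'}
    (hy : y ∈ (extChartAt J x₀).target) :
    ContMDiffAt 𝓘(ℝ, E') J ∞ (extChartAt J x₀).symm y :=
  (contMDiffOn_extChartAt_symm x₀).contMDiffAt ((isOpen_extChartAt_target x₀).mem_nhds hy)

theorem isSmooth_omegaTilde (hB : IsInvariantInnerProduct I G B) :
    (omegaTilde I G B g).IsSmooth (modelYg I g) :=
  isSmooth_of_pullVec fun _ _ hy =>
    contDiffAt_pullVec_omegaTilde hB (contMDiffAt_extChartAt_symm_of_mem hy)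

variable (I G) in
theorem mdifferentiable_epsR : MDifferentiable (modelY I g) I (epsR : (Fin (2 * g) → G) → G) :=
  (contMDiff_freeGroup_lift I G (surfaceRelation g)).mdifferentiable (by simp)

/-- The exterior derivative of `omegaTilde` is the difference of the pullbacks of the Cartan form
under the exponential map and the surface relation. -/
theorem d_omegaTilde_apply (hB : IsInvariantInnerProduct I G B) (p : (Fin (2 * g) → G) × E)
    (u : Fin 3 → (Fin (2 * g) → E) × E) :
    (omegaTilde I G B g).d (modelYg I g) p u =
      -(B (maurerCartan I (epsR p.1) (mfderiv (modelY I g) I epsR p.1 (u 0).1))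
        (lieBracketL I G (maurerCartan I (epsR p.1) (mfderiv (modelY I g) I epsR p.1 (u 1).1))
          (maurerCartan I (epsR p.1) (mfderiv (modelY I g) I epsR p.1 (u 2).1)))) +
      B (darboux I (lieExp I G) p.2 (u 0).2)
        (lieBracketL I G (darboux I (lieExp I G) p.2 (u 1).2)
          (darboux I (lieExp I G) p.2 (u 2).2)) := by
  have hy := mem_extChartAt_target (I := modelYg I g) p
  have hφ := contMDiffAt_extChartAt_symm_of_mem hy
  set χ := extChartAt (modelYg I g) p with hχ
  have hm := hφ.mdifferentiableAt (by simp)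
  have hp : χ.symm (χ p) = p := extChartAt_to_inv p
  have hid : ∀ w, mderiv 𝓘(ℝ, (Fin (2 * g) → E) × E) (modelYg I g) χ.symm (χ p)
      (mderiv (modelYg I g) 𝓘(ℝ, (Fin (2 * g) → E) × E) χ p w) = w := fun w =>
    congrArg (fun L => L w) (mderiv_extChartAt_symm_comp (I := modelYg I g) p)
  have h1 : ∀ w, darboux I (fun z => epsR (χ.symm z).1) (χ p)
      (mderiv (modelYg I g) 𝓘(ℝ, (Fin (2 * g) → E) × E) χ p w) =
      maurerCartan I (epsR p.1) (mfderiv (modelY I g) I epsR p.1 w.1) := by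
    intro w
    have h := mderiv_comp (g := fun q : (Fin (2 * g) → G) × E => epsR q.1) (f := χ.symm)
      (x := χ p) ((mdifferentiable_epsR I G _).comp _ mdifferentiableAt_fst) hm
    have h' := mderiv_comp (I := modelYg I g) (g := (epsR : (Fin (2 * g) → G) → G))
      (f := (Prod.fst : (Fin (2 * g) → G) × E → _)) (x := p)
      (mdifferentiable_epsR I G _) mdifferentiableAt_fst
    rw [darboux, h, hp, h', mderiv_fst]
    simp only [ContinuousLinearMap.comp_apply, hid]
    rfl
  have h2 : ∀ w, darboux I (fun z => lieExp I G (χ.symm z).2) (χ p)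
      (mderiv (modelYg I g) 𝓘(ℝ, (Fin (2 * g) → E) × E) χ p w) =
      darboux I (lieExp I G) p.2 w.2 := by
    intro w
    have h := mderiv_comp (g := fun q : (Fin (2 * g) → G) × E => lieExp I G q.2) (f := χ.symm)
      (x := χ p) ((mdifferentiable_lieExp _).comp _ mdifferentiableAt_snd) hm
    have h' := mderiv_comp (I := modelYg I g) (g := lieExp I G)
      (f := (Prod.snd : (Fin (2 * g) → G) × E → _)) (x := p)
      (mdifferentiable_lieExp _) mdifferentiableAt_snd
    rw [darboux, h, hp, h', mderiv_snd]
    simp only [ContinuousLinearMap.comp_apply, hid]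
    rfl
  have h3 := congrArg (fun η : ((Fin (2 * g) → E) × E) [⋀^Fin 3]→L[ℝ] ℝ => η fun i =>
    mderiv (modelYg I g) 𝓘(ℝ, (Fin (2 * g) → E) × E) χ p (u i))
    (extDeriv_pullVec_omegaTilde hB hφ)
  have h4 : (omegaTilde I G B g).d (modelYg I g) p u =
      extDeriv (pullVec (modelYg I g) χ.symm (omegaTilde I G B g)) (χ p) fun i =>
        mderiv (modelYg I g) 𝓘(ℝ, (Fin (2 * g) → E) × E) χ p (u i) := by
    rw [d_eq]
    rfl
  refine h4.trans (h3.trans ?_)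
  change -(cubicForm B (lieBracketL I G) _ _) + cubicForm B (lieBracketL I G) _ _ = _
  rw [cubicForm_apply hB.isInvariantPairing, cubicForm_apply hB.isInvariantPairing]
  simp only [h1, h2]

theorem darboux_expBeta (β : G) (v : E) :
    darboux I (expBeta I β) v = darboux I (lieExp I G) v :=
  darboux_mul_left (mdifferentiable_lieExp v) β

theorem maurerCartan_epsR_of_mem_zariskiTangent {p : (Fin (2 * g) → G) × E}
    (hp : p ∈ extendedModuli I g β) {u : (Fin (2 * g) → E) × E} (hu : u ∈ zariskiTangent I β p) :
    maurerCartan I (epsR p.1) (mfderiv (modelY I g) I epsR p.1 u.1) =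
      darboux I (lieExp I G) p.2 u.2 := by
  rw [← darboux_expBeta β]
  have h1 : epsR p.1 = expBeta I β p.2 := hp
  have h2 : mderiv (modelY I g) I epsR p.1 u.1 = mderiv 𝓘(ℝ, E) I (expBeta I β) p.2 u.2 := hu
  change mderiv I I (fun x : G => (epsR p.1)⁻¹ * x) (epsR p.1)
    (mderiv (modelY I g) I epsR p.1 u.1) = _
  rw [h2, h1]
  rfl

theorem isClosed_pullback_omegaTilde (hB : IsInvariantInnerProduct I G B) {F : Type*}
    [NormedAddCommGroup F] [NormedSpace ℝ F] [FiniteDimensional ℝ F]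
    {N : Type*} [TopologicalSpace N] [ChartedSpace F N] [IsManifold 𝓘(ℝ, F) ∞ N]
    {f : N → (Fin (2 * g) → G) × E} (hf : ContMDiff 𝓘(ℝ, F) (modelYg I g) ∞ f)
    (hfX : ∀ n, f n ∈ extendedModuli I g β) :
    (DForm.pullback 𝓘(ℝ, F) (modelYg I g) f (omegaTilde I G B g)).IsClosed 𝓘(ℝ, F) := by
  have hev : ∀ (x₀ : N), ∀ y ∈ (extChartAt 𝓘(ℝ, F) x₀).target,
      pullVec 𝓘(ℝ, F) (extChartAt 𝓘(ℝ, F) x₀).symm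
        (DForm.pullback 𝓘(ℝ, F) (modelYg I g) f (omegaTilde I G B g)) =ᶠ[𝓝 y]
      pullVec (modelYg I g) (fun z => f ((extChartAt 𝓘(ℝ, F) x₀).symm z)) (omegaTilde I G B g) := by
    intro x₀ y hy
    filter_upwards [(isOpen_extChartAt_target x₀).mem_nhds hy] with z hz
    exact pullVec_pullback (hf.mdifferentiable (by simp) _) (mdifferentiableAt_extChartAt_symm hz)
  have hs : ∀ (x₀ : N), ∀ y ∈ (extChartAt 𝓘(ℝ, F) x₀).target,
      ContMDiffAt 𝓘(ℝ, F) (modelYg I g) ∞ (fun z => f ((extChartAt 𝓘(ℝ, F) x₀).symm z)) y :=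
    fun x₀ y hy => hf.contMDiffAt.comp y (contMDiffAt_extChartAt_symm_of_mem hy)
  refine ⟨isSmooth_of_pullVec fun x₀ y hy =>
    (contDiffAt_pullVec_omegaTilde hB (hs x₀ y hy)).congr_of_eventuallyEq (hev x₀ y hy), ?_⟩
  funext x
  have hx := mem_extChartAt_target (I := 𝓘(ℝ, F)) x
  have hψ := hs x _ hx
  have h0 : extDeriv (pullVec 𝓘(ℝ, F) (extChartAt 𝓘(ℝ, F) x).symm
      (DForm.pullback 𝓘(ℝ, F) (modelYg I g) f (omegaTilde I G B g))) (extChartAt 𝓘(ℝ, F) x x) =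
      0 := by
    have h1 : (fun z => epsR (f ((extChartAt 𝓘(ℝ, F) x).symm z)).1) =
        fun z => β * lieExp I G (f ((extChartAt 𝓘(ℝ, F) x).symm z)).2 := funext fun z => hfX _
    rw [(hev x _ hx).extDeriv_eq, extDeriv_pullVec_omegaTilde hB hψ, h1, darboux_mul_left,
      neg_add_cancel]
    exact (mdifferentiable_lieExp _).comp _
      ((contDiffAt_snd_of_contMDiffAt hψ).differentiableAt (by simp)).mdifferentiableAt
  rw [d_eq, h0]
  rfl

theorem freeGroup_lift_conj {ι : Type*} (k : G) (h : ι → G) (w : FreeGroup ι) :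
    FreeGroup.lift (fun i => k * h i * k⁻¹) w = k * FreeGroup.lift h w * k⁻¹ := by
  have e : FreeGroup.lift (fun i => k * h i * k⁻¹) =
      (MulAut.conj k).toMonoidHom.comp (FreeGroup.lift h) :=
    FreeGroup.ext_hom _ _ fun i => by simp
  rw [e]
  rfl

theorem mapsTo_conjAction (hβ : β ∈ Subgroup.center G) (k : G) :
    MapsTo (conjAction I k) (extendedModuli I g β) (extendedModuli I g β) := by
  intro p hp
  have h1 : epsR p.1 = β * lieExp I G p.2 := hp
  have h2 : epsR (fun i => k * p.1 i * k⁻¹) = k * epsR p.1 * k⁻¹ := freeGroup_lift_conj k p.1 _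
  change epsR (fun i => k * p.1 i * k⁻¹) = β * lieExp I G (lieAdjoint I k p.2)
  rw [h2, h1, lieExp_lieAdjoint, ← mul_assoc, ← mul_assoc, ← mul_assoc,
    Subgroup.mem_center_iff.1 hβ k]

variable (I G) in
theorem contMDiff_conjAction (k : G) :
    ContMDiff (modelYg I g) (modelYg I g) ∞
      (conjAction I k : (Fin (2 * g) → G) × E → (Fin (2 * g) → G) × E) := by
  refine ContMDiff.prodMk (fun p => contMDiffAt_pi_iff.2 fun i => ?_)
    ((lieAdjoint I k).contDiff.contMDiff.comp contMDiff_snd)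
  exact (contMDiff_conj I k).contMDiffAt.comp p
    ((contMDiff_pi_apply (I := I) (n := ∞) i).contMDiffAt.comp p contMDiffAt_fst)

theorem pullVec_omegaForm_conj (hB : IsInvariantInnerProduct I G B) {V : Type*}
    [NormedAddCommGroup V] [NormedSpace ℝ V] {φ : V → Fin (2 * g) → G} {y : V}
    (hφ : MDifferentiableAt 𝓘(ℝ, V) (modelY I g) φ y) (k : G)
    (hφ' : MDifferentiableAt 𝓘(ℝ, V) (modelY I g) (fun z i => k * φ z i * k⁻¹) y) :
    pullVec (modelY I g) (fun z i => k * φ z i * k⁻¹) (omegaForm I G B g) y =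
      pullVec (modelY I g) φ (omegaForm I G B g) y := by
  rw [pullVec_omegaForm B hφ, pullVec_omegaForm B hφ']
  refine Finset.sum_congr rfl fun ab _ => ?_
  have ha := mdifferentiableAt_word hφ ab.1
  have hb := mdifferentiableAt_word hφ ab.2
  have hb' := mdifferentiableAt_word hφ' ab.2
  have h1 : darbouxRight I (fun z => FreeGroup.lift (fun i => k * φ z i * k⁻¹) ab.2) y =
      (lieAdjoint I k).comp (darbouxRight I (fun z => FreeGroup.lift (φ z) ab.2) y) := by
    rw [darbouxRight_eq hb', darbouxRight_eq hb]
    simp only [freeGroup_lift_conj]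
    rw [darboux_conj hb, lieAdjoint_mul, lieAdjoint_mul, ContinuousLinearMap.comp_assoc,
      ContinuousLinearMap.comp_assoc, ← ContinuousLinearMap.comp_assoc _ (lieAdjoint I k),
      ← lieAdjoint_mul, inv_mul_cancel, lieAdjoint_one, ContinuousLinearMap.id_comp]
  simp only [h1]
  simp only [freeGroup_lift_conj]
  rw [darboux_conj ha]
  congr 1
  ext u
  rw [wedgeTwo_apply', wedgeTwo_apply']
  simp only [ContinuousLinearMap.comp_apply, hB.invariant]

theorem pullback_conjAction_omegaTilde (hB : IsInvariantInnerProduct I G B) (k : G) :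
    DForm.pullback (modelYg I g) (modelYg I g) (conjAction I k) (omegaTilde I G B g) =
      omegaTilde I G B g := by
  refine eq_of_pullVec_eq fun p => ?_
  have hm := mdifferentiableAt_extChartAt_symm (mem_extChartAt_target (I := modelYg I g) p)
  set χ := extChartAt (modelYg I g) p
  have hc := (contMDiff_conjAction (g := g) I G k).mdifferentiable (by simp)
  have hcm : MDifferentiableAt 𝓘(ℝ, (Fin (2 * g) → E) × E) (modelYg I g)
    (fun z => conjAction I k (χ.symm z)) (χ p) := (hc _).comp _ hm
  have h2 : DifferentiableAt ℝ (fun z => (χ.symm z).2) (χ p) :=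
    mdifferentiableAt_iff_differentiableAt.1 hm.snd
  have h3 : fderiv ℝ (fun z => (conjAction I k (χ.symm z)).2) (χ p) =
      (lieAdjoint I k).comp (fderiv ℝ (fun z => (χ.symm z).2) (χ p)) :=
    ((lieAdjoint I k).hasFDerivAt.comp (χ p) h2.hasFDerivAt).fderiv
  rw [pullVec_pullback (hc _) hm, pullVec_omegaTilde hcm, pullVec_omegaTilde hm, h3,
    ← vectorSigma_lieAdjoint hB k (χ.symm (χ p)).2]
  exact congrArg₂ (· + ·) (pullVec_omegaForm_conj hB hm.fst k hcm.fst) rfl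

end ExtendedModuliSpace

end ExtendedModuli

end

theorem mainTheorem3 {E : Type*} [NormedAddCommGroup E] [NormedSpace ℝ E] [FiniteDimensional ℝ E]
    {H : Type*} [TopologicalSpace H] (I : ModelWithCorners ℝ E H) [I.Boundaryless]
    {G : Type*} [TopologicalSpace G] [ChartedSpace H G] [Group G] [LieGroup I ∞ G] [T2Space G]
    (B : E →L[ℝ] E →L[ℝ] ℝ) (hB : IsInvariantInnerProduct I G B)
    (g : ℕ) (β : G) (hβ : β ∈ Subgroup.center G) :
    -- the form is a smooth form on the ambient manifold
    (omegaTilde I G B g).IsSmooth (modelYg I g) ∧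
    -- its exterior derivative vanishes on the Zariski tangent spaces of the fibre product
    (∀ p ∈ extendedModuli I g β, ∀ u v w : (Fin (2 * g) → E) × E,
      u ∈ zariskiTangent I β p → v ∈ zariskiTangent I β p → w ∈ zariskiTangent I β p →
        (omegaTilde I G B g).d (modelYg I g) p ![u, v, w] = 0) ∧
    -- its pullback to every smooth manifold mapping smoothly into the fibre product is closed
    (∀ (F : Type*) [NormedAddCommGroup F] [NormedSpace ℝ F] [FiniteDimensional ℝ F]
      (N : Type*) [TopologicalSpace N] [ChartedSpace F N] [IsManifold 𝓘(ℝ, F) ∞ N]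
      (f : N → (Fin (2 * g) → G) × E), ContMDiff 𝓘(ℝ, F) (modelYg I g) ∞ f →
      (∀ n, f n ∈ extendedModuli I g β) →
        (DForm.pullback 𝓘(ℝ, F) (modelYg I g) f (omegaTilde I G B g)).IsClosed 𝓘(ℝ, F)) ∧
    -- the fibre product and the form are invariant under the action of the group
    (∀ k : G, MapsTo (conjAction I k) (extendedModuli I g β) (extendedModuli I g β)) ∧
    (∀ k : G, DForm.pullback (modelYg I g) (modelYg I g) (conjAction I k) (omegaTilde I G B g) =
      omegaTilde I G B g) := by
  refine ⟨isSmooth_omegaTilde hB, fun p hp u v w hu hv hw => ?_, ?_, ?_, ?_⟩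
  · refine (d_omegaTilde_apply hB p ![u, v, w]).trans ?_
    simp only [Matrix.cons_val_zero, Matrix.cons_val_one, Matrix.cons_val]
    rw [maurerCartan_epsR_of_mem_zariskiTangent hp hu, maurerCartan_epsR_of_mem_zariskiTangent hp hv,
      maurerCartan_epsR_of_mem_zariskiTangent hp hw, neg_add_cancel]
  · intro F _ _ _ N _ _ _ f hf hfX
    exact isClosed_pullback_omegaTilde hB hf hfX
  · exact fun k => mapsTo_conjAction hβ k
  · exact fun k => pullback_conjAction_omegaTilde hB k
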